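/- Let $c\in\mathbb R\setminus\{0\}$, $N\ge 1$, and put $$f(x,y)=\frac{x-y+ic}{x-y},\quad g(x,y)=\frac{ic}{x-y},\quad S(x)=\frac{x-ic}{x+ic},\quad \varphi(x)=\frac{2c}{c^2+x^2}.$$ **Form factors of the one-dimensional Bose gas.** Consider the Yang--Baxter algebra of the Lieb--Liniger model (operators $A,B,C,D$, normalised by the vacuum eigenvalue $d$ of $D$) with the exchange relations $$A(\mu)B(\lambda)=f(\mu,\lambda)B(\lambda)A(\mu)+g(\lambda,\mu)B(\mu)A(\lambda),\qquad D(\mu)B(\lambda)=f(\lambda,\mu)B(\lambda)D(\mu)+g(\mu,\lambda)B(\mu)D(\lambda),$$ $$C(\mu)B(\lambda)=B(\lambda)C(\mu)+g(\mu,\lambda)\bigl(A(\mu)D(\lambda)-A(\lambda)D(\mu)\bigr),$$ the vacuum $A(\lambda)|0\rangle=l(\lambda)|0\rangle$, $D(\lambda)|0\rangle=|0\rangle$, $C(\lambda)|0\rangle=0$, $\langle 0|0\rangle=1$, $\langle 0|B(\lambda)=0$, and the fields $\Psi=\Psi(0)$, $\Psi^\dagger=\Psi^\dagger(0)$ acting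 by $$\Psi\prod_{k}B(\lambda_k)|0\rangle=-i\sqrt c\sum_k l(\lambda_k)\prod_{m\ne k}f(\lambda_k,\lambda_m)\prod_{m\neq k}B(\lambda_m)|0\rangle,$$ $$\langle0|\prod_kC(\lambda_k)\Psi^\dagger=i\sqrt c\sum_k\prod_{m\ne k}f(\lambda_m,\lambda_k)\,\langle 0|\prod_{m\neq k}C(\lambda_m).$$ Evaluating by these rules, with the $4N$ quantities $\lambda^C_j,\lambda^B_j,l^C_j=l(\lambda^C_j),l^B_j=l(\lambda^B_j)$ treated as independent, defines the off-shell matrix element $$M^k_{2N}=\langle 0|\prod_{j=1}^N C(\lambda_j^C)\,(\Psi^\dagger)^k\Psi^k\prod_{j=1}^N B(\lambda_j^B)|0\rangle .$$ The on-shell form factor $\mathbb F^k_{2N}(\{\lambda^C\}|\{\lambda^B\})$ is obtained by inserting for $l^C_j$ and for $l^B_j$ the values determined by the Bethe equations $l_j\prod_{m\ne j}S(\lambda_m-\lambda_j)=1$ of the respective set of rapidities, and $$F^k_{2N}(\lambda^C_1,\dots,\lambda^C_N|\lambda^B_1,\dots,\lambda^B_N)=\Bigl(c^N\prod_{j<m}f(\lambda^B_j,\lambda^B_m)f(\lambda^C_j,\lambda^C_m)\Bigr)^{-1}\,\mathbb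 F^k_{2N}(\{\lambda^C\}|\{\lambda^B\}).$$ **Diagonal evaluations.** Let $\lambda_1,\dots,\lambda_N$ be pairwise distinct real numbers. The symmetric diagonal form factor is $$F^k_{2N,s}(\lambda_1,\dots,\lambda_N)=\lim_{\varepsilon\to0}F^k_{2N}(\lambda_1+\varepsilon,\dots,\lambda_N+\varepsilon|\lambda_N,\dots,\lambda_1).$$ The connected part $F^k_{2N,c}(\lambda_1,\dots,\lambda_N)$ is the finite part of $F^k_{2N}(\lambda_1+\varepsilon_1,\dots,\lambda_N+\varepsilon_N|\lambda_N,\dots,\lambda_1)$: if $\varepsilon_j=te_j$ with fixed non-zero $e_1,\dots,e_N\in\mathbb C$ and $t\to0$, this function has a finite limit of the form $P(e)/(e_1\cdots e_N)$ with a polynomial $P$, homogeneous of degree $N$ and independent of $e$, and $F^k_{2N,c}$ is the term of the limit without any ratios $e_i/e_j$ or products thereof, that is, the coefficient of $e_1\cdots e_N$ in $P$. **Theorem.** For $k=1,2$ and every $N\ge1$ these limits exist (the second one in the stated form), and $$F^1_{2N,s}(\lambda_1,\dots,\lambda_N)=N^2\,\mathcal G_N,\qquad F^2_{2N,s}(\lambda_1,\dots,\lambda_N)=\frac2c\,\mathcal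 G_N\sum_{i<j}(\lambda_i-\lambda_j)^2,$$ where $\mathcal G_N=\sum_{T}\prod_{\{i,j\}\in E(T)}\varphi(\lambda_i-\lambda_j)$ is the sum over all spanning trees $T$ of the complete graph on $\{1,\dots,N\}$; moreover $$F^{1}_{2N,c}(\lambda_1,\dots,\lambda_N)=\sum_{\sigma\in S_N}\varphi(\lambda_{\sigma_1}-\lambda_{\sigma_2})\varphi(\lambda_{\sigma_2}-\lambda_{\sigma_3})\cdots\varphi(\lambda_{\sigma_{N-1}}-\lambda_{\sigma_N}),$$ $$F^{2}_{2N,c}(\lambda_1,\dots,\lambda_N)=\frac1c\sum_{\sigma\in S_N}\varphi(\lambda_{\sigma_1}-\lambda_{\sigma_2})\varphi(\lambda_{\sigma_2}-\lambda_{\sigma_3})\cdots\varphi(\lambda_{\sigma_{N-1}}-\lambda_{\sigma_N})\,(\lambda_{\sigma_1}-\lambda_{\sigma_N})^2 .$$ -/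

import Mathlib

open Filter Topology

namespace BoseGas

/-- `f(x,y) = (x - y + ic)/(x - y)`. -/
noncomputable def fFun (c : ℝ) (x y : ℂ) : ℂ := (x - y + Complex.I * c) / (x - y)

/-- `g(x,y) = ic/(x - y)`. -/
noncomputable def gFun (c : ℝ) (x y : ℂ) : ℂ := Complex.I * c / (x - y)

/-- The two-particle scattering factor `S(x) = (x - ic)/(x + ic)`. -/
noncomputable def sLL (c : ℝ) (x : ℂ) : ℂ := (x - Complex.I * c) / (x + Complex.I * c)

/-- The derivative of the scattering phase, `φ(x) = 2c/(c² + x²)`. -/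
noncomputable def phi (c x : ℝ) : ℝ := 2 * c / (c ^ 2 + x ^ 2)

theorem phi_neg (c x : ℝ) : phi c (-x) = phi c x := by
  simp [phi]

/-! Off-shell Bethe vectors and the action of the monodromy matrix on them.

Particles are labelled by a type `ι`; the label `i` has rapidity `lam i` and (independent) vacuum
eigenvalue ratio `l i = a(lam i)/d(lam i)`.  All operators are normalised by `d`, so that on the
vacuum `A(i)|0⟩ = l i |0⟩`, `D(i)|0⟩ = |0⟩`, `C(i)|0⟩ = 0`.
A list `[i₁, …, iₙ]` stands for the vector `B(i₁)⋯B(iₙ)|0⟩`. -/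

section Algebra

variable {ι : Type}

/-- Formal linear combinations of words. -/
abbrev Words (ι : Type) : Type := List ι →₀ ℂ

/-- Multiplication by `B(i)` from the left. -/
noncomputable def opB (i : ι) : Words ι →ₗ[ℂ] Words ι := Finsupp.lmapDomain ℂ ℂ (List.cons i)

/-- `A(m)` moved to the vacuum through a word of `B`s with the exchange relation
`A(m)B(i) = f(m,i) B(i)A(m) + g(i,m) B(m)A(i)`. -/
noncomputable def wordA (c : ℝ) (lam l : ι → ℂ) : List ι → ι → Words ι
  | [], m => Finsupp.single [] (l m)
  | i :: w, m => fFun c (lam m) (lam i) • opB i (wordA c lam l w m)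
      + gFun c (lam i) (lam m) • opB m (wordA c lam l w i)

/-- `D(m)` moved to the vacuum through a word of `B`s with the exchange relation
`D(m)B(i) = f(i,m) B(i)D(m) + g(m,i) B(m)D(i)`. -/
noncomputable def wordD (c : ℝ) (lam : ι → ℂ) : List ι → ι → Words ι
  | [], _ => Finsupp.single [] 1
  | i :: w, m => fFun c (lam i) (lam m) • opB i (wordD c lam w m)
      + gFun c (lam m) (lam i) • opB m (wordD c lam w i)

/-- The operator `A(m)`. -/
noncomputable def opA (c : ℝ) (lam l : ι → ℂ) (m : ι) : Words ι →ₗ[ℂ] Words ι :=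
  Finsupp.linearCombination ℂ (fun w => wordA c lam l w m)

/-- `C(m)` moved to the vacuum through a word of `B`s with the exchange relation
`C(m)B(i) = B(i)C(m) + g(m,i) (A(m)D(i) - A(i)D(m))`. -/
noncomputable def wordC (c : ℝ) (lam l : ι → ℂ) : List ι → ι → Words ι
  | [], _ => 0
  | i :: w, m => opB i (wordC c lam l w m)
      + gFun c (lam m) (lam i) •
        (opA c lam l m (wordD c lam w i) - opA c lam l i (wordD c lam w m))

/-- The operator `C(m)`. -/
noncomputable def opC (c : ℝ) (lam l : ι → ℂ) (m : ι) : Words ι →ₗ[ℂ] Words ι :=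
  Finsupp.linearCombination ℂ (fun w => wordC c lam l w m)

/-- The field `Ψ = Ψ(0)` acting on Bethe vectors:
`Ψ ∏ B(k)|0⟩ = -i√c ∑ₖ l(k) ∏_{m ≠ k} f(k,m) ∏_{m ≠ k} B(m)|0⟩`. -/
noncomputable def opPsi (c : ℝ) (lam l : ι → ℂ) : Words ι →ₗ[ℂ] Words ι :=
  Finsupp.linearCombination ℂ (fun w => ∑ k : Fin w.length,
    (-Complex.I * (c : ℂ) ^ (1 / 2 : ℂ) * l (w.get k) *
        ((w.eraseIdx k).map (fun m => fFun c (lam (w.get k)) (lam m))).prod) •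
      Finsupp.single (w.eraseIdx k) 1)

/-- The field `Ψ† = Ψ†(0)` acting to the left on dual Bethe vectors, where a list `[i₁, …, iₙ]`
now stands for `⟨0|C(i₁)⋯C(iₙ)`:
`⟨0|∏ C(k) Ψ† = i√c ∑ₖ ∏_{m ≠ k} f(m,k) ⟨0|∏_{m ≠ k} C(m)`. -/
noncomputable def opPsiDag (c : ℝ) (lam : ι → ℂ) : Words ι →ₗ[ℂ] Words ι :=
  Finsupp.linearCombination ℂ (fun w => ∑ k : Fin w.length,
    (Complex.I * (c : ℂ) ^ (1 / 2 : ℂ) *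
        ((w.eraseIdx k).map (fun m => fFun c (lam m) (lam (w.get k)))).prod) •
      Finsupp.single (w.eraseIdx k) 1)

/-- The pairing of a dual Bethe vector (a combination of words of `C`s) with a Bethe vector:
the `C`s are applied one after the other and the vacuum component is read off. -/
noncomputable def pairing (c : ℝ) (lam l : ι → ℂ) (b v : Words ι) : ℂ :=
  b.sum fun w a => a * (w.foldr (fun i u => opC c lam l i u) v) []

end Algebra

/-- The off-shell matrix element
`⟨0| ∏ C(λᶜⱼ) (Ψ†)ᵏ Ψᵏ ∏ B(λᴮⱼ) |0⟩`, a function of the `4N` independent variables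
`λᶜⱼ, λᴮⱼ, lᶜⱼ, lᴮⱼ`. -/
noncomputable def offShell (c : ℝ) (k : ℕ) {N : ℕ} (lamC lamB lC lB : Fin N → ℂ) : ℂ :=
  let lam : Fin N ⊕ Fin N → ℂ := Sum.elim lamC lamB
  let l : Fin N ⊕ Fin N → ℂ := Sum.elim lC lB
  pairing c lam l
    ((opPsiDag c lam)^[k] (Finsupp.single (List.ofFn Sum.inl) 1))
    ((opPsi c lam l)^[k] (Finsupp.single (List.ofFn Sum.inr) 1))

/-- The values `lⱼ` determined by the Bethe equations `lⱼ ∏_{k ≠ j} S(λₖ - λⱼ) = 1`. -/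
noncomputable def betheL (c : ℝ) {N : ℕ} (lam : Fin N → ℂ) (j : Fin N) : ℂ :=
  (∏ k ∈ Finset.univ.erase j, sLL c (lam k - lam j))⁻¹

/-- The on-shell form factor in the normalisation of the algebraic Bethe Ansatz. -/
noncomputable def formFactorABA (c : ℝ) (k : ℕ) {N : ℕ} (lamC lamB : Fin N → ℂ) : ℂ :=
  offShell c k lamC lamB (betheL c lamC) (betheL c lamB)

/-- The form factor
`F^k_{2N}(λᶜ|λᴮ) = (c^N ∏_{j<k} fᴮⱼₖ fᶜⱼₖ)⁻¹ 𝔽^k_{2N}(λᶜ|λᴮ)`. -/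
noncomputable def formFactor (c : ℝ) (k : ℕ) {N : ℕ} (lamC lamB : Fin N → ℂ) : ℂ :=
  ((c : ℂ) ^ N * ∏ i : Fin N, ∏ j ∈ Finset.Ioi i,
      (fFun c (lamB i) (lamB j) * fFun c (lamC i) (lamC j)))⁻¹
    * formFactorABA c k lamC lamB

/-- The near-diagonal form factor
`F^k_{2N}(λ₁ + ε₁, …, λ_N + ε_N | λ_N, …, λ₁)`. -/
noncomputable def nearDiag (c : ℝ) (k : ℕ) {N : ℕ} (lam : Fin N → ℝ) (ε : Fin N → ℂ) : ℂ :=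
  formFactor c k (fun i => (lam i : ℂ) + ε i) (fun i => (lam (Fin.rev i) : ℂ))

/-- `x` is the symmetric evaluation `F^k_{2N,s}(λ)`: the limit of the near-diagonal form factor
when all shifts are equal and tend to zero. -/
def IsSymmetricDiag (c : ℝ) (k : ℕ) {N : ℕ} (lam : Fin N → ℝ) (x : ℂ) : Prop :=
  Tendsto (fun ε : ℂ => nearDiag c k lam (fun _ => ε)) (𝓝[≠] 0) (𝓝 x)

/-- `x` is the connected part `F^k_{2N,c}(λ)`.  When all the shifts go to zero with fixed non-zero
ratios, `εᵢ = t eᵢ`, the near-diagonal form factor has a finite limit; the limit is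
`P(e)/(e₁⋯e_N)` with `P` homogeneous of degree `N`, i.e. a sum of a constant and of multiples of
non-trivial products of ratios `eᵢ/eⱼ`.  The connected part is that constant, which is the
coefficient of `e₁⋯e_N` in `P`. -/
def IsConnectedDiag (c : ℝ) (k : ℕ) {N : ℕ} (lam : Fin N → ℝ) (x : ℂ) : Prop :=
  ∃ P : MvPolynomial (Fin N) ℂ, P.IsHomogeneous N ∧
    (∀ e : Fin N → ℂ, (∀ i, e i ≠ 0) →
      Tendsto (fun t : ℂ => nearDiag c k lam (fun i => t * e i)) (𝓝[≠] 0)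
        (𝓝 (MvPolynomial.eval e P / ∏ i, e i))) ∧
    P.coeff (Finsupp.equivFunOnFinite.symm (fun _ => 1)) = x

/-- The weight `φ(λᵢ - λⱼ)` of the edge `{i,j}`. -/
noncomputable def edgeWeight (c : ℝ) {N : ℕ} (lam : Fin N → ℝ) : Sym2 (Fin N) → ℝ :=
  Sym2.lift ⟨fun i j => phi c (lam i - lam j), fun i j => by
    simpa using phi_neg c (lam j - lam i)⟩

open Classical in
/-- The weighted sum over the spanning trees of the complete graph on `N` vertices. -/
noncomputable def treeSum (c : ℝ) {N : ℕ} (lam : Fin N → ℝ) : ℝ :=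
  ∑ T : SimpleGraph (Fin N) with T.IsTree, ∏ e ∈ T.edgeFinset, edgeWeight c lam e

/-- The chain `φ(λ_{σ1} - λ_{σ2}) φ(λ_{σ2} - λ_{σ3}) ⋯ φ(λ_{σ(N-1)} - λ_{σN})`, `N = n + 1`. -/
noncomputable def chain (c : ℝ) {n : ℕ} (lam : Fin (n + 1) → ℝ)
    (σ : Equiv.Perm (Fin (n + 1))) : ℝ :=
  ∏ i : Fin n, phi c (lam (σ i.castSucc) - lam (σ i.succ))

end BoseGas

set_option linter.unusedSectionVars false


namespace BoseGas

/-! ### Partial fractions and residues -/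

section PartialFractions

variable {ι : Type*} [DecidableEq ι]

/-! Algebra. A Bethe vector is probed only through functionals of its set of labels, and the
operators are transposed so as to act on such functionals (`eval_wordA`, `eval_wordC`). Sums over
ordered partitions, weighted by f over pairs from an earlier and a later piece, form an associative
product `star`. In this language Ψ is left and Ψ† is right multiplication by functionals living on
one-element sets. The functional `eigE` is reproduced by the transposed A, D and C up to insertion
of a label. Hence an operator acting on one part of its argument can be moved to the other part
(`actC_union_eigE`), and a product of C's is resolved into a closed sum over partitions
(`scalar_product`).

On shell, the Bethe equations let a factor carrying the weight ∏ l move from the left end of a star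
product to the right end, losing that weight (`BetheOn.star_lprod`). All eigenvalues disappear, and
the matrix element becomes a double sum over partitions (A', H, A) and (B', K, D) of the two sets of
rapidities, with |H| = |K| = k (`pairing_eq_doubleSum`). A residue identity changes the size of a
middle piece in two different ways. Comparing the two eliminates the middle pieces altogether: with
n = |B'| - |A|, they are replaced by the weight n²/2 for k = 1 and (n⁴ - n²)/24 for k = 2.

Analysis. The generating function in z of the sums without middle pieces is a determinant, by
Cauchy's formula (`det_eq_sum_partitions`), whose diagonal limit is taken entry by entry. After z =
e^X and a rescaling of rows and columns, the limiting matrix is M + X²B with M = `gaudin`. The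
moments of n are Taylor coefficients of its determinant, and only the orders 2 and 4 occur. Since
the leading term of B is the constant -1/c in all entries, both orders are linear in the adjugate of
M. Up to normalisation, the form factors tend to the sum of the entries of adj M with weights 1 and
(λᵢ - λⱼ)²/c (`sum_limDet`).

Combinatorics. M times diag(e) is a weighted Laplacian, so the matrix tree theorem writes adj M as a
sum over trees given by their parent functions (`adjugate_gaudin`). For e = 1 every root yields the
same sum over spanning trees. The monomial eᵢ ∏ e_{f(v)} of a tree with root j equals e₁⋯e_N exactly
if the tree is a path from i to j, and this produces the chains. -/

theorem prod_one_add_div_eq (s : Finset ι) (x d : ι → ℂ) (hx : ∀ i ∈ s, ∀ j ∈ s, i ≠ j → x i ≠ x j)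
    (m : ℂ) (hm : ∀ i ∈ s, m ≠ x i) :
    ∏ k ∈ s, (1 + d k / (m - x k)) =
      1 + ∑ i ∈ s, d i / (m - x i) * ∏ k ∈ s.erase i, (1 + d k / (x i - x k)) := by
  induction s using Finset.induction_on generalizing m with
  | empty => simp
  | insert n s hn ih =>
    have hx' : ∀ i ∈ s, ∀ j ∈ s, i ≠ j → x i ≠ x j := fun i hi j hj =>
      hx i (Finset.mem_insert_of_mem hi) j (Finset.mem_insert_of_mem hj)
    have h1 := ih hx' m (fun i hi => hm i (Finset.mem_insert_of_mem hi))
    have hnx : ∀ i ∈ s, x n ≠ x i := fun i hi =>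
      hx n (Finset.mem_insert_self _ _) i (Finset.mem_insert_of_mem hi) (by rintro rfl; exact hn hi)
    have h2 := ih hx' (x n) hnx
    rw [Finset.prod_insert hn, Finset.sum_insert hn, Finset.erase_insert hn, h2, h1]
    have h3 : ∀ i ∈ s, d i / (m - x i) * ∏ k ∈ (insert n s).erase i, (1 + d k / (x i - x k)) =
        d i / (m - x i) * (∏ k ∈ s.erase i, (1 + d k / (x i - x k))) +
        d n / (m - x n) * (d i / (m - x i) * (∏ k ∈ s.erase i, (1 + d k / (x i - x k)))) -
        d n / (m - x n) * (d i / (x n - x i) * (∏ k ∈ s.erase i, (1 + d k / (x i - x k)))) := by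
      intro i hi
      have hne : n ≠ i := by rintro rfl; exact hn hi
      rw [Finset.erase_insert_of_ne hne, Finset.prod_insert (by simp [hn])]
      have e1 : m - x i ≠ 0 := sub_ne_zero.2 (hm i (Finset.mem_insert_of_mem hi))
      have e2 : m - x n ≠ 0 := sub_ne_zero.2 (hm n (Finset.mem_insert_self _ _))
      have e3 : x n - x i ≠ 0 := sub_ne_zero.2 (hnx i hi)
      have e4 : x i - x n ≠ 0 := sub_ne_zero.2 (hnx i hi).symm
      have e5 : d i / (m - x i) * (d n / (x i - x n)) =
          d n / (m - x n) * (d i / (m - x i)) - d n / (m - x n) * (d i / (x n - x i)) := by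
        rw [← neg_sub (x n) (x i)]; field_simp; ring
      linear_combination (∏ k ∈ s.erase i, (1 + d k / (x i - x k))) * e5
    rw [Finset.sum_congr rfl h3, Finset.sum_sub_distrib, Finset.sum_add_distrib,
      ← Finset.mul_sum, ← Finset.mul_sum]
    ring

/-- This compares the coefficients of 1/m at infinity in `prod_one_add_div_eq`. The residues d may
vary with the node, as `sum_fp_erase_left` needs both signs ±ic. -/
theorem sum_residues_eq (s : Finset ι) (x d : ι → ℂ)
    (hx : ∀ i ∈ s, ∀ j ∈ s, i ≠ j → x i ≠ x j) :
    ∑ i ∈ s, d i * ∏ k ∈ s.erase i, (1 + d k / (x i - x k)) = ∑ i ∈ s, d i := by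
  induction s using Finset.induction_on with
  | empty => simp
  | insert n s hn ih =>
    have hx' : ∀ i ∈ s, ∀ j ∈ s, i ≠ j → x i ≠ x j := fun i hi j hj =>
      hx i (Finset.mem_insert_of_mem hi) j (Finset.mem_insert_of_mem hj)
    have hnx : ∀ i ∈ s, x n ≠ x i := fun i hi =>
      hx n (Finset.mem_insert_self _ _) i (Finset.mem_insert_of_mem hi) (by rintro rfl; exact hn hi)
    have h2 := prod_one_add_div_eq s x d hx' (x n) hnx
    rw [Finset.sum_insert hn, Finset.sum_insert hn, Finset.erase_insert hn, h2]
    have h3 : ∀ i ∈ s, d i * ∏ k ∈ (insert n s).erase i, (1 + d k / (x i - x k)) =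
        d i * (∏ k ∈ s.erase i, (1 + d k / (x i - x k))) -
        d n * (d i / (x n - x i) * (∏ k ∈ s.erase i, (1 + d k / (x i - x k)))) := by
      intro i hi
      have hne : n ≠ i := by rintro rfl; exact hn hi
      rw [Finset.erase_insert_of_ne hne, Finset.prod_insert (by simp [hn])]
      rw [← neg_sub (x n) (x i), div_neg]
      ring
    rw [Finset.sum_congr rfl h3, Finset.sum_sub_distrib, ih hx', ← Finset.mul_sum]
    ring

end PartialFractions

/-! ### The shuffle product of functionals of finite sets -/

section Star

variable {ι : Type} [DecidableEq ι]

/-- The product of the kernel `f` over all pairs of a member of `A` and a member of `B`. -/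
noncomputable def fp (f : ι → ι → ℂ) (A B : Finset ι) : ℂ := ∏ a ∈ A, ∏ b ∈ B, f a b

variable {f : ι → ι → ℂ}

@[simp] theorem fp_empty_left (B : Finset ι) : fp f ∅ B = 1 := by simp [fp]
@[simp] theorem fp_empty_right (A : Finset ι) : fp f A ∅ = 1 := by simp [fp]
@[simp] theorem fp_singleton_left (a : ι) (B : Finset ι) : fp f {a} B = ∏ b ∈ B, f a b := by
  simp [fp]
@[simp] theorem fp_singleton_right (A : Finset ι) (b : ι) : fp f A {b} = ∏ a ∈ A, f a b := by
  simp [fp]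
theorem fp_insert_left {a : ι} {A : Finset ι} (h : a ∉ A) (B : Finset ι) :
    fp f (insert a A) B = fp f {a} B * fp f A B := by simp [fp, Finset.prod_insert h]
theorem fp_insert_right {b : ι} {B : Finset ι} (h : b ∉ B) (A : Finset ι) :
    fp f A (insert b B) = fp f A {b} * fp f A B := by
  simp [fp, Finset.prod_insert h, Finset.prod_mul_distrib]
theorem fp_union_left {A A' : Finset ι} (h : Disjoint A A') (B : Finset ι) :
    fp f (A ∪ A') B = fp f A B * fp f A' B := by simp [fp, Finset.prod_union h]
theorem fp_union_right {B B' : Finset ι} (h : Disjoint B B') (A : Finset ι) :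
    fp f A (B ∪ B') = fp f A B * fp f A B' := by
  simp [fp, Finset.prod_union h, Finset.prod_mul_distrib]
theorem fp_erase_left {a : ι} {A : Finset ι} (h : a ∈ A) (B : Finset ι) :
    fp f A B = fp f {a} B * fp f (A.erase a) B := by
  rw [← fp_insert_left (Finset.notMem_erase a A), Finset.insert_erase h]
theorem fp_erase_right {b : ι} {B : Finset ι} (h : b ∈ B) (A : Finset ι) :
    fp f A B = fp f A {b} * fp f A (B.erase b) := by
  rw [← fp_insert_right (Finset.notMem_erase b B), Finset.insert_erase h]
theorem fp_swap (A B : Finset ι) : fp (fun i j => f j i) A B = fp f B A := Finset.prod_comm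
theorem fp_ne_zero {A B : Finset ι} (h : ∀ a ∈ A, ∀ b ∈ B, f a b ≠ 0) : fp f A B ≠ 0 :=
  Finset.prod_ne_zero_iff.2 fun a ha => Finset.prod_ne_zero_iff.2 fun b hb => h a ha b hb
theorem fp_sdiff_left {A A' : Finset ι} (h : A' ⊆ A) (B : Finset ι) :
    fp f A B = fp f A' B * fp f (A \ A') B := by
  rw [← fp_union_left Finset.disjoint_sdiff, Finset.union_sdiff_of_subset h]
theorem fp_sdiff_right {B B' : Finset ι} (h : B' ⊆ B) (A : Finset ι) :
    fp f A B = fp f A B' * fp f A (B \ B') := by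
  rw [← fp_union_right Finset.disjoint_sdiff, Finset.union_sdiff_of_subset h]

variable (f) in
/-- The shuffle product with kernel `f`. -/
noncomputable def star (F G : Finset ι → ℂ) (S : Finset ι) : ℂ :=
  ∑ A ∈ S.powerset, fp f A (S \ A) * (F A * G (S \ A))

theorem star_congr {F F' G G' : Finset ι → ℂ} {S : Finset ι} (hF : ∀ A ⊆ S, F A = F' A)
    (hG : ∀ A ⊆ S, G A = G' A) : star f F G S = star f F' G' S := by
  refine Finset.sum_congr rfl fun A hA => ?_
  rw [hF A (Finset.mem_powerset.1 hA), hG _ Finset.sdiff_subset]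

/-- Both sides run over ordered partitions of S into three pieces, weighted by f over all pairs from
an earlier and a later piece. The bijection replaces (first two pieces, first piece) by (first
piece, second piece). -/
theorem star_assoc (F G H : Finset ι → ℂ) (S : Finset ι) :
    star f (star f F G) H S = star f F (star f G H) S := by
  simp only [star, Finset.mul_sum, Finset.sum_mul]
  rw [Finset.sum_sigma', Finset.sum_sigma']
  refine Finset.sum_bij' (fun p _ => ⟨p.2, p.1 \ p.2⟩) (fun p _ => ⟨p.1 ∪ p.2, p.1⟩) ?_ ?_ ?_ ?_ ?_
  · rintro ⟨A, A'⟩ h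
    simp only [Finset.mem_sigma, Finset.mem_powerset] at h ⊢
    exact ⟨h.2.trans h.1, Finset.sdiff_subset_sdiff h.1 le_rfl⟩
  · rintro ⟨A, A'⟩ h
    simp only [Finset.mem_sigma, Finset.mem_powerset] at h ⊢
    exact ⟨Finset.union_subset h.1 (h.2.trans Finset.sdiff_subset), Finset.subset_union_left⟩
  · rintro ⟨A, A'⟩ h
    simp only [Finset.mem_sigma, Finset.mem_powerset] at h ⊢
    rw [Finset.union_sdiff_of_subset h.2]
  · rintro ⟨A, A'⟩ h
    simp only [Finset.mem_sigma, Finset.mem_powerset] at h ⊢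
    have : Disjoint A A' := (Finset.disjoint_of_subset_left h.2 Finset.sdiff_disjoint).symm
    rw [Finset.union_sdiff_cancel_left this]
  · rintro ⟨A, A'⟩ h
    simp only [Finset.mem_sigma, Finset.mem_powerset] at h ⊢
    have e : (S \ A') \ (A \ A') = S \ A := by
      ext x; simp only [Finset.mem_sdiff]; have := @h.2 x; tauto
    rw [e, fp_sdiff_left h.2, fp_sdiff_right (f := f) (A := A') (B' := A \ A') (B := S \ A')
      (Finset.sdiff_subset_sdiff h.1 le_rfl), e]
    ring

/-- The indicator function of the sets of size `k`. -/
noncomputable def sizeInd (k : ℕ) (S : Finset ι) : ℂ := if S.card = k then 1 else 0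

/-- The sign `(-1)^|S|`. -/
noncomputable def sgn (S : Finset ι) : ℂ := (-1) ^ S.card

/-- The functional supported on one-element sets with the values `h`. -/
noncomputable def single (h : ι → ℂ) (S : Finset ι) : ℂ := if S.card = 1 then ∑ a ∈ S, h a else 0

theorem single_one : single (fun _ : ι => 1) = sizeInd 1 := by
  funext S
  unfold single sizeInd
  split_ifs with h
  · simp [h]
  · rfl

theorem star_single_right (F : Finset ι → ℂ) (h : ι → ℂ) (S : Finset ι) :
    star f F (single h) S = ∑ a ∈ S, fp f (S.erase a) {a} * (F (S.erase a) * h a) := by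
  unfold star
  rw [← Finset.sum_subset (s₁ := S.image S.erase)]
  · rw [Finset.sum_image]
    · refine Finset.sum_congr rfl fun a ha => ?_
      have : S \ S.erase a = {a} := by
        ext x; simp only [Finset.mem_sdiff, Finset.mem_erase, Finset.mem_singleton]
        constructor
        · tauto
        · rintro rfl; exact ⟨ha, by simp⟩
      rw [this]; simp [single]
    · intro a ha b hb h
      exact (Finset.erase_inj S ha).1 h
  · intro A hA
    obtain ⟨a, -, rfl⟩ := Finset.mem_image.1 hA
    exact Finset.mem_powerset.2 (Finset.erase_subset _ _)
  · intro A hA hA'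
    rw [single, if_neg, mul_zero, mul_zero]
    intro h
    obtain ⟨a, ha⟩ := Finset.card_eq_one.1 h
    refine hA' (Finset.mem_image.2 ⟨a, ?_, ?_⟩)
    · exact (Finset.mem_sdiff.1 (ha ▸ Finset.mem_singleton_self a)).1
    · rw [← Finset.sdiff_singleton_eq_erase, ← ha,
        Finset.sdiff_sdiff_eq_self (Finset.mem_powerset.1 hA)]

theorem star_sizeInd_one_right (F : Finset ι → ℂ) (S : Finset ι) :
    star f F (sizeInd 1) S = ∑ a ∈ S, fp f (S.erase a) {a} * F (S.erase a) := by
  simp only [← single_one, star_single_right, mul_one]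

/-- Together with `ker_neg` this yields the mirror image of an identity by replacing c with -c. -/
theorem star_reverse (F G : Finset ι → ℂ) (S : Finset ι) :
    star (fun i j => f j i) F G S = star f G F S := by
  unfold star
  refine Finset.sum_bij' (fun A _ => S \ A) (fun A _ => S \ A) ?_ ?_ ?_ ?_ ?_
  · intro A _; simp
  · intro A _; simp
  · intro A hA; exact Finset.sdiff_sdiff_eq_self (Finset.mem_powerset.1 hA)
  · intro A hA; exact Finset.sdiff_sdiff_eq_self (Finset.mem_powerset.1 hA)
  · intro A hA
    rw [Finset.sdiff_sdiff_eq_self (Finset.mem_powerset.1 hA), fp_swap]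
    ring

theorem star_single_left (F : Finset ι → ℂ) (h : ι → ℂ) (S : Finset ι) :
    star f (single h) F S = ∑ a ∈ S, fp f {a} (S.erase a) * (F (S.erase a) * h a) := by
  rw [← star_reverse, star_single_right]
  refine Finset.sum_congr rfl fun a _ => ?_
  rw [fp_swap]

/-- The new label belongs to the first or to the second piece; its factors with the opposite piece
become weights. -/
theorem star_insert (F G : Finset ι → ℂ) {m : ι} {S : Finset ι} (hm : m ∉ S) :
    star f F G (insert m S) =
      star f (fun A => F (insert m A)) (fun B => fp f {m} B * G B) S +
        star f (fun A => fp f A {m} * F A) (fun B => G (insert m B)) S := by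
  unfold star
  rw [Finset.sum_powerset_insert hm, add_comm, ← Finset.sum_add_distrib,
    ← Finset.sum_add_distrib]
  refine Finset.sum_congr rfl fun A hA => ?_
  have hmA : m ∉ A := fun h => hm (Finset.mem_powerset.1 hA h)
  rw [Finset.insert_sdiff_insert, Finset.sdiff_insert_of_notMem hm,
    Finset.insert_sdiff_of_notMem _ hmA, fp_insert_left hmA,
    fp_insert_right (fun h => hm (Finset.mem_sdiff.1 h).1)]
  ring

end Star

end BoseGas


namespace BoseGas

/-! ### Identities for the kernels f and g -/

section Kernel

variable {ι : Type} [DecidableEq ι]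

/-- The kernel `f(λᵢ, λⱼ)` on labels. -/
noncomputable def ker (c : ℝ) (lam : ι → ℂ) (i j : ι) : ℂ := fFun c (lam i) (lam j)

/-- The kernel `g(λᵢ, λⱼ)` on labels. -/
noncomputable def gker (c : ℝ) (lam : ι → ℂ) (i j : ι) : ℂ := gFun c (lam i) (lam j)

theorem fFun_neg (c : ℝ) (x y : ℂ) : fFun (-c) x y = fFun c y x := by
  unfold fFun
  rw [← neg_div_neg_eq]; push_cast; congr 1 <;> ring

theorem gFun_neg (c : ℝ) (x y : ℂ) : gFun (-c) x y = gFun c y x := by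
  unfold gFun
  rw [← neg_div_neg_eq]; push_cast; congr 1 <;> ring

theorem gFun_swap (c : ℝ) (x y : ℂ) : gFun c y x = -gFun c x y := by
  unfold gFun
  rw [← div_neg]; congr 1; ring

variable {c : ℝ} {lam : ι → ℂ}

theorem ker_neg : ker (-c) lam = fun i j => ker c lam j i := by
  funext i j; exact fFun_neg _ _ _

theorem gker_neg (i j : ι) : gker (-c) lam i j = gker c lam j i := gFun_neg _ _ _

theorem gker_swap (i j : ι) : gker c lam j i = -gker c lam i j := gFun_swap _ _ _

theorem ker_eq (hl : Function.Injective lam) {i j : ι} (h : i ≠ j) :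
    ker c lam i j = 1 + gker c lam i j := by
  have : lam i - lam j ≠ 0 := sub_ne_zero.2 (hl.ne h)
  unfold ker gker fFun gFun; field_simp

/-- Partial fractions in λᵢ. This three-term relation is what makes the closed formulas for A and C
compatible with the exchange relations. -/
theorem gker_mul_gker (hl : Function.Injective lam) {i j k : ι} (hij : i ≠ j) (hik : i ≠ k)
    (hjk : j ≠ k) : gker c lam i j * gker c lam i k =
      gker c lam i j * gker c lam j k + gker c lam i k * gker c lam k j := by
  have h1 : lam i - lam j ≠ 0 := sub_ne_zero.2 (hl.ne hij)
  have h2 : lam i - lam k ≠ 0 := sub_ne_zero.2 (hl.ne hik)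
  have h3 : lam j - lam k ≠ 0 := sub_ne_zero.2 (hl.ne hjk)
  rw [gker_swap j k]
  unfold gker gFun; field_simp; ring

theorem fp_singleton_left_expand (hl : Function.Injective lam) {m : ι} {D : Finset ι}
    (hm : m ∉ D) : fp (ker c lam) {m} D =
      1 + ∑ j ∈ D, gker c lam m j * fp (ker c lam) {j} (D.erase j) := by
  have hmj : ∀ j ∈ D, m ≠ j := fun j hj h => hm (h ▸ hj)
  have := prod_one_add_div_eq D lam (fun _ => Complex.I * c) (fun i _ j _ h => hl.ne h) (lam m)
    (fun j hj => hl.ne (hmj j hj))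
  rw [fp_singleton_left, Finset.prod_congr rfl fun j hj => ker_eq hl (hmj j hj)]
  refine this.trans ?_
  congr 1
  refine Finset.sum_congr rfl fun j _ => ?_
  rw [fp_singleton_left]
  congr 1
  refine Finset.prod_congr rfl fun k hk => ?_
  rw [ker_eq hl (Finset.ne_of_mem_erase hk).symm]; rfl

theorem fp_singleton_right_expand (hl : Function.Injective lam) {m : ι} {D : Finset ι}
    (hm : m ∉ D) : fp (ker c lam) D {m} =
      1 + ∑ j ∈ D, gker c lam j m * fp (ker c lam) (D.erase j) {j} := by
  have := fp_singleton_left_expand (c := -c) hl hm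
  simpa only [ker_neg, fp_swap, gker_neg] using this

/-- The partial fraction expansion is evaluated at λₘ - ic, where the product is the inverse of f(D,
m), and then multiplied by f(D, m). -/
theorem sum_gker_mul_fp (hl : Function.Injective lam)
    (hf : ∀ i j, i ≠ j → ker c lam i j ≠ 0) {m : ι} {D : Finset ι} (hm : m ∉ D) :
    ∑ j ∈ D, gker c lam j m * fp (ker c lam) {j} (D.erase j) * fp (ker c lam) (D.erase j) {m} =
      fp (ker c lam) D {m} - 1 := by
  have hmj : ∀ j ∈ D, m ≠ j := fun j hj h => hm (h ▸ hj)
  have hd : ∀ j ∈ D, lam j - lam m ≠ 0 := fun j hj => sub_ne_zero.2 (hl.ne (hmj j hj).symm)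
  have hs : ∀ j ∈ D, lam j - lam m + Complex.I * c ≠ 0 := fun j hj h0 => by
    apply hf j m (hmj j hj).symm; simp [ker, fFun, h0]
  have := prod_one_add_div_eq D lam (fun _ => Complex.I * c) (fun i _ j _ h => hl.ne h)
    (lam m - Complex.I * c) (fun j hj h => hs j hj (by rw [← h]; ring))
  have h1 : (∏ k ∈ D, (1 + Complex.I * c / (lam m - Complex.I * c - lam k))) *
      fp (ker c lam) D {m} = 1 := by
    rw [fp_singleton_right, ← Finset.prod_mul_distrib]
    refine Finset.prod_eq_one fun j hj => ?_
    have e : lam m - Complex.I * c - lam j ≠ 0 := fun h => hs j hj (by linear_combination -h)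
    have := hd j hj
    unfold ker fFun
    field_simp
    ring
  rw [this] at h1
  have h2 : fp (ker c lam) D {m} - 1 = -(∑ i ∈ D, Complex.I * c / (lam m - Complex.I * c - lam i) *
      ∏ k ∈ D.erase i, (1 + Complex.I * c / (lam i - lam k))) * fp (ker c lam) D {m} := by
    linear_combination h1
  rw [h2, neg_mul, Finset.sum_mul, ← Finset.sum_neg_distrib]
  refine Finset.sum_congr rfl fun j hj => ?_
  rw [fp_erase_left hj {m}]
  have h3 : fp (ker c lam) {j} (D.erase j) =
      ∏ k ∈ D.erase j, (1 + Complex.I * c / (lam j - lam k)) := by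
    rw [fp_singleton_left]
    refine Finset.prod_congr rfl fun k hk => ?_
    rw [ker_eq hl (Finset.ne_of_mem_erase hk).symm]; rfl
  have h4 : gker c lam j m = -(Complex.I * c / (lam m - Complex.I * c - lam j) *
      fp (ker c lam) {j} {m}) := by
    have e : lam m - Complex.I * c - lam j ≠ 0 := fun h => hs j hj (by linear_combination -h)
    have := hd j hj
    simp only [fp_singleton_left, Finset.prod_singleton]
    unfold gker gFun ker fFun
    field_simp
    ring
  rw [h3, h4]; ring

/-- Sum of the residues of ∏_{u ∈ U} (1 - ic/(x - λᵤ)) ∏_{a ∈ A} (1 + ic/(x - λₐ - ic)). The nodes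
of A are shifted by ic so that every mixed factor is 1/f(a, u); multiplication by f(A, U) clears
these. The identity drives the recursions for the double sums. -/
theorem sum_fp_erase_left (hc : c ≠ 0) (hl : Function.Injective lam)
    (hf : ∀ i j, i ≠ j → ker c lam i j ≠ 0) {U A : Finset ι} (hUA : Disjoint U A) :
    ∑ j ∈ U, fp (ker c lam) (U.erase j) {j} * fp (ker c lam) A (U.erase j) =
      ((U.card : ℂ) - A.card) * fp (ker c lam) A U +
        ∑ a ∈ A, fp (ker c lam) {a} (A.erase a) * fp (ker c lam) (A.erase a) U := by
  set ε : ℂ := Complex.I * c with hε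
  have hε0 : ε ≠ 0 := mul_ne_zero Complex.I_ne_zero (by exact_mod_cast hc)
  have hUA' : ∀ u ∈ U, u ∉ A := fun u hu hA => Finset.disjoint_left.1 hUA hu hA
  have hne : ∀ u ∈ U, ∀ a ∈ A, a ≠ u := fun u hu a ha h => hUA' u hu (h ▸ ha)
  have hd : ∀ i j, i ≠ j → lam i - lam j ≠ 0 := fun i j h => sub_ne_zero.2 (hl.ne h)
  have hs : ∀ i j, i ≠ j → lam i - lam j + ε ≠ 0 := fun i j h h0 => by
    apply hf i j h; simp [ker, fFun, ← hε, h0]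
  let x : ι → ℂ := fun i => if i ∈ A then lam i + ε else lam i
  let d : ι → ℂ := fun i => if i ∈ A then ε else -ε
  have hx : ∀ i ∈ U ∪ A, ∀ j ∈ U ∪ A, i ≠ j → x i ≠ x j := by
    intro i _ j _ hij h
    simp only [x] at h
    split_ifs at h
    · exact hl.ne hij (add_right_cancel h)
    · exact hs i j hij (by linear_combination h)
    · exact hs j i hij.symm (by linear_combination -h)
    · exact hl.ne hij h
  have key := sum_residues_eq (U ∪ A) x d hx
  have hxU : ∀ u ∈ U, x u = lam u := fun u hu => if_neg (hUA' u hu)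
  have hxA : ∀ a ∈ A, x a = lam a + ε := fun a ha => if_pos ha
  have hdU : ∀ u ∈ U, d u = -ε := fun u hu => if_neg (hUA' u hu)
  have hdA : ∀ a ∈ A, d a = ε := fun a ha => if_pos ha
  have t1 : ∀ i j, i ≠ j → 1 + -ε / (lam i - lam j) = ker c lam j i := by
    intro i j h
    have h1 := hd i j h
    rw [ker_eq hl h.symm, gker_swap i j]
    unfold gker gFun; rw [← hε]; field_simp
  have t2 : ∀ i j, i ≠ j → 1 + ε / (lam i - lam j) = ker c lam i j := by
    intro i j h
    rw [ker_eq hl h]; rfl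
  have t3 : ∀ u a, a ≠ u → 1 + ε / (lam u - (lam a + ε)) = (ker c lam a u)⁻¹ := by
    intro u a h
    have h1 := hd a u h
    have h2 := hs a u h
    have h3 : lam u - (lam a + ε) ≠ 0 := fun h => h2 (by linear_combination -h)
    unfold ker fFun; rw [← hε]; field_simp; ring
  have t4 : ∀ u a, a ≠ u → 1 + -ε / (lam a + ε - lam u) = (ker c lam a u)⁻¹ := by
    intro u a h
    have h1 := hd a u h
    have h2 := hs a u h
    have h3 : lam a + ε - lam u ≠ 0 := fun h => h2 (by linear_combination h)
    unfold ker fFun; rw [← hε]; field_simp; ring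
  rw [Finset.sum_union hUA, Finset.sum_union hUA, Finset.sum_congr rfl hdU,
    Finset.sum_congr rfl hdA] at key
  have hA0 : ∀ u ∈ U, fp (ker c lam) A {u} ≠ 0 := fun u hu =>
    fp_ne_zero fun a ha b hb => hf _ _ (by rw [Finset.mem_singleton.1 hb]; exact hne u hu a ha)
  have hU0 : ∀ a ∈ A, fp (ker c lam) {a} U ≠ 0 := fun a ha =>
    fp_ne_zero fun b hb u hu => hf _ _ (by rw [Finset.mem_singleton.1 hb]; exact hne u hu a ha)
  have e1 : ∀ u ∈ U, d u * ∏ k ∈ (U ∪ A).erase u, (1 + d k / (x u - x k)) =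
      -ε * (fp (ker c lam) (U.erase u) {u} * (fp (ker c lam) A {u})⁻¹) := by
    intro u hu
    rw [Finset.erase_union_distrib, Finset.erase_eq_of_notMem (hUA' u hu), Finset.prod_union
      (Finset.disjoint_of_subset_left (Finset.erase_subset _ _) hUA), hdU u hu, hxU u hu]
    congr 2
    · rw [fp_singleton_right]
      refine Finset.prod_congr rfl fun k hk => ?_
      have hk' := Finset.mem_of_mem_erase hk
      rw [hdU k hk', hxU k hk', t1 _ _ (Finset.ne_of_mem_erase hk).symm]
    · rw [fp_singleton_right, ← Finset.prod_inv_distrib]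
      refine Finset.prod_congr rfl fun k hk => ?_
      rw [hdA k hk, hxA k hk, t3 _ _ (hne u hu k hk)]
  have e2 : ∀ a ∈ A, d a * ∏ k ∈ (U ∪ A).erase a, (1 + d k / (x a - x k)) =
      ε * (fp (ker c lam) {a} (A.erase a) * (fp (ker c lam) {a} U)⁻¹) := by
    intro a ha
    rw [Finset.erase_union_distrib, Finset.erase_eq_of_notMem
      (fun h => hne a h a ha rfl), Finset.prod_union
      (Finset.disjoint_of_subset_right (Finset.erase_subset _ _) hUA), hdA a ha, hxA a ha,
      mul_comm (∏ x ∈ U, _)]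
    congr 2
    · rw [fp_singleton_left]
      refine Finset.prod_congr rfl fun k hk => ?_
      have hk' := Finset.mem_of_mem_erase hk
      rw [hdA k hk', hxA k hk', add_sub_add_right_eq_sub, t2 _ _ (Finset.ne_of_mem_erase hk).symm]
    · rw [fp_singleton_left, ← Finset.prod_inv_distrib]
      refine Finset.prod_congr rfl fun k hk => ?_
      rw [hdU k hk, hxU k hk, t4 _ _ (hne k hk a ha)]
  rw [Finset.sum_congr rfl e1, Finset.sum_congr rfl e2, ← Finset.mul_sum, ← Finset.mul_sum,
    Finset.sum_const, Finset.sum_const, nsmul_eq_mul, nsmul_eq_mul] at key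
  have key2 : ∑ u ∈ U, fp (ker c lam) (U.erase u) {u} * (fp (ker c lam) A {u})⁻¹ =
      ((U.card : ℂ) - A.card) +
        ∑ a ∈ A, fp (ker c lam) {a} (A.erase a) * (fp (ker c lam) {a} U)⁻¹ := by
    apply mul_left_cancel₀ hε0
    linear_combination -key
  have e3 : ∀ u ∈ U, fp (ker c lam) (U.erase u) {u} * fp (ker c lam) A (U.erase u) =
      fp (ker c lam) A U * (fp (ker c lam) (U.erase u) {u} * (fp (ker c lam) A {u})⁻¹) := by
    intro u hu
    rw [fp_erase_right hu A]
    have := hA0 u hu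
    field_simp
  have e4 : ∀ a ∈ A, fp (ker c lam) {a} (A.erase a) * fp (ker c lam) (A.erase a) U =
      fp (ker c lam) A U * (fp (ker c lam) {a} (A.erase a) * (fp (ker c lam) {a} U)⁻¹) := by
    intro a ha
    rw [fp_erase_left ha U]
    have := hU0 a ha
    field_simp
  rw [Finset.sum_congr rfl e3, Finset.sum_congr rfl e4, ← Finset.mul_sum, ← Finset.mul_sum, key2]
  ring

theorem sum_fp_erase_right (hc : c ≠ 0) (hl : Function.Injective lam)
    (hf : ∀ i j, i ≠ j → ker c lam i j ≠ 0) {V A : Finset ι} (hVA : Disjoint V A) :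
    ∑ j ∈ V, fp (ker c lam) {j} (V.erase j) * fp (ker c lam) (V.erase j) A =
      ((V.card : ℂ) - A.card) * fp (ker c lam) V A +
        ∑ a ∈ A, fp (ker c lam) (A.erase a) {a} * fp (ker c lam) V (A.erase a) := by
  have := sum_fp_erase_left (c := -c) (neg_ne_zero.2 hc) hl
    (by simpa only [ker_neg] using fun i j h => hf j i h.symm) hVA
  simpa only [ker_neg, fp_swap] using this

/-- For A = ∅, `sum_fp_erase_left` says that the sum over the label split off merely counts labels,
as it would for f = 1. -/
theorem star_const_sizeInd (hc : c ≠ 0) (hl : Function.Injective lam)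
    (hf : ∀ i j, i ≠ j → ker c lam i j ≠ 0) (k : ℕ) (S : Finset ι) :
    star (ker c lam) (sizeInd k) (sizeInd 1) S = (k + 1) * sizeInd (k + 1) S := by
  rw [star_sizeInd_one_right]
  by_cases hS : S.card = k + 1
  · have h1 := sum_fp_erase_left hc hl hf (Finset.disjoint_empty_right S)
    simp only [fp_empty_left, mul_one, Finset.sum_empty, add_zero, Finset.card_empty,
      Nat.cast_zero, sub_zero] at h1
    rw [sizeInd, if_pos hS, mul_one]
    rw [hS] at h1; push_cast at h1; rw [← h1]
    refine Finset.sum_congr rfl fun a ha => ?_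
    rw [sizeInd, if_pos (by rw [Finset.card_erase_of_mem ha, hS]; rfl), mul_one]
  · rw [sizeInd, if_neg hS, mul_zero]
    refine Finset.sum_eq_zero fun a ha => ?_
    rw [sizeInd, if_neg, mul_zero]
    rw [Finset.card_erase_of_mem ha]
    have := Finset.card_pos.2 ⟨a, ha⟩
    omega

theorem star_sizeInd_const (hc : c ≠ 0) (hl : Function.Injective lam)
    (hf : ∀ i j, i ≠ j → ker c lam i j ≠ 0) (k : ℕ) (S : Finset ι) :
    star (ker c lam) (sizeInd 1) (sizeInd k) S = (k + 1) * sizeInd (k + 1) S := by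
  have := star_const_sizeInd (c := -c) (neg_ne_zero.2 hc) hl
    (by simpa only [ker_neg] using fun i j h => hf j i h.symm) k S
  rwa [ker_neg, star_reverse] at this

end Kernel

end BoseGas


namespace BoseGas

/-! ### Transposed action of A, D and C on functionals -/

section Action

variable {ι : Type} [DecidableEq ι]

/-- The action of `A(m)` on symmetric functionals of Bethe vectors. -/
noncomputable def actA (c : ℝ) (lam l : ι → ℂ) (m : ι) (Φ : Finset ι → ℂ) (S : Finset ι) : ℂ :=
  l m * fp (ker c lam) {m} S * Φ S +
    ∑ j ∈ S, l j * gker c lam j m * fp (ker c lam) {j} (S.erase j) * Φ (insert m (S.erase j))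

/-- The action of `D(m)` on symmetric functionals of Bethe vectors. -/
noncomputable def actD (c : ℝ) (lam : ι → ℂ) (m : ι) (Φ : Finset ι → ℂ) (S : Finset ι) : ℂ :=
  fp (ker c lam) S {m} * Φ S +
    ∑ j ∈ S, gker c lam m j * fp (ker c lam) (S.erase j) {j} * Φ (insert m (S.erase j))

/-- The action of `C(m)` on symmetric functionals of Bethe vectors. -/
noncomputable def actC (c : ℝ) (lam l : ι → ℂ) (m : ι) (Φ : Finset ι → ℂ) (S : Finset ι) : ℂ :=
  ∑ k ∈ S, gker c lam m k * fp (ker c lam) (S.erase k) {k} * actA c lam l m Φ (S.erase k) -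
    ∑ j ∈ S, l j * gker c lam m j * fp (ker c lam) {j} (S.erase j) *
      fp (ker c lam) (S.erase j) {m} * Φ (S.erase j)

variable {c : ℝ} {lam l : ι → ℂ}

/-- The exchange relation of D is that of A with c replaced by -c, so the results on D are inherited
from A. -/
theorem wordD_eq_wordA (w : List ι) (m : ι) :
    wordD c lam w m = wordA (-c) lam (fun _ => 1) w m := by
  induction w generalizing m with
  | nil => rfl
  | cons i w ih => rw [wordD, wordA, fFun_neg, gFun_neg, ih, ih]

theorem actD_eq_actA (m : ι) (Φ : Finset ι → ℂ) (S : Finset ι) :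
    actD c lam m Φ S = actA (-c) lam (fun _ => 1) m Φ S := by
  simp only [actD, actA, ker_neg, fp_swap, gker_neg, one_mul]

theorem insert_erase_comm {i j m : ι} {S : Finset ι} (hi : i ∉ S) (hj : j ∈ S) :
    insert m ((insert i S).erase j) = insert i (insert m (S.erase j)) := by
  have : i ≠ j := fun h => hi (h ▸ hj)
  rw [Finset.erase_insert_of_ne this, Finset.insert_comm]

/-- The recursion of `wordA` seen from the functionals. The terms that carry l j with j ∈ S match
through `gker_mul_gker`. -/
theorem actA_insert (hl : Function.Injective lam) {i m : ι} {S : Finset ι} (hi : i ∉ S)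
    (hm : m ∉ S) (him : i ≠ m) (Φ : Finset ι → ℂ) :
    actA c lam l m Φ (insert i S) =
      ker c lam m i * actA c lam l m (fun T => Φ (insert i T)) S +
        gker c lam i m * actA c lam l i (fun T => Φ (insert m T)) S := by
  unfold actA
  rw [Finset.sum_insert hi, Finset.erase_insert hi, fp_insert_right hi]
  have h : ∀ j ∈ S, l j * gker c lam j m * fp (ker c lam) {j} ((insert i S).erase j) *
        Φ (insert m ((insert i S).erase j)) =
      ker c lam m i * (l j * gker c lam j m * fp (ker c lam) {j} (S.erase j) *
        Φ (insert i (insert m (S.erase j)))) +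
      gker c lam i m * (l j * gker c lam j i * fp (ker c lam) {j} (S.erase j) *
        Φ (insert m (insert i (S.erase j)))) := by
    intro j hj
    have hij : i ≠ j := fun h => hi (h ▸ hj)
    have hmj : m ≠ j := fun h => hm (h ▸ hj)
    rw [insert_erase_comm hi hj, Finset.erase_insert_of_ne hij, fp_insert_right (by simp [hi]),
      Finset.insert_comm m i]
    have h1 := gker_mul_gker (c := c) hl hmj.symm hij.symm him.symm
    have h2 : fp (ker c lam) {j} {i} = ker c lam j i := by simp
    rw [h2, ker_eq hl hij.symm, ker_eq hl him.symm]
    linear_combination (l j * fp (ker c lam) {j} (S.erase j) *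
      Φ (insert i (insert m (S.erase j)))) * h1
  rw [Finset.sum_congr rfl h, Finset.sum_add_distrib, ← Finset.mul_sum, ← Finset.mul_sum]
  have h2 : fp (ker c lam) {m} {i} = ker c lam m i := by simp
  rw [h2]; ring

/-- Counterpart of the relation between C(m) and B(i). Transposition reverses products, so A(m)D(i)
appears with the action of A inside that of D. -/
theorem actC_insert (hl : Function.Injective lam) {i m : ι} {S : Finset ι} (hi : i ∉ S)
    (hm : m ∉ S) (him : i ≠ m) (Φ : Finset ι → ℂ) :
    actC c lam l m Φ (insert i S) = actC c lam l m (fun T => Φ (insert i T)) S +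
      gker c lam m i * (actD c lam i (actA c lam l m Φ) S - actD c lam m (actA c lam l i Φ) S) := by
  have gmi : gker c lam i m = -gker c lam m i := gker_swap _ _
  unfold actC actD
  rw [Finset.sum_insert hi, Finset.sum_insert hi, Finset.erase_insert hi]
  have h1 : ∀ k ∈ S, gker c lam m k * fp (ker c lam) ((insert i S).erase k) {k} *
        actA c lam l m Φ ((insert i S).erase k) =
      gker c lam m k * fp (ker c lam) (S.erase k) {k} *
        actA c lam l m (fun T => Φ (insert i T)) (S.erase k) +
      gker c lam m i * (gker c lam i k * fp (ker c lam) (S.erase k) {k} *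
        actA c lam l m Φ (insert i (S.erase k))) -
      gker c lam m i * (gker c lam m k * fp (ker c lam) (S.erase k) {k} *
        actA c lam l i Φ (insert m (S.erase k))) := by
    intro k hk
    have hik : i ≠ k := fun h => hi (h ▸ hk)
    have hmk : m ≠ k := fun h => hm (h ▸ hk)
    have hi' : i ∉ S.erase k := fun h => hi (Finset.mem_of_mem_erase h)
    have hm' : m ∉ S.erase k := fun h => hm (Finset.mem_of_mem_erase h)
    rw [Finset.erase_insert_of_ne hik, fp_insert_left hi', actA_insert hl hi' hm' him,
      actA_insert hl hm' hi' him.symm]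
    have h2 : fp (ker c lam) {i} {k} = ker c lam i k := by simp
    have h1 := gker_mul_gker (c := c) hl hmk him.symm hik.symm
    rw [gker_swap i k] at h1
    rw [h2, ker_eq hl hik, ker_eq hl him.symm, ker_eq hl him, gmi]
    set X := actA c lam l m (fun T => Φ (insert i T)) (S.erase k)
    set Y := actA c lam l i (fun T => Φ (insert m T)) (S.erase k)
    linear_combination (fp (ker c lam) (S.erase k) {k} *
      ((gker c lam m i + 1) * X - gker c lam m i * Y)) * h1
  have h2 : ∀ j ∈ S, l j * gker c lam m j * fp (ker c lam) {j} ((insert i S).erase j) *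
        fp (ker c lam) ((insert i S).erase j) {m} * Φ ((insert i S).erase j) =
      l j * gker c lam m j * fp (ker c lam) {j} (S.erase j) *
        fp (ker c lam) (S.erase j) {m} * Φ (insert i (S.erase j)) +
      gker c lam m i * (fp (ker c lam) S {m} *
        (l j * gker c lam j i * fp (ker c lam) {j} (S.erase j) * Φ (insert i (S.erase j)))) := by
    intro j hj
    have hij : i ≠ j := fun h => hi (h ▸ hj)
    have hmj : m ≠ j := fun h => hm (h ▸ hj)
    have hi' : i ∉ S.erase j := fun h => hi (Finset.mem_of_mem_erase h)
    rw [Finset.erase_insert_of_ne hij, fp_insert_left hi', fp_insert_right hi',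
      fp_erase_left hj {m}]
    have h2 : fp (ker c lam) {j} {i} = ker c lam j i := by simp
    have h3 : fp (ker c lam) {j} {m} = ker c lam j m := by simp
    have h4 : fp (ker c lam) {i} {m} = ker c lam i m := by simp
    have h1 := gker_mul_gker (c := c) hl hmj him.symm hij.symm
    have h5 : gker c lam j i = -gker c lam i j := gker_swap _ _
    have h6 : gker c lam j m = -gker c lam m j := gker_swap _ _
    rw [h2, h3, h4, ker_eq hl hij.symm, ker_eq hl hmj.symm, ker_eq hl him, gmi, h6]
    rw [h5] at h1 ⊢
    linear_combination (l j * fp (ker c lam) {j} (S.erase j) *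
      fp (ker c lam) (S.erase j) {m} * Φ (insert i (S.erase j))) * (-h1)
  rw [Finset.sum_congr rfl h1, Finset.sum_congr rfl h2, Finset.sum_sub_distrib,
    Finset.sum_add_distrib, Finset.sum_add_distrib, ← Finset.mul_sum, ← Finset.mul_sum,
    ← Finset.mul_sum, ← Finset.mul_sum]
  have h3 : actA c lam l i Φ S = l i * fp (ker c lam) {i} S * Φ S +
    ∑ j ∈ S, l j * gker c lam j i * fp (ker c lam) {j} (S.erase j) * Φ (insert i (S.erase j)) := rfl
  rw [h3]
  ring

/-- Only words without repetitions made of the available letters occur. The commutativity of the B's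
enters solely through the assumption that L sees such a word as a set. -/
theorem eval_wordA (hl : Function.Injective lam) (w : List ι) (m : ι) (hw : (m :: w).Nodup)
    (L : Words ι →ₗ[ℂ] ℂ) (Φ : Finset ι → ℂ)
    (hL : ∀ u : List ι, u.Nodup → u ⊆ m :: w → L (Finsupp.single u 1) = Φ u.toFinset) :
    L (wordA c lam l w m) = actA c lam l m Φ w.toFinset := by
  induction w generalizing m L Φ with
  | nil =>
    have h := hL [] List.nodup_nil (by simp)
    have : (Finsupp.single ([] : List ι) (l m) : Words ι) = l m • Finsupp.single [] 1 := by simp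
    rw [wordA, this, map_smul, h]
    simp [actA]
  | cons i w ih =>
    have hiw : i ∉ w := (List.nodup_cons.1 (List.nodup_cons.1 hw).2).1
    have hmw : m ∉ w := fun h => (List.nodup_cons.1 hw).1 (List.mem_cons_of_mem _ h)
    have him : i ≠ m := fun h => (List.nodup_cons.1 hw).1 (h ▸ List.mem_cons_self)
    have hwn : w.Nodup := (List.nodup_cons.1 (List.nodup_cons.1 hw).2).2
    have key : ∀ a b : ι, a ≠ b → a ∉ w → b ∉ w → (∀ x ∈ a :: b :: w, x ∈ m :: i :: w) →
        L (opB a (wordA c lam l w b)) = actA c lam l b (fun T => Φ (insert a T)) w.toFinset := by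
      intro a b hab ha hb hsub
      have := ih b (List.nodup_cons.2 ⟨hb, hwn⟩) (L ∘ₗ opB a) (fun T => Φ (insert a T)) ?_
      · exact this
      · intro u hu hus
        have hau : a ∉ u := fun h => by
          rcases List.mem_cons.1 (hus h) with h | h
          · exact hab h
          · exact ha h
        have h1 : opB a (Finsupp.single u 1 : Words ι) = Finsupp.single (a :: u) 1 := by
          simp [opB, Finsupp.lmapDomain_apply, Finsupp.mapDomain_single]
        rw [LinearMap.comp_apply, h1, hL (a :: u) (List.nodup_cons.2 ⟨hau, hu⟩)]
        · simp
        · intro x hx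
          rcases List.mem_cons.1 hx with rfl | hx
          · exact hsub _ List.mem_cons_self
          · exact hsub _ (List.mem_cons_of_mem _ (hus hx))
    rw [wordA, map_add, map_smul, map_smul, key i m him hiw hmw (by simp; tauto),
      key m i him.symm hmw hiw (by simp), List.toFinset_cons,
      actA_insert hl (by simpa using hiw) (by simpa using hmw) him]
    rfl

theorem eval_wordD (hl : Function.Injective lam) (w : List ι) (m : ι) (hw : (m :: w).Nodup)
    (L : Words ι →ₗ[ℂ] ℂ) (Φ : Finset ι → ℂ)
    (hL : ∀ u : List ι, u.Nodup → u ⊆ m :: w → L (Finsupp.single u 1) = Φ u.toFinset) :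
    L (wordD c lam w m) = actD c lam m Φ w.toFinset := by
  rw [wordD_eq_wordA, actD_eq_actA, eval_wordA hl w m hw L Φ hL]

theorem opA_single (m : ι) (u : List ι) :
    opA c lam l m (Finsupp.single u 1) = wordA c lam l u m := by
  simp [opA]

theorem opC_single (m : ι) (u : List ι) :
    opC c lam l m (Finsupp.single u 1) = wordC c lam l u m := by
  simp [opC]

theorem eval_wordC (hl : Function.Injective lam) (w : List ι) (m : ι) (hw : (m :: w).Nodup)
    (L : Words ι →ₗ[ℂ] ℂ) (Φ : Finset ι → ℂ)
    (hL : ∀ u : List ι, u.Nodup → u ⊆ m :: w → L (Finsupp.single u 1) = Φ u.toFinset) :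
    L (wordC c lam l w m) = actC c lam l m Φ w.toFinset := by
  induction w generalizing m L Φ with
  | nil => simp [wordC, actC]
  | cons i w ih =>
    have hiw : i ∉ w := (List.nodup_cons.1 (List.nodup_cons.1 hw).2).1
    have hmw : m ∉ w := fun h => (List.nodup_cons.1 hw).1 (List.mem_cons_of_mem _ h)
    have him : i ≠ m := fun h => (List.nodup_cons.1 hw).1 (h ▸ List.mem_cons_self)
    have hwn : w.Nodup := (List.nodup_cons.1 (List.nodup_cons.1 hw).2).2
    have key : ∀ a b : ι, a ≠ b → a ∉ w → b ∉ w → (∀ x ∈ a :: b :: w, x ∈ m :: i :: w) →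
        L (opA c lam l a (wordD c lam w b)) = actD c lam b (actA c lam l a Φ) w.toFinset := by
      intro a b hab ha hb hsub
      refine eval_wordD hl w b (List.nodup_cons.2 ⟨hb, hwn⟩) (L ∘ₗ opA c lam l a) _ ?_
      intro u hu hus
      have hau : a ∉ u := fun h => by
        rcases List.mem_cons.1 (hus h) with h | h
        · exact hab h
        · exact ha h
      rw [LinearMap.comp_apply, opA_single]
      refine eval_wordA hl u a (List.nodup_cons.2 ⟨hau, hu⟩) L Φ fun v hv hvs => hL v hv ?_
      intro x hx
      rcases List.mem_cons.1 (hvs hx) with rfl | hx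
      · exact hsub _ List.mem_cons_self
      · exact hsub _ (List.mem_cons_of_mem _ (hus hx))
    have h1 : L (opB i (wordC c lam l w m)) =
        actC c lam l m (fun T => Φ (insert i T)) w.toFinset := by
      refine ih m (List.nodup_cons.2 ⟨hmw, hwn⟩) (L ∘ₗ opB i) _ ?_
      intro u hu hus
      have hau : i ∉ u := fun h => by
        rcases List.mem_cons.1 (hus h) with h | h
        · exact him h
        · exact hiw h
      have h1 : opB i (Finsupp.single u 1 : Words ι) = Finsupp.single (i :: u) 1 := by
        simp [opB, Finsupp.lmapDomain_apply, Finsupp.mapDomain_single]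
      rw [LinearMap.comp_apply, h1, hL (i :: u) (List.nodup_cons.2 ⟨hau, hu⟩)]
      · simp
      · intro x hx
        rcases List.mem_cons.1 hx with rfl | hx
        · simp
        · have := hus hx
          simp only [List.mem_cons] at this ⊢
          tauto
    rw [wordC, map_add, map_smul, map_sub, h1, key m i him.symm hmw hiw (by simp),
      key i m him hiw hmw (by simp; tauto), List.toFinset_cons,
      actC_insert hl (by simpa using hiw) (by simpa using hmw) him]
    rfl

/-- The leftmost C acts last on the vector and therefore first on the functional: `foldr` turns into
`foldl`. -/
theorem eval_foldr_opC (hl : Function.Injective lam) (cs w : List ι) (hw : (cs ++ w).Nodup)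
    (L : Words ι →ₗ[ℂ] ℂ) (Φ : Finset ι → ℂ)
    (hL : ∀ u : List ι, u.Nodup → u ⊆ cs ++ w → L (Finsupp.single u 1) = Φ u.toFinset) :
    L (cs.foldr (fun i u => opC c lam l i u) (Finsupp.single w 1)) =
      cs.foldl (fun Ψ i => actC c lam l i Ψ) Φ w.toFinset := by
  induction cs generalizing L Φ with
  | nil => exact hL w hw (by simp)
  | cons i cs ih =>
    rw [List.cons_append] at hw
    rw [List.foldr_cons, List.foldl_cons]
    refine ih (List.nodup_cons.1 hw).2 (L ∘ₗ opC c lam l i) _ ?_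
    intro u hu hus
    rw [LinearMap.comp_apply, opC_single]
    refine eval_wordC hl u i (List.nodup_cons.2 ⟨fun h => (List.nodup_cons.1 hw).1 (hus h), hu⟩)
      L Φ fun v hv hvs => hL v hv ?_
    intro x hx
    rcases List.mem_cons.1 (hvs hx) with rfl | hx
    · simp
    · exact List.mem_cons_of_mem _ (hus hx)

end Action

end BoseGas


namespace BoseGas

/-! ### Linearity of the shuffle product and weighted removal of a label -/

section StarLinear

variable {ι : Type} [DecidableEq ι] {f : ι → ι → ℂ}

theorem star_add_left (F F' G : Finset ι → ℂ) (S : Finset ι) :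
    star f (fun A => F A + F' A) G S = star f F G S + star f F' G S := by
  simp only [star, ← Finset.sum_add_distrib]
  exact Finset.sum_congr rfl fun A _ => by ring

theorem star_add_right (F G G' : Finset ι → ℂ) (S : Finset ι) :
    star f F (fun A => G A + G' A) S = star f F G S + star f F G' S := by
  simp only [star, ← Finset.sum_add_distrib]
  exact Finset.sum_congr rfl fun A _ => by ring

theorem star_mul_left (a : ℂ) (F G : Finset ι → ℂ) (S : Finset ι) :
    star f (fun A => a * F A) G S = a * star f F G S := by
  simp only [star, Finset.mul_sum]
  exact Finset.sum_congr rfl fun A _ => by ring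

theorem star_mul_right (a : ℂ) (F G : Finset ι → ℂ) (S : Finset ι) :
    star f F (fun A => a * G A) S = a * star f F G S := by
  simp only [star, Finset.mul_sum]
  exact Finset.sum_congr rfl fun A _ => by ring

theorem fp_mul_star_left (m : ι) (F G : Finset ι → ℂ) (S : Finset ι) :
    fp f {m} S * star f F G S =
      star f (fun A => fp f {m} A * F A) (fun A => fp f {m} A * G A) S := by
  simp only [star, Finset.mul_sum]
  refine Finset.sum_congr rfl fun A hA => ?_
  rw [fp_sdiff_right (Finset.mem_powerset.1 hA) {m}]; ring

theorem fp_mul_star_right (m : ι) (F G : Finset ι → ℂ) (S : Finset ι) :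
    fp f S {m} * star f F G S =
      star f (fun A => fp f A {m} * F A) (fun A => fp f A {m} * G A) S := by
  simp only [star, Finset.mul_sum]
  refine Finset.sum_congr rfl fun A hA => ?_
  rw [fp_sdiff_left (Finset.mem_powerset.1 hA) {m}]; ring

/-- The sum over j is left multiplication by a functional on one-element sets; associativity lets it
act on the left factor alone. -/
theorem sum_mul_star_left (h : ι → ℂ) (F G : Finset ι → ℂ) (S : Finset ι) :
    ∑ j ∈ S, h j * fp f {j} (S.erase j) * star f F G (S.erase j) =
      star f (fun D => ∑ j ∈ D, h j * fp f {j} (D.erase j) * F (D.erase j)) G S := by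
  have h1 := star_single_left (f := f) (star f F G) h S
  rw [← star_assoc] at h1
  calc _ = ∑ a ∈ S, fp f {a} (S.erase a) * (star f F G (S.erase a) * h a) :=
        Finset.sum_congr rfl fun _ _ => by ring
    _ = _ := h1.symm
    _ = _ := star_congr (fun A _ => by
        rw [star_single_left]; exact Finset.sum_congr rfl fun _ _ => by ring) fun _ _ => rfl

theorem sum_mul_star_right (h : ι → ℂ) (F G : Finset ι → ℂ) (S : Finset ι) :
    ∑ j ∈ S, h j * fp f (S.erase j) {j} * star f F G (S.erase j) =
      star f F (fun D => ∑ j ∈ D, h j * fp f (D.erase j) {j} * G (D.erase j)) S := by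
  have h1 := star_single_right (f := f) (star f F G) h S
  rw [star_assoc] at h1
  calc _ = ∑ a ∈ S, fp f (S.erase a) {a} * (star f F G (S.erase a) * h a) :=
        Finset.sum_congr rfl fun _ _ => by ring
    _ = _ := h1.symm
    _ = _ := star_congr (fun _ _ => rfl) (fun A _ => by
        rw [star_single_right]; exact Finset.sum_congr rfl fun _ _ => by ring)

end StarLinear

/-! ### The functional `eigE` under A, D and C -/

section Eigen

variable {ι : Type} [DecidableEq ι]

/-- The multiplicative functional with the values `x`. -/
noncomputable def lprod (x : ι → ℂ) (S : Finset ι) : ℂ := ∏ j ∈ S, x j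

theorem lprod_insert (x : ι → ℂ) {m : ι} {S : Finset ι} (h : m ∉ S) :
    lprod x (insert m S) = x m * lprod x S := Finset.prod_insert h

theorem lprod_erase (x : ι → ℂ) {m : ι} {S : Finset ι} (h : m ∈ S) :
    x m * lprod x (S.erase m) = lprod x S := Finset.mul_prod_erase _ _ h

theorem sgn_eq_lprod : (sgn : Finset ι → ℂ) = lprod fun _ => -1 := by
  funext S; simp [sgn, lprod]

theorem sgn_erase {m : ι} {S : Finset ι} (h : m ∈ S) : sgn (S.erase m) = -sgn S := by
  have := lprod_erase (fun _ => -1) h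
  rw [← sgn_eq_lprod] at this; linear_combination -this

theorem sgn_insert {m : ι} {S : Finset ι} (h : m ∉ S) : sgn (insert m S) = -sgn S := by
  rw [sgn_eq_lprod, lprod_insert _ h]; ring

theorem sgn_mul_self (S : Finset ι) : sgn S * sgn S = 1 := by
  simp [sgn, ← mul_pow]

variable {c : ℝ} {lam l : ι → ℂ}

theorem sum_gker_left (hl : Function.Injective lam) {m : ι} {D : Finset ι} (hm : m ∉ D) :
    ∑ j ∈ D, gker c lam j m * fp (ker c lam) {j} (D.erase j) = 1 - fp (ker c lam) {m} D := by
  rw [fp_singleton_left_expand hl hm]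
  simp only [gker_swap m, neg_mul, Finset.sum_neg_distrib]; ring

theorem sum_gker_right (hl : Function.Injective lam) {m : ι} {D : Finset ι} (hm : m ∉ D) :
    ∑ j ∈ D, gker c lam m j * fp (ker c lam) (D.erase j) {j} = 1 - fp (ker c lam) D {m} := by
  rw [fp_singleton_right_expand hl hm]
  have : ∀ j, gker c lam m j = -gker c lam j m := fun j => gker_swap _ _
  simp only [this, neg_mul, Finset.sum_neg_distrib]; ring

/-- The two possible places of m split the functional into two star products. In each, the sum over
j acts on the first factor only, where it is evaluated by `sum_gker_left` or by `sum_gker_mul_fp`.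
General values y are kept because D needs the roles of the two factors exchanged. -/
theorem actA_star (hl : Function.Injective lam) (hf : ∀ i j, i ≠ j → ker c lam i j ≠ 0)
    (x y : ι → ℂ) {m : ι} {S : Finset ι} (hm : m ∉ S) :
    actA c lam x m (star (ker c lam) (lprod x) (lprod y)) S =
      star (ker c lam) (lprod x) (lprod y) (insert m S) -
        y m * star (ker c lam) (lprod x) (lprod y) S := by
  have hins : ∀ T ⊆ S, star (ker c lam) (lprod x) (lprod y) (insert m T) =
      star (ker c lam) (fun A => x m * lprod x A) (fun B => fp (ker c lam) {m} B * lprod y B) T +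
        star (ker c lam) (fun A => fp (ker c lam) A {m} * lprod x A)
          (fun B => y m * lprod y B) T := by
    intro T hT
    have hmT : m ∉ T := fun h => hm (hT h)
    rw [star_insert _ _ hmT]
    congr 1
    · exact star_congr (fun A hA => lprod_insert x fun h => hmT (hA h)) fun _ _ => rfl
    · exact star_congr (fun _ _ => rfl) fun A hA => lprod_insert y fun h => hmT (hA h)
  have h1 : ∀ j ∈ S, x j * gker c lam j m * fp (ker c lam) {j} (S.erase j) *
      star (ker c lam) (lprod x) (lprod y) (insert m (S.erase j)) =
      (x j * gker c lam j m) * fp (ker c lam) {j} (S.erase j) * star (ker c lam)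
        (fun A => x m * lprod x A) (fun B => fp (ker c lam) {m} B * lprod y B) (S.erase j) +
      (x j * gker c lam j m) * fp (ker c lam) {j} (S.erase j) * star (ker c lam)
        (fun A => fp (ker c lam) A {m} * lprod x A) (fun B => y m * lprod y B) (S.erase j) := by
    intro j _
    rw [hins _ (Finset.erase_subset _ _)]; ring
  rw [actA, Finset.sum_congr rfl h1, Finset.sum_add_distrib, sum_mul_star_left, sum_mul_star_left,
    hins S le_rfl, mul_assoc, fp_mul_star_left, ← star_mul_left]
  have e1 : star (ker c lam) (fun D => ∑ j ∈ D, x j * gker c lam j m *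
        fp (ker c lam) {j} (D.erase j) * (x m * lprod x (D.erase j)))
        (fun B => fp (ker c lam) {m} B * lprod y B) S =
      star (ker c lam) (fun D => x m * lprod x D + -1 * (x m * (fp (ker c lam) {m} D * lprod x D)))
        (fun B => fp (ker c lam) {m} B * lprod y B) S := by
    refine star_congr (fun D hD => ?_) fun _ _ => rfl
    have h2 := sum_gker_left (c := c) hl (fun h => hm (hD h))
    have : x m * lprod x D + -1 * (x m * (fp (ker c lam) {m} D * lprod x D)) =
      x m * lprod x D * (1 - fp (ker c lam) {m} D) := by ring
    rw [this, ← h2, Finset.mul_sum]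
    refine Finset.sum_congr rfl fun j hj => ?_
    rw [← lprod_erase x hj]; ring
  have e2 : star (ker c lam) (fun D => ∑ j ∈ D, x j * gker c lam j m *
        fp (ker c lam) {j} (D.erase j) * (fp (ker c lam) (D.erase j) {m} * lprod x (D.erase j)))
        (fun B => y m * lprod y B) S =
      star (ker c lam) (fun D => fp (ker c lam) D {m} * lprod x D + -1 * lprod x D)
        (fun B => y m * lprod y B) S := by
    refine star_congr (fun D hD => ?_) fun _ _ => rfl
    have h2 := sum_gker_mul_fp (c := c) hl hf (fun h => hm (hD h))
    have : fp (ker c lam) D {m} * lprod x D + -1 * lprod x D =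
      lprod x D * (fp (ker c lam) D {m} - 1) := by ring
    rw [this, ← h2, Finset.mul_sum]
    refine Finset.sum_congr rfl fun j hj => ?_
    rw [← lprod_erase x hj]; ring
  rw [e1, e2, star_add_left, star_add_left, star_mul_left (-1), star_mul_left (-1),
    star_mul_right (y m) (lprod x)]
  ring

/-- The functional `∑ l(A) (-1)^|B| f(A, B)` over ordered partitions. -/
noncomputable def eigE (c : ℝ) (lam l : ι → ℂ) : Finset ι → ℂ := star (ker c lam) (lprod l) sgn

theorem actA_eigE (hl : Function.Injective lam) (hf : ∀ i j, i ≠ j → ker c lam i j ≠ 0)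
    {m : ι} {S : Finset ι} (hm : m ∉ S) :
    actA c lam l m (eigE c lam l) S = eigE c lam l S + eigE c lam l (insert m S) := by
  rw [eigE, sgn_eq_lprod, actA_star hl hf _ _ hm]; ring

theorem actD_eigE (hl : Function.Injective lam) (hf : ∀ i j, i ≠ j → ker c lam i j ≠ 0)
    {m : ι} {S : Finset ι} (hm : m ∉ S) :
    actD c lam m (eigE c lam l) S = l m * eigE c lam l S - eigE c lam l (insert m S) := by
  have hf' : ∀ i j, i ≠ j → ker (-c) lam i j ≠ 0 := by
    simpa only [ker_neg] using fun i j h => hf j i h.symm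
  -- At -c the kernel is reversed, so the sign stands in the first factor; taking -1 as eigenvalues
  -- turns the action of A into minus that of D.
  have h := actA_star hl hf' (fun _ => -1) l hm
  have e : star (ker (-c) lam) (lprod fun _ => -1) (lprod l) = eigE c lam l := by
    funext T; rw [ker_neg, star_reverse, eigE, sgn_eq_lprod]
  rw [e] at h
  have h2 : actA (-c) lam (fun _ => -1) m (eigE c lam l) S = -actD c lam m (eigE c lam l) S := by
    rw [actD_eq_actA]; simp only [actA, neg_mul, one_mul, Finset.sum_neg_distrib]; ring
  rw [h2] at h; linear_combination -h

/-- The inner A splits `eigE` into two terms. The one with m inserted is completed to the action of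
D; the other one and the subtracted sum both produce the star product with f(B, m) on the sign
factor, which cancels. -/
theorem actC_eigE (hl : Function.Injective lam) (hf : ∀ i j, i ≠ j → ker c lam i j ≠ 0)
    {m : ι} {S : Finset ι} (hm : m ∉ S) :
    actC c lam l m (eigE c lam l) S =
      (l m - 1) * eigE c lam l S - eigE c lam l (insert m S) := by
  have hD := actD_eigE (l := l) hl hf hm
  unfold actD at hD
  unfold actC
  have h1 : ∀ k ∈ S, gker c lam m k * fp (ker c lam) (S.erase k) {k} *
      actA c lam l m (eigE c lam l) (S.erase k) =
      gker c lam m k * fp (ker c lam) (S.erase k) {k} * eigE c lam l (S.erase k) +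
      gker c lam m k * fp (ker c lam) (S.erase k) {k} * eigE c lam l (insert m (S.erase k)) := by
    intro k _
    rw [actA_eigE hl hf (fun h => hm (Finset.mem_of_mem_erase h))]; ring
  rw [Finset.sum_congr rfl h1, Finset.sum_add_distrib]
  have h2 : ∑ k ∈ S, gker c lam m k * fp (ker c lam) (S.erase k) {k} * eigE c lam l (S.erase k) =
      -1 * eigE c lam l S +
        star (ker c lam) (lprod l) (fun B => fp (ker c lam) B {m} * sgn B) S := by
    unfold eigE
    rw [sum_mul_star_right, ← star_mul_right, ← star_add_right]
    refine star_congr (fun _ _ => rfl) fun D hD => ?_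
    have := sum_gker_right (c := c) hl (fun h => hm (hD h))
    have e : -1 * sgn D + fp (ker c lam) D {m} * sgn D =
      -sgn D * (1 - fp (ker c lam) D {m}) := by ring
    rw [e, ← this, Finset.mul_sum]
    refine Finset.sum_congr rfl fun j hj => ?_
    rw [sgn_erase hj]; ring
  have h3 : ∑ j ∈ S, l j * gker c lam m j * fp (ker c lam) {j} (S.erase j) *
      fp (ker c lam) (S.erase j) {m} * eigE c lam l (S.erase j) =
      -1 * (fp (ker c lam) S {m} * eigE c lam l S) +
        star (ker c lam) (lprod l) (fun B => fp (ker c lam) B {m} * sgn B) S := by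
    unfold eigE
    have : ∀ j ∈ S, l j * gker c lam m j * fp (ker c lam) {j} (S.erase j) *
        fp (ker c lam) (S.erase j) {m} * star (ker c lam) (lprod l) sgn (S.erase j) =
        (l j * gker c lam m j) * fp (ker c lam) {j} (S.erase j) *
        star (ker c lam) (fun A => fp (ker c lam) A {m} * lprod l A)
          (fun A => fp (ker c lam) A {m} * sgn A) (S.erase j) := by
      intro j _
      rw [← fp_mul_star_right]; ring
    rw [Finset.sum_congr rfl this, sum_mul_star_left, fp_mul_star_right, ← star_mul_left,
      ← star_add_left]
    refine star_congr (fun D hD => ?_) fun _ _ => rfl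
    have := sum_gker_mul_fp (c := c) hl hf (fun h => hm (hD h))
    have e : -1 * (fp (ker c lam) D {m} * lprod l D) + lprod l D =
      -lprod l D * (fp (ker c lam) D {m} - 1) := by ring
    rw [e, ← this, Finset.mul_sum]
    refine Finset.sum_congr rfl fun j hj => ?_
    rw [← lprod_erase l hj, gker_swap j m]; ring
  rw [h2, h3]
  linear_combination hD

end Eigen

end BoseGas


namespace BoseGas

/-! ### Moving operators between the two parts of the argument of `eigE` -/

section Transposition

variable {ι : Type} [DecidableEq ι] {c : ℝ} {lam l : ι → ℂ}

theorem actA_congr {m : ι} {Φ Φ' : Finset ι → ℂ} {S : Finset ι} (h0 : Φ S = Φ' S)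
    (h : ∀ j ∈ S, Φ (insert m (S.erase j)) = Φ' (insert m (S.erase j))) :
    actA c lam l m Φ S = actA c lam l m Φ' S := by
  unfold actA
  rw [h0, Finset.sum_congr rfl fun j hj => by rw [h j hj]]

theorem actD_congr {m : ι} {Φ Φ' : Finset ι → ℂ} {S : Finset ι} (h0 : Φ S = Φ' S)
    (h : ∀ j ∈ S, Φ (insert m (S.erase j)) = Φ' (insert m (S.erase j))) :
    actD c lam m Φ S = actD c lam m Φ' S := by
  unfold actD
  rw [h0, Finset.sum_congr rfl fun j hj => by rw [h j hj]]

theorem card_insert_erase {m j : ι} {S : Finset ι} (hm : m ∉ S) (hj : j ∈ S) :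
    (insert m (S.erase j)).card = S.card := by
  rw [Finset.card_insert_of_notMem fun h => hm (Finset.mem_of_mem_erase h),
    Finset.card_erase_add_one hj]

theorem actC_congr {m : ι} {Φ Φ' : Finset ι → ℂ} {S : Finset ι} (hm : m ∉ S)
    (h : ∀ T ⊆ insert m S, T.card + 1 = S.card → Φ T = Φ' T) :
    actC c lam l m Φ S = actC c lam l m Φ' S := by
  have h0 : ∀ k ∈ S, Φ (S.erase k) = Φ' (S.erase k) := fun k hk =>
    h _ ((Finset.erase_subset _ _).trans (Finset.subset_insert _ _))
      (Finset.card_erase_add_one hk)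
  unfold actC
  congr 1
  · refine Finset.sum_congr rfl fun k hk => ?_
    rw [actA_congr (h0 k hk) fun j hj => ?_]
    have hm' : m ∉ S.erase k := fun h => hm (Finset.mem_of_mem_erase h)
    refine h _ (Finset.insert_subset_insert _ ((Finset.erase_subset _ _).trans
      (Finset.erase_subset _ _))) ?_
    rw [card_insert_erase hm' hj, Finset.card_erase_add_one hk]
  · exact Finset.sum_congr rfl fun k hk => by rw [h0 k hk]

theorem actA_sum {κ : Type*} (s : Finset κ) (a : κ → ℂ) (K : κ → Finset ι → ℂ) (m : ι)
    (S : Finset ι) : actA c lam l m (fun T => ∑ b ∈ s, a b * K b T) S =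
      ∑ b ∈ s, a b * actA c lam l m (K b) S := by
  simp only [actA, Finset.mul_sum, mul_add, Finset.sum_add_distrib]
  congr 1
  · exact Finset.sum_congr rfl fun b _ => by ring
  · rw [Finset.sum_comm]
    exact Finset.sum_congr rfl fun b _ => Finset.sum_congr rfl fun j _ => by ring

theorem actC_sum {κ : Type*} (s : Finset κ) (a : κ → ℂ) (K : κ → Finset ι → ℂ) (m : ι)
    (S : Finset ι) : actC c lam l m (fun T => ∑ b ∈ s, a b * K b T) S =
      ∑ b ∈ s, a b * actC c lam l m (K b) S := by
  simp only [actC, actA_sum, Finset.mul_sum, mul_sub, Finset.sum_sub_distrib]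
  congr 1 <;> rw [Finset.sum_comm] <;>
    exact Finset.sum_congr rfl fun b _ => Finset.sum_congr rfl fun j _ => by ring

theorem actD_comm (i m : ι) (K : Finset ι → Finset ι → ℂ) (v w : Finset ι) :
    actD c lam i (fun T => actD c lam m (fun U => K U T) v) w =
      actD c lam m (fun U => actD c lam i (fun T => K U T) w) v := by
  simp only [actD, mul_add, Finset.mul_sum, Finset.sum_add_distrib]
  rw [Finset.sum_comm (s := w) (t := v)]
  have e : ∀ a b b' d : ℂ, b = b' → a + b + d = a + (b' + d) := by intros; subst_vars; ring
  simp only [mul_left_comm, mul_comm, mul_assoc]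
  ring

theorem actD_insert (hl : Function.Injective lam) {i m : ι} {S : Finset ι} (hi : i ∉ S)
    (hm : m ∉ S) (him : i ≠ m) (Φ : Finset ι → ℂ) :
    actD c lam m Φ (insert i S) =
      ker c lam i m * actD c lam m (fun T => Φ (insert i T)) S +
        gker c lam m i * actD c lam i (fun T => Φ (insert m T)) S := by
  simp only [actD_eq_actA]
  rw [actA_insert hl hi hm him, ker_neg, gker_neg]

theorem actD_sub (m : ι) (Φ Φ' : Finset ι → ℂ) (S : Finset ι) :
    actD c lam m (fun T => Φ T - Φ' T) S = actD c lam m Φ S - actD c lam m Φ' S := by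
  simp only [actD, mul_sub, Finset.sum_sub_distrib]; ring

theorem actD_add (m : ι) (Φ Φ' : Finset ι → ℂ) (S : Finset ι) :
    actD c lam m (fun T => Φ T + Φ' T) S = actD c lam m Φ S + actD c lam m Φ' S := by
  simp only [actD, mul_add, Finset.sum_add_distrib]; ring

/-- The letters of w pass to v one at a time, the exchange relation of A on w being mirrored by that
of D on v. The start w = ∅ is `actD_eigE`. -/
theorem actA_union_eigE (hl : Function.Injective lam) (hf : ∀ i j, i ≠ j → ker c lam i j ≠ 0)
    (w : Finset ι) : ∀ (v : Finset ι) (m : ι), Disjoint v w → m ∉ v → m ∉ w →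
    actA c lam l m (fun T => eigE c lam l (v ∪ T)) w = eigE c lam l (insert m (v ∪ w)) +
      actD c lam m (fun U => eigE c lam l (U ∪ w)) v := by
  induction w using Finset.induction_on with
  | empty =>
    intro v m _ hmv _
    simp only [Finset.union_empty]
    rw [actD_eigE hl hf hmv]
    simp [actA]
  | insert i w hi ih =>
    intro v m hvw hmv hmw
    rw [Finset.disjoint_insert_right] at hvw
    rw [Finset.mem_insert, not_or] at hmw
    have e1 : ∀ T, v ∪ insert i T = insert i v ∪ T := fun T => by
      rw [Finset.union_insert, Finset.insert_union]
    have e2 : ∀ T, v ∪ insert m T = insert m v ∪ T := fun T => by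
      rw [Finset.union_insert, Finset.insert_union]
    rw [actA_insert hl hi hmw.2 (Ne.symm hmw.1)]
    simp only [e1, e2]
    rw [ih (insert i v) m (Finset.disjoint_insert_left.2 ⟨hi, hvw.2⟩)
        (by simp [hmv, hmw.1]) hmw.2,
      ih (insert m v) i (Finset.disjoint_insert_left.2 ⟨hmw.2, hvw.2⟩)
        (by simp [hvw.1, Ne.symm hmw.1]) hi,
      actD_insert hl hvw.1 hmv (Ne.symm hmw.1), actD_insert hl hmv hvw.1 hmw.1]
    have e3 : ∀ U, insert i U ∪ w = U ∪ insert i w := fun U => by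
      rw [Finset.union_insert, Finset.insert_union]
    have e4 : insert i (insert m v ∪ w) = insert m (insert i v ∪ w) := by
      rw [Finset.insert_union, Finset.insert_union, Finset.insert_comm]
    rw [e4]
    simp only [e3]
    rw [ker_eq hl hmw.1, ker_eq hl (Ne.symm hmw.1), gker_swap m i]
    ring

theorem actD_union_eigE (hl : Function.Injective lam) (hf : ∀ i j, i ≠ j → ker c lam i j ≠ 0)
    {v w : Finset ι} {m : ι} (hvw : Disjoint v w) (hmv : m ∉ v) (hmw : m ∉ w) :
    actD c lam m (fun T => eigE c lam l (v ∪ T)) w =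
      actA c lam l m (fun U => eigE c lam l (U ∪ w)) v - eigE c lam l (insert m (v ∪ w)) := by
  have := actA_union_eigE (l := l) hl hf v w m hvw.symm hmw hmv
  simp only [Finset.union_comm w, Finset.union_comm _ v] at this
  rw [this]; ring

/-- The mixed term met when C passes a letter. Both operators are carried over to v in turn, which
is possible because actions on different arguments commute (`actD_comm`). -/
theorem actD_actA_union_eigE (hl : Function.Injective lam)
    (hf : ∀ i j, i ≠ j → ker c lam i j ≠ 0) {v w : Finset ι} {i m : ι} (hvw : Disjoint v w)
    (hmv : m ∉ v) (hmw : m ∉ w) (hiv : i ∉ v) (hiw : i ∉ w) (him : i ≠ m) :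
    actD c lam i (actA c lam l m (fun T => eigE c lam l (v ∪ T))) w =
      actA c lam l i (fun U => eigE c lam l (U ∪ w)) (insert m v) -
        eigE c lam l (insert i (insert m (v ∪ w))) +
      (actD c lam m (actA c lam l i (fun U => eigE c lam l (U ∪ w))) v -
        actD c lam m (fun U => eigE c lam l (insert i U ∪ w)) v) := by
  have h1 : actD c lam i (actA c lam l m (fun T => eigE c lam l (v ∪ T))) w =
      actD c lam i (fun T => eigE c lam l (insert m v ∪ T) +
        actD c lam m (fun U => eigE c lam l (U ∪ T)) v) w := by
    refine actD_congr ?_ fun j hj => ?_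
    · rw [actA_union_eigE hl hf w v m hvw hmv hmw, Finset.insert_union]
    · rw [actA_union_eigE hl hf _ v m _ hmv, Finset.insert_union]
      · rw [Finset.mem_insert, not_or]
        exact ⟨him.symm, fun h => hmw (Finset.mem_of_mem_erase h)⟩
      · exact Finset.disjoint_insert_right.2 ⟨hiv, hvw.mono_right (Finset.erase_subset _ _)⟩
  rw [h1, actD_add, actD_union_eigE hl hf (Finset.disjoint_insert_left.2 ⟨hmw, hvw⟩)
    (by simp [him, hiv]) hiw, actD_comm, Finset.insert_union m]
  congr 1
  rw [← actD_sub]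
  refine actD_congr ?_ fun j hj => ?_
  · rw [actD_union_eigE hl hf hvw hiv hiw, Finset.insert_union]
  · rw [actD_union_eigE hl hf _ _ hiw, Finset.insert_union i]
    · exact Finset.disjoint_insert_left.2 ⟨hmw, hvw.mono_left (Finset.erase_subset _ _)⟩
    · rw [Finset.mem_insert, not_or]
      exact ⟨him, fun h => hiv (Finset.mem_of_mem_erase h)⟩

/-- Again the letters of w pass to v. For w = ∅, C annihilates the vacuum, and the right side
cancels by the three formulas for `eigE`. -/
theorem actC_union_eigE (hl : Function.Injective lam) (hf : ∀ i j, i ≠ j → ker c lam i j ≠ 0)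
    (w : Finset ι) : ∀ (v : Finset ι) (m : ι), Disjoint v w → m ∉ v → m ∉ w →
    actC c lam l m (fun T => eigE c lam l (v ∪ T)) w = -eigE c lam l (insert m v ∪ w) +
      actA c lam l m (fun U => eigE c lam l (U ∪ w)) v -
      actD c lam m (fun U => eigE c lam l (U ∪ w)) v +
      actC c lam l m (fun U => eigE c lam l (U ∪ w)) v := by
  induction w using Finset.induction_on with
  | empty =>
    intro v m _ hmv _
    simp only [Finset.union_empty]
    have h0 : actC c lam l m (fun T => eigE c lam l (v ∪ T)) ∅ = 0 := by simp [actC]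
    rw [h0, actD_eigE hl hf hmv, actA_eigE hl hf hmv, actC_eigE hl hf hmv]
    ring
  | insert i w hi ih =>
    intro v m hvw hmv hmw
    rw [Finset.disjoint_insert_right] at hvw
    rw [Finset.mem_insert, not_or] at hmw
    have him := Ne.symm hmw.1
    have e1 : ∀ T, v ∪ insert i T = insert i v ∪ T := fun T => by
      rw [Finset.union_insert, Finset.insert_union]
    have e3 : ∀ U, insert i U ∪ w = U ∪ insert i w := fun U => by
      rw [Finset.union_insert, Finset.insert_union]
    rw [actC_insert hl hi hmw.2 him]
    simp only [e1]
    rw [ih (insert i v) m (Finset.disjoint_insert_left.2 ⟨hi, hvw.2⟩)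
        (by simp [hmv, hmw.1]) hmw.2,
      actD_actA_union_eigE hl hf hvw.2 hmv hmw.2 hvw.1 hi him,
      actD_actA_union_eigE hl hf hvw.2 hvw.1 hi hmv hmw.2 hmw.1,
      actC_insert hl hvw.1 hmv him, actD_insert hl hvw.1 hmv him,
      actA_insert hl hvw.1 hmv him, actA_insert hl hmv hvw.1 hmw.1]
    simp only [e3]
    rw [ker_eq hl hmw.1, ker_eq hl him, gker_swap m i, Finset.insert_comm m i (v ∪ w),
      Finset.insert_comm m i v, e3]
    ring

end Transposition

end BoseGas


namespace BoseGas

/-! ### Off-shell scalar products -/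

section Coefficient

variable {ι : Type} [DecidableEq ι] {c : ℝ} {lam l : ι → ℂ}

/-- The three-term functional `∑ l(A) (-1)^|B| Φ(B) (-1)^|D| f3(A, B, D)` with additional weights
`x(A)` and `y(D)`. -/
noncomputable def tripleV (c : ℝ) (lam l : ι → ℂ) (x y Φ : Finset ι → ℂ) (C : Finset ι) : ℂ :=
  star (ker c lam) (fun A => lprod l A * x A)
    (star (ker c lam) (fun B => sgn B * Φ B) fun D => sgn D * y D) C

theorem tripleV_congr {x x' y y' Φ Φ' : Finset ι → ℂ} {C : Finset ι}
    (hx : ∀ B ⊆ C, x B = x' B) (hy : ∀ B ⊆ C, y B = y' B)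
    (h : ∀ B ⊆ C, Φ B = Φ' B) : tripleV c lam l x y Φ C = tripleV c lam l x' y' Φ' C :=
  star_congr (fun B hB => by rw [hx B hB]) fun B hB =>
    star_congr (fun D hD => by rw [h D (hD.trans hB)]) fun D hD => by rw [hy D (hD.trans hB)]

theorem tripleV_add (x y Φ Φ' : Finset ι → ℂ) (C : Finset ι) :
    tripleV c lam l x y (fun B => Φ B + Φ' B) C =
      tripleV c lam l x y Φ C + tripleV c lam l x y Φ' C := by
  simp only [tripleV]
  rw [← star_add_right]
  refine star_congr (fun _ _ => rfl) fun B _ => ?_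
  rw [← star_add_left]
  simp only [mul_add]

theorem tripleV_mul (a : ℂ) (x y Φ : Finset ι → ℂ) (C : Finset ι) :
    tripleV c lam l x y (fun B => a * Φ B) C = a * tripleV c lam l x y Φ C := by
  simp only [tripleV]
  rw [← star_mul_right]
  refine star_congr (fun _ _ => rfl) fun B _ => ?_
  rw [← star_mul_left]
  simp only [mul_left_comm]

theorem tripleV_add_left (x x' y Φ : Finset ι → ℂ) (C : Finset ι) :
    tripleV c lam l (fun B => x B + x' B) y Φ C =
      tripleV c lam l x y Φ C + tripleV c lam l x' y Φ C := by
  simp only [tripleV]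
  rw [← star_add_left]
  simp only [mul_add]

theorem tripleV_mul_left (a : ℂ) (x y Φ : Finset ι → ℂ) (C : Finset ι) :
    tripleV c lam l (fun B => a * x B) y Φ C = a * tripleV c lam l x y Φ C := by
  simp only [tripleV]
  rw [← star_mul_left]
  simp only [mul_left_comm]

theorem tripleV_add_right (x y y' Φ : Finset ι → ℂ) (C : Finset ι) :
    tripleV c lam l x (fun B => y B + y' B) Φ C =
      tripleV c lam l x y Φ C + tripleV c lam l x y' Φ C := by
  simp only [tripleV]
  rw [← star_add_right]
  refine star_congr (fun _ _ => rfl) fun B _ => ?_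
  rw [← star_add_right]
  simp only [mul_add]

theorem tripleV_mul_right (a : ℂ) (x y Φ : Finset ι → ℂ) (C : Finset ι) :
    tripleV c lam l x (fun B => a * y B) Φ C = a * tripleV c lam l x y Φ C := by
  simp only [tripleV]
  rw [← star_mul_right]
  refine star_congr (fun _ _ => rfl) fun B _ => ?_
  rw [← star_mul_right]
  simp only [mul_left_comm]

theorem tripleV_sum {κ : Type*} (s : Finset κ) (x y : Finset ι → ℂ) (Φ : κ → Finset ι → ℂ)
    (C : Finset ι) : tripleV c lam l x y (fun B => ∑ b ∈ s, Φ b B) C =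
      ∑ b ∈ s, tripleV c lam l x y (Φ b) C := by
  classical
  induction s using Finset.induction_on with
  | empty =>
    simp only [Finset.sum_empty]
    have := tripleV_mul (c := c) (lam := lam) (l := l) 0 x y (fun _ => 0) C
    simpa using this
  | insert b s hb ih => simp only [Finset.sum_insert hb, tripleV_add, ih]

/-- Linearity in Φ: the values on indicators are the coefficients, so an operator acting on a
further argument of Φ can be taken through the sum. -/
theorem tripleV_eq_sum (x y Φ : Finset ι → ℂ) (C : Finset ι) :
    tripleV c lam l x y Φ C =
      ∑ B ∈ C.powerset, tripleV c lam l x y (fun B' => if B' = B then 1 else 0) C * Φ B := by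
  simp only [mul_comm _ (Φ _), ← tripleV_mul, ← tripleV_sum]
  refine tripleV_congr (fun _ _ => rfl) (fun _ _ => rfl) fun B hB => ?_
  simp [hB]

/-- A label leaving the middle piece with weight l j joins the first piece, and the sum over its
position there is `fp_singleton_right_expand`. In `tripleV_sum_right` it joins the third piece. -/
theorem tripleV_sum_left (hl : Function.Injective lam) (y Ψ : Finset ι → ℂ) {m : ι}
    {C : Finset ι} (hm : m ∉ C) :
    tripleV c lam l (fun _ => 1) y (fun γ => ∑ j ∈ γ, l j * gker c lam j m *
      fp (ker c lam) {j} (γ.erase j) * Ψ (γ.erase j)) C =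
    -1 * tripleV c lam l (fun A => fp (ker c lam) A {m}) y Ψ C +
      tripleV c lam l (fun _ => 1) y Ψ C := by
  have h1 : star (ker c lam) (fun B => sgn B * ∑ j ∈ B, l j * gker c lam j m *
      fp (ker c lam) {j} (B.erase j) * Ψ (B.erase j)) (fun D => sgn D * y D) =
      star (ker c lam) (single fun j => -(l j * gker c lam j m))
        (star (ker c lam) (fun B => sgn B * Ψ B) fun D => sgn D * y D) := by
    funext T
    rw [← star_assoc]
    refine star_congr (fun A hA => ?_) fun _ _ => rfl
    rw [star_single_left, Finset.mul_sum]
    refine Finset.sum_congr rfl fun j hj => ?_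
    rw [sgn_erase hj]; ring
  rw [← tripleV_mul_left, ← tripleV_add_left]
  unfold tripleV
  rw [h1, ← star_assoc]
  refine star_congr (fun A hA => ?_) fun _ _ => rfl
  rw [star_single_right]
  have h2 := fp_singleton_right_expand (c := c) hl (fun h => hm (hA h))
  beta_reduce
  have : ∀ a ∈ A, fp (ker c lam) (A.erase a) {a} * (lprod l (A.erase a) * 1 *
      -(l a * gker c lam a m)) =
      -lprod l A * (gker c lam a m * fp (ker c lam) (A.erase a) {a}) := by
    intro a ha
    rw [← lprod_erase l ha]; ring
  rw [Finset.sum_congr rfl this, ← Finset.mul_sum, h2]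
  ring

theorem tripleV_sum_right (hl : Function.Injective lam) (x Ψ : Finset ι → ℂ) {m : ι}
    {C : Finset ι} (hm : m ∉ C) :
    tripleV c lam l x (fun _ => 1) (fun γ => ∑ k ∈ γ, gker c lam m k *
      fp (ker c lam) (γ.erase k) {k} * Ψ (γ.erase k)) C =
    tripleV c lam l x (fun D => fp (ker c lam) {m} D) Ψ C +
      -1 * tripleV c lam l x (fun _ => 1) Ψ C := by
  have h1 : ∀ T ⊆ C, star (ker c lam) (fun B => sgn B * ∑ k ∈ B, gker c lam m k *
      fp (ker c lam) (B.erase k) {k} * Ψ (B.erase k)) (fun D => sgn D * 1) T =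
      star (ker c lam) (fun B => sgn B * Ψ B)
        (fun D => sgn D * (fp (ker c lam) {m} D + -1 * 1)) T := by
    intro T hT
    have h2 : star (ker c lam) (fun B => sgn B * ∑ k ∈ B, gker c lam m k *
        fp (ker c lam) (B.erase k) {k} * Ψ (B.erase k)) (fun D => sgn D * 1) T =
        star (ker c lam) (star (ker c lam) (fun B => sgn B * Ψ B)
          (single fun k => -gker c lam m k)) (fun D => sgn D * 1) T := by
      refine star_congr (fun A hA => ?_) fun _ _ => rfl
      rw [star_single_right, Finset.mul_sum]
      refine Finset.sum_congr rfl fun j hj => ?_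
      rw [sgn_erase hj]; ring
    rw [h2, star_assoc]
    refine star_congr (fun _ _ => rfl) fun A hA => ?_
    rw [star_single_left]
    have h2 := fp_singleton_left_expand (c := c) hl (fun h => hm (hT (hA h)))
    rw [h2, mul_add, mul_add, Finset.mul_sum]
    have : ∀ a ∈ A, fp (ker c lam) {a} (A.erase a) * (sgn (A.erase a) * 1 *
        -gker c lam m a) = sgn A * (gker c lam m a * fp (ker c lam) {a} (A.erase a)) := by
      intro a ha
      rw [sgn_erase ha]; ring
    rw [Finset.sum_congr rfl this]
    ring
  rw [← tripleV_mul_right, ← tripleV_add_right]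
  exact star_congr (fun _ _ => rfl) h1

theorem tripleV_insert {m : ι} {C : Finset ι} (hm : m ∉ C) (Φ : Finset ι → ℂ) :
    tripleV c lam l (fun _ => 1) (fun _ => 1) Φ (insert m C) =
      l m * tripleV c lam l (fun _ => 1) (fun D => fp (ker c lam) {m} D)
        (fun B => fp (ker c lam) {m} B * Φ B) C -
      tripleV c lam l (fun A => fp (ker c lam) A {m}) (fun D => fp (ker c lam) {m} D)
        (fun B => Φ (insert m B)) C -
      tripleV c lam l (fun A => fp (ker c lam) A {m}) (fun _ => 1)
        (fun B => fp (ker c lam) B {m} * Φ B) C := by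
  unfold tripleV
  rw [star_insert _ _ hm]
  have h1 : star (ker c lam) (fun A => lprod l (insert m A) * 1) (fun B => fp (ker c lam) {m} B *
      star (ker c lam) (fun B => sgn B * Φ B) (fun D => sgn D * 1) B) C =
      l m * star (ker c lam) (fun A => lprod l A * 1) (star (ker c lam)
        (fun B => sgn B * (fp (ker c lam) {m} B * Φ B))
        (fun D => sgn D * fp (ker c lam) {m} D)) C := by
    rw [← star_mul_left]
    refine star_congr (fun A hA => ?_) fun A hA => ?_
    · rw [lprod_insert l fun h => hm (hA h)]; ring
    · rw [fp_mul_star_left]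
      exact star_congr (fun B _ => by ring) fun B _ => by ring
  have h2 : star (ker c lam) (fun A => fp (ker c lam) A {m} * (lprod l A * 1)) (fun B =>
      star (ker c lam) (fun B => sgn B * Φ B) (fun D => sgn D * 1) (insert m B)) C =
      star (ker c lam) (fun A => lprod l A * fp (ker c lam) A {m}) (fun B =>
        -1 * star (ker c lam) (fun B => sgn B * Φ (insert m B))
          (fun D => sgn D * fp (ker c lam) {m} D) B +
        -1 * star (ker c lam) (fun B => sgn B * (fp (ker c lam) B {m} * Φ B))
          (fun D => sgn D * 1) B) C := by
    refine star_congr (fun A _ => by ring) fun A hA => ?_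
    rw [star_insert _ _ (fun h => hm (hA h)), ← star_mul_left, ← star_mul_right]
    congr 1
    · refine star_congr (fun B hB => ?_) fun B hB => by ring
      rw [sgn_insert (fun h => hm (hA (hB h)))]; ring
    · refine star_congr (fun B hB => by ring) fun B hB => ?_
      rw [sgn_insert (fun h => hm (hA (hB h)))]; ring
  rw [h1, h2, star_add_right, star_mul_right, star_mul_right]
  ring

/-- The four terms of the transposed C are absorbed into the outer pieces; what survives is the
three places that m can take in a partition of the enlarged set. -/
theorem tripleV_actC (hl : Function.Injective lam) {m : ι} {C : Finset ι} (hm : m ∉ C)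
    (Φ : Finset ι → ℂ) :
    tripleV c lam l (fun _ => 1) (fun _ => 1) (fun γ => -Φ (insert m γ) + actA c lam l m Φ γ -
      actD c lam m Φ γ + actC c lam l m Φ γ) C =
    tripleV c lam l (fun _ => 1) (fun _ => 1) Φ (insert m C) := by
  have hA : ∀ y : Finset ι → ℂ, tripleV c lam l (fun _ => 1) y (actA c lam l m Φ) C =
      l m * tripleV c lam l (fun _ => 1) y (fun B => fp (ker c lam) {m} B * Φ B) C +
      (-1 * tripleV c lam l (fun A => fp (ker c lam) A {m}) y (fun B => Φ (insert m B)) C +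
        tripleV c lam l (fun _ => 1) y (fun B => Φ (insert m B)) C) := by
    intro y
    rw [← tripleV_sum_left hl y _ hm, ← tripleV_mul, ← tripleV_add]
    refine tripleV_congr (fun _ _ => rfl) (fun _ _ => rfl) fun B hB => ?_
    rw [actA]; ring
  have hD : tripleV c lam l (fun _ => 1) (fun _ => 1) (actD c lam m Φ) C =
      tripleV c lam l (fun _ => 1) (fun _ => 1) (fun B => fp (ker c lam) B {m} * Φ B) C +
      (tripleV c lam l (fun _ => 1) (fun D => fp (ker c lam) {m} D)
        (fun B => Φ (insert m B)) C + -1 * tripleV c lam l (fun _ => 1) (fun _ => 1)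
          (fun B => Φ (insert m B)) C) := by
    rw [← tripleV_sum_right hl _ _ hm, ← tripleV_add]
    rfl
  have hC : tripleV c lam l (fun _ => 1) (fun _ => 1) (actC c lam l m Φ) C =
      (tripleV c lam l (fun _ => 1) (fun D => fp (ker c lam) {m} D) (actA c lam l m Φ) C +
        -1 * tripleV c lam l (fun _ => 1) (fun _ => 1) (actA c lam l m Φ) C) +
      (-1 * tripleV c lam l (fun A => fp (ker c lam) A {m}) (fun _ => 1)
        (fun B => fp (ker c lam) B {m} * Φ B) C +
        tripleV c lam l (fun _ => 1) (fun _ => 1) (fun B => fp (ker c lam) B {m} * Φ B) C) := by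
    rw [← tripleV_sum_right hl _ _ hm, ← tripleV_sum_left hl _ _ hm, ← tripleV_add]
    refine tripleV_congr (fun _ _ => rfl) (fun _ _ => rfl) fun B hB => ?_
    rw [actC, sub_eq_add_neg, ← Finset.sum_neg_distrib]
    congr 1
    refine Finset.sum_congr rfl fun j _ => ?_
    rw [gker_swap j m]; ring
  have h : ∀ γ, -Φ (insert m γ) + actA c lam l m Φ γ - actD c lam m Φ γ + actC c lam l m Φ γ =
      -1 * Φ (insert m γ) + (actA c lam l m Φ γ + (-1 * actD c lam m Φ γ + actC c lam l m Φ γ)) :=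
    fun γ => by ring
  simp only [h]
  rw [tripleV_add, tripleV_add, tripleV_add, tripleV_mul, tripleV_mul, hC, hD, hA, hA,
    tripleV_insert hm]
  ring

/-- The scalar product: applying the `C`s of the list `cs` one after the other. -/
theorem foldl_actC_eigE (hl : Function.Injective lam) (hf : ∀ i j, i ≠ j → ker c lam i j ≠ 0)
    (cs : List ι) : ∀ W : Finset ι, cs.Nodup → Disjoint cs.toFinset W →
    cs.foldl (fun Ψ i => actC c lam l i Ψ) (eigE c lam l) W =
      tripleV c lam l (fun _ => 1) (fun _ => 1) (fun γ => eigE c lam l (γ ∪ W)) cs.toFinset := by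
  induction cs using List.reverseRecOn with
  | nil => intro W _ _; simp [tripleV, star, lprod, sgn]
  | append_singleton cs m ih =>
    intro W hcs hW
    have hmcs : m ∉ cs := fun h => by
      rw [List.nodup_append] at hcs; exact hcs.2.2 m h m (by simp) rfl
    have hcs' : cs.Nodup := (List.nodup_append.1 hcs).1
    have e : (cs ++ [m]).toFinset = insert m cs.toFinset := by
      ext; simp
    rw [e, Finset.disjoint_insert_left] at hW
    rw [List.foldl_append, List.foldl_cons, List.foldl_nil, e, ← tripleV_actC hl (by simpa)]
    -- The earlier C's give a combination of the functionals `eigE (B ∪ ·)`. On each of these the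
    -- last C is transposed to B, and `tripleV_actC` absorbs it.
    rw [actC_congr (Φ' := fun T => ∑ B ∈ cs.toFinset.powerset,
      tripleV c lam l (fun _ => 1) (fun _ => 1) (fun B' => if B' = B then 1 else 0) cs.toFinset *
        eigE c lam l (B ∪ T)) hW.1, actC_sum, tripleV_eq_sum]
    · refine Finset.sum_congr rfl fun B hB => ?_
      have hB' := Finset.mem_powerset.1 hB
      rw [actC_union_eigE hl hf W B m (hW.2.mono_left hB')
        (fun h => hmcs (by simpa using hB' h)) hW.1]
    · intro T hT _
      rw [ih T hcs', tripleV_eq_sum]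
      refine Finset.disjoint_of_subset_right hT (Finset.disjoint_insert_right.2 ⟨by simpa, hW.2⟩)

/-- Each C lowers the particle number by one, so with as many C's as B's only the value on ∅
matters. The vacuum projection may therefore be exchanged for `eigE`, which is also 1 there. -/
theorem foldl_actC_congr (cs : List ι) : ∀ (Φ Φ' : Finset ι → ℂ) (W : Finset ι),
    cs.Nodup → Disjoint cs.toFinset W → cs.length = W.card → Φ ∅ = Φ' ∅ →
    cs.foldl (fun Ψ i => actC c lam l i Ψ) Φ W = cs.foldl (fun Ψ i => actC c lam l i Ψ) Φ' W := by
  induction cs using List.reverseRecOn with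
  | nil =>
    intro Φ Φ' W _ _ h h0
    rw [List.length_nil, eq_comm, Finset.card_eq_zero] at h
    subst h; exact h0
  | append_singleton cs m ih =>
    intro Φ Φ' W hcs hW hc h0
    have hmcs : m ∉ cs := fun h => by
      rw [List.nodup_append] at hcs; exact hcs.2.2 m h m (by simp) rfl
    have hcs' : cs.Nodup := (List.nodup_append.1 hcs).1
    have e : (cs ++ [m]).toFinset = insert m cs.toFinset := by
      ext; simp
    rw [e, Finset.disjoint_insert_left] at hW
    rw [List.foldl_append, List.foldl_cons, List.foldl_nil, List.foldl_append, List.foldl_cons,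
      List.foldl_nil]
    refine actC_congr hW.1 fun T hT hTc => ih Φ Φ' T hcs' ?_ ?_ h0
    · exact Finset.disjoint_of_subset_right hT (Finset.disjoint_insert_right.2 ⟨by simpa, hW.2⟩)
    · rw [List.length_append, List.length_singleton] at hc; omega

theorem scalar_product (hl : Function.Injective lam) (hf : ∀ i j, i ≠ j → ker c lam i j ≠ 0)
    (cs w : List ι) (hw : (cs ++ w).Nodup) (hlen : cs.length = w.length) :
    (cs.foldr (fun i u => opC c lam l i u) (Finsupp.single w 1)) [] =
      tripleV c lam l (fun _ => 1) (fun _ => 1) (fun γ => eigE c lam l (γ ∪ w.toFinset))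
        cs.toFinset := by
  have hn := List.nodup_append.1 hw
  have hd : Disjoint cs.toFinset w.toFinset := by
    rw [Finset.disjoint_left]
    intro a h1 h2
    exact hn.2.2 a (by simpa using h1) a (by simpa using h2) rfl
  have h := eval_foldr_opC (c := c) (l := l) hl cs w hw (Finsupp.lapply [])
    (fun S => if S = ∅ then 1 else 0) ?_
  · rw [← foldl_actC_eigE hl hf cs _ hn.1 hd, ← foldl_actC_congr cs
      (fun S => if S = ∅ then 1 else 0) _ w.toFinset hn.1 hd]
    · exact h
    · rw [List.toFinset_card_of_nodup hn.2.1, hlen]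
    · simp [eigE, star, lprod, sgn]
  · intro u _ _
    simp [Finsupp.single_apply]

end Coefficient

end BoseGas


namespace BoseGas

/-! ### The fields as star multiplications -/

section Fields

variable {ι : Type} [DecidableEq ι] {c : ℝ} {lam l : ι → ℂ}

theorem toFinset_eraseIdx {w : List ι} (hw : w.Nodup) (k : Fin w.length) :
    (w.eraseIdx k).toFinset = w.toFinset.erase (w.get k) := by
  ext x
  rw [List.get_eq_getElem, ← List.Nodup.erase_getElem hw, List.mem_toFinset, hw.mem_erase_iff,
    Finset.mem_erase, List.mem_toFinset]

theorem sum_eraseIdx {w : List ι} (hw : w.Nodup) (h : ι → Finset ι → ℂ) :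
    ∑ k : Fin w.length, h (w.get k) (w.eraseIdx k).toFinset =
      ∑ a ∈ w.toFinset, h a (w.toFinset.erase a) := by
  refine Finset.sum_bij (fun k _ => w.get k) ?_ ?_ ?_ ?_
  · intro k _; simp
  · intro a _ b _ hab; exact hw.injective_get hab
  · intro b hb
    obtain ⟨k, hk⟩ := List.mem_iff_get.1 (List.mem_toFinset.1 hb)
    exact ⟨k, Finset.mem_univ _, hk⟩
  · intro k _; rw [toFinset_eraseIdx hw]

theorem nodup_eraseIdx {w : List ι} (hw : w.Nodup) (k : ℕ) : (w.eraseIdx k).Nodup :=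
  hw.sublist (List.eraseIdx_sublist _ _)

theorem prod_map_eq {u : List ι} (hu : u.Nodup) (h : ι → ℂ) :
    (u.map h).prod = ∏ a ∈ u.toFinset, h a := (List.prod_toFinset h hu).symm

/-- The factor f(k, m) over the remaining labels puts the removed label in front: this is left
multiplication by `single l`. For Ψ† the removed label stands behind and carries no eigenvalue. -/
theorem eval_opPsi_iterate (k : ℕ) : ∀ (w : List ι) (_ : w.Nodup) (L : Words ι →ₗ[ℂ] ℂ)
    (Φ : Finset ι → ℂ) (_ : ∀ u : List ι, u.Nodup → u ⊆ w → u.length + k = w.length →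
      L (Finsupp.single u 1) = Φ u.toFinset),
    L ((opPsi c lam l)^[k] (Finsupp.single w 1)) =
      (-Complex.I * (c : ℂ) ^ (1 / 2 : ℂ)) ^ k *
        ((star (ker c lam) (single l))^[k] Φ) w.toFinset := by
  induction k with
  | zero =>
    intro w hw L Φ hL
    simpa using hL w hw (fun _ h => h) rfl
  | succ k ih =>
    intro w hw L Φ hL
    have hlin : ∀ v : Words ι, L ((opPsi c lam l)^[k] v) = (L ∘ₗ (opPsi c lam l) ^ k) v := by
      intro v; simp [Module.End.pow_apply]
    rw [Function.iterate_succ_apply, Function.iterate_succ_apply', hlin]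
    have h1 : opPsi c lam l (Finsupp.single w 1) = ∑ k : Fin w.length,
        (-Complex.I * (c : ℂ) ^ (1 / 2 : ℂ) * l (w.get k) *
          ((w.eraseIdx k).map (fun m => fFun c (lam (w.get k)) (lam m))).prod) •
          Finsupp.single (w.eraseIdx k) 1 := by
      simp [opPsi]
    rw [h1, map_sum, star_single_left, Finset.mul_sum, ← sum_eraseIdx hw (fun a T =>
      (-Complex.I * (c : ℂ) ^ (1 / 2 : ℂ)) ^ (k + 1) * (fp (ker c lam) {a} T *
        ((star (ker c lam) (single l))^[k] Φ T * l a)))]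
    refine Finset.sum_congr rfl fun j _ => ?_
    rw [map_smul, ← hlin, ih _ (nodup_eraseIdx hw _) L Φ, prod_map_eq (nodup_eraseIdx hw _),
      fp_singleton_left, smul_eq_mul]
    · simp only [ker]; ring
    · intro u hu hus hlen
      refine hL u hu (fun x hx => List.mem_of_mem_eraseIdx (hus hx)) ?_
      have := List.length_eraseIdx_add_one j.2
      omega

theorem eval_opPsiDag_iterate (k : ℕ) : ∀ (w : List ι) (_ : w.Nodup) (L : Words ι →ₗ[ℂ] ℂ)
    (Φ : Finset ι → ℂ) (_ : ∀ u : List ι, u.Nodup → u ⊆ w → u.length + k = w.length →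
      L (Finsupp.single u 1) = Φ u.toFinset),
    L ((opPsiDag c lam)^[k] (Finsupp.single w 1)) =
      (Complex.I * (c : ℂ) ^ (1 / 2 : ℂ)) ^ k *
        ((fun F => star (ker c lam) F (sizeInd 1))^[k] Φ) w.toFinset := by
  induction k with
  | zero =>
    intro w hw L Φ hL
    simpa using hL w hw (fun _ h => h) rfl
  | succ k ih =>
    intro w hw L Φ hL
    have hlin : ∀ v : Words ι, L ((opPsiDag c lam)^[k] v) = (L ∘ₗ (opPsiDag c lam) ^ k) v := by
      intro v; simp [Module.End.pow_apply]
    rw [Function.iterate_succ_apply, Function.iterate_succ_apply', hlin]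
    have h1 : opPsiDag c lam (Finsupp.single w 1) = ∑ k : Fin w.length,
        (Complex.I * (c : ℂ) ^ (1 / 2 : ℂ) *
          ((w.eraseIdx k).map (fun m => fFun c (lam m) (lam (w.get k)))).prod) •
          Finsupp.single (w.eraseIdx k) 1 := by
      simp [opPsiDag]
    rw [h1, map_sum, star_sizeInd_one_right, Finset.mul_sum, ← sum_eraseIdx hw (fun a T =>
      (Complex.I * (c : ℂ) ^ (1 / 2 : ℂ)) ^ (k + 1) * (fp (ker c lam) T {a} *
        ((fun F => star (ker c lam) F (sizeInd 1))^[k] Φ T)))]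
    refine Finset.sum_congr rfl fun j _ => ?_
    rw [map_smul, ← hlin, ih _ (nodup_eraseIdx hw _) L Φ, prod_map_eq (nodup_eraseIdx hw _),
      fp_singleton_right, smul_eq_mul]
    · simp only [ker]; ring
    · intro u hu hus hlen
      refine hL u hu (fun x hx => List.mem_of_mem_eraseIdx (hus hx)) ?_
      have := List.length_eraseIdx_add_one j.2
      omega

theorem exists_foldr_opC_linear (u : List ι) : ∃ M : Words ι →ₗ[ℂ] Words ι,
    ∀ v, M v = u.foldr (fun i u => opC c lam l i u) v := by
  induction u with
  | nil => exact ⟨LinearMap.id, fun v => rfl⟩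
  | cons i u ih =>
    obtain ⟨M, hM⟩ := ih
    exact ⟨opC c lam l i ∘ₗ M, fun v => by simp [hM]⟩

theorem pairing_fields (hl : Function.Injective lam) (hf : ∀ i j, i ≠ j → ker c lam i j ≠ 0)
    (k : ℕ) (cs w : List ι) (hw : (cs ++ w).Nodup) (hlen : cs.length = w.length) :
    pairing c lam l ((opPsiDag c lam)^[k] (Finsupp.single cs 1))
      ((opPsi c lam l)^[k] (Finsupp.single w 1)) =
    (c : ℂ) ^ k * ((fun F => star (ker c lam) F (sizeInd 1))^[k] (fun X =>
      ((star (ker c lam) (single l))^[k] (fun W => tripleV c lam l (fun _ => 1) (fun _ => 1)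
        (fun γ => eigE c lam l (γ ∪ W)) X)) w.toFinset)) cs.toFinset := by
  obtain ⟨hcs, hws, hcw⟩ := List.nodup_append.1 hw
  have h1 : ∀ b v : Words ι, pairing c lam l b v = Finsupp.linearCombination ℂ
      (fun u : List ι => (u.foldr (fun i u => opC c lam l i u) v) []) b := by
    intro b v; simp [pairing, Finsupp.linearCombination_apply]
  rw [h1, eval_opPsiDag_iterate k cs hcs _ (fun X => (-Complex.I * (c : ℂ) ^ (1 / 2 : ℂ)) ^ k *
      ((star (ker c lam) (single l))^[k] (fun W => tripleV c lam l (fun _ => 1) (fun _ => 1)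
        (fun γ => eigE c lam l (γ ∪ W)) X)) w.toFinset)]
  · have h2 : ∀ (a : ℂ) (G : Finset ι → ℂ) (j : ℕ),
        (fun F => star (ker c lam) F (sizeInd 1))^[j] (fun X => a * G X) =
          fun X => a * (fun F => star (ker c lam) F (sizeInd 1))^[j] G X := by
      intro a G j
      induction j with
      | zero => rfl
      | succ j ih =>
        rw [Function.iterate_succ_apply', ih, Function.iterate_succ_apply']
        funext X; exact star_mul_left _ _ _ _
    rw [h2, ← mul_assoc, ← mul_pow]
    congr 2
    -- Only the square of the complex root enters, so the sign of c is immaterial.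
    have h3 : ((c : ℂ) ^ (1 / 2 : ℂ)) * ((c : ℂ) ^ (1 / 2 : ℂ)) = c := by
      rw [← pow_two]
      have := Complex.cpow_nat_inv_pow (c : ℂ) (n := 2) (by norm_num)
      rw [one_div]; exact_mod_cast this
    linear_combination (-Complex.I ^ 2) * h3 - (c : ℂ) * Complex.I_sq
  · intro u hu hus hul
    obtain ⟨M, hM⟩ := exists_foldr_opC_linear (c := c) (lam := lam) (l := l) u
    rw [Finsupp.linearCombination_single, one_smul, ← hM]
    refine eval_opPsi_iterate k w hws (Finsupp.lapply [] ∘ₗ M) _ fun v hv hvs hvl => ?_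
    rw [LinearMap.comp_apply, hM]
    refine scalar_product hl hf u v (List.nodup_append.2 ⟨hu, hv, fun a ha b hb =>
      hcw a (hus ha) b (hvs hb)⟩) (by omega)

end Fields

/-! ### Consequences of the Bethe equations -/

section OnShell

variable {ι : Type} [DecidableEq ι] {c : ℝ} {lam l : ι → ℂ}

theorem star_lprod_mul (f : ι → ι → ℂ) (l : ι → ℂ) (F G : Finset ι → ℂ) (S : Finset ι) :
    star f (fun A => lprod l A * F A) (fun A => lprod l A * G A) S =
      lprod l S * star f F G S := by
  simp only [star, Finset.mul_sum]
  refine Finset.sum_congr rfl fun A hA => ?_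
  have : lprod l S = lprod l A * lprod l (S \ A) := by
    unfold lprod
    rw [mul_comm]; exact (Finset.prod_sdiff (Finset.mem_powerset.1 hA)).symm
  rw [this]; ring

theorem single_eq (l : ι → ℂ) : single l = fun A => lprod l A * sizeInd 1 A := by
  funext A
  by_cases h : A.card = 1
  · obtain ⟨a, rfl⟩ := Finset.card_eq_one.1 h
    simp [single, lprod, sizeInd]
  · simp [single, sizeInd, h]

/-- Powers of the one-particle functional behave as for f = 1: each set of k labels is built up with
total weight k! (`star_sizeInd_const`). -/
theorem star_iterate_left (hc : c ≠ 0) (hl : Function.Injective lam)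
    (hf : ∀ i j, i ≠ j → ker c lam i j ≠ 0) (k : ℕ) (Φ : Finset ι → ℂ) (S : Finset ι) :
    ((star (ker c lam) (single l))^[k] Φ) S =
      k.factorial * star (ker c lam) (fun A => lprod l A * sizeInd k A) Φ S := by
  induction k generalizing S with
  | zero =>
    simp only [Function.iterate_zero, id, Nat.factorial_zero, Nat.cast_one, one_mul]
    unfold star
    rw [Finset.sum_eq_single ∅]
    · simp [lprod, sizeInd]
    · intro A _ hA; simp [sizeInd, hA]
    · simp
  | succ k ih =>
    rw [Function.iterate_succ_apply', funext ih, star_mul_right, ← star_assoc, single_eq]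
    have : (star (ker c lam) (fun A => lprod l A * sizeInd 1 A)
        fun A => lprod l A * sizeInd k A) =
        fun A => ((k : ℂ) + 1) * (lprod l A * sizeInd (k + 1) A) := by
      funext A
      rw [star_lprod_mul, star_sizeInd_const hc hl hf]; ring
    rw [this, star_mul_left, Nat.factorial_succ]
    push_cast; ring

theorem star_iterate_right (hc : c ≠ 0) (hl : Function.Injective lam)
    (hf : ∀ i j, i ≠ j → ker c lam i j ≠ 0) (k : ℕ) (Φ : Finset ι → ℂ) (S : Finset ι) :
    ((fun F => star (ker c lam) F (sizeInd 1))^[k] Φ) S =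
      k.factorial * star (ker c lam) Φ (sizeInd k) S := by
  induction k generalizing S with
  | zero =>
    simp only [Function.iterate_zero, id, Nat.factorial_zero, Nat.cast_one, one_mul]
    unfold star
    rw [Finset.sum_eq_single S]
    · simp [sizeInd]
    · intro A hA hA'
      have : S \ A ≠ ∅ := fun h => hA' (Finset.Subset.antisymm (Finset.mem_powerset.1 hA)
        (Finset.sdiff_eq_empty_iff_subset.1 h))
      simp [sizeInd, this]
    · simp
  | succ k ih =>
    rw [Function.iterate_succ_apply', funext ih, star_mul_left, star_assoc]
    have : star (ker c lam) (sizeInd k) (sizeInd 1) =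
        fun A => ((k : ℂ) + 1) * sizeInd (k + 1) A := by
      funext A
      rw [star_const_sizeInd hc hl hf]
    rw [this, star_mul_right, Nat.factorial_succ]
    push_cast; ring

/-- The Bethe equations for the set `S` of labels. -/
def BetheOn (c : ℝ) (lam l : ι → ℂ) (S : Finset ι) : Prop :=
  ∀ j ∈ S, l j * fp (ker c lam) {j} (S.erase j) = fp (ker c lam) (S.erase j) {j}

/-- In the product of the Bethe equations over A, the factors between two members of A occur on both
sides and cancel. -/
theorem BetheOn.lprod_mul_fp (hf : ∀ i j, i ≠ j → ker c lam i j ≠ 0) {S A : Finset ι}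
    (h : BetheOn c lam l S) (hA : A ⊆ S) :
    lprod l A * fp (ker c lam) A (S \ A) = fp (ker c lam) (S \ A) A := by
  have h2 : ∀ j ∈ A, S.erase j \ A.erase j = S \ A := fun j hj => by
    ext x; simp only [Finset.mem_sdiff, Finset.mem_erase]
    constructor
    · tauto
    · rintro ⟨h1, h2⟩; exact ⟨⟨fun h => h2 (h ▸ hj), h1⟩, by tauto⟩
  have h3 : ∏ j ∈ A, fp (ker c lam) (A.erase j) {j} = ∏ j ∈ A, fp (ker c lam) {j} (A.erase j) := by
    simp only [fp_singleton_left, fp_singleton_right]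
    refine Finset.prod_comm' ?_
    intro x y
    simp only [Finset.mem_erase]
    constructor
    · rintro ⟨h1, h2, h3⟩; exact ⟨⟨Ne.symm h2, h1⟩, h3⟩
    · rintro ⟨⟨h1, h2⟩, h3⟩; exact ⟨h2, Ne.symm h1, h3⟩
  have h1 : ∏ j ∈ A, (l j * (fp (ker c lam) {j} (A.erase j) * fp (ker c lam) {j} (S \ A))) =
      ∏ j ∈ A, (fp (ker c lam) (A.erase j) {j} * fp (ker c lam) (S \ A) {j}) := by
    refine Finset.prod_congr rfl fun j hj => ?_
    have := h j (hA hj)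
    rwa [fp_sdiff_right (Finset.erase_subset_erase j hA) {j},
      fp_sdiff_left (Finset.erase_subset_erase j hA) {j}, h2 j hj] at this
  rw [Finset.prod_mul_distrib, Finset.prod_mul_distrib, Finset.prod_mul_distrib, h3] at h1
  have h4 : ∏ j ∈ A, fp (ker c lam) {j} (A.erase j) ≠ 0 :=
    Finset.prod_ne_zero_iff.2 fun j _ => fp_ne_zero fun a ha b hb =>
      hf _ _ (by rw [Finset.mem_singleton.1 ha]; exact (Finset.ne_of_mem_erase hb).symm)
  have h5 : ∏ j ∈ A, fp (ker c lam) {j} (S \ A) = fp (ker c lam) A (S \ A) := by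
    simp [fp]
  have h6 : ∏ j ∈ A, fp (ker c lam) (S \ A) {j} = fp (ker c lam) (S \ A) A := by
    simp only [fp_singleton_right]; exact Finset.prod_comm
  rw [h5, h6] at h1
  refine mul_left_cancel₀ h4 ?_
  rw [← h1, lprod]; ring

/-- The Bethe equations pay for exchanging the order of the two pieces, but only on the full set S.
This is how the vacuum eigenvalues are eliminated. -/
theorem BetheOn.star_lprod (hf : ∀ i j, i ≠ j → ker c lam i j ≠ 0) {S : Finset ι}
    (h : BetheOn c lam l S) (F X : Finset ι → ℂ) :
    star (ker c lam) (fun A => lprod l A * F A) X S = star (ker c lam) X F S := by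
  rw [← star_reverse F X]
  refine Finset.sum_congr rfl fun A hA => ?_
  have e : fp (fun i j => ker c lam j i) A (S \ A) = _ := fp_swap A (S \ A)
  rw [e, ← h.lprod_mul_fp hf (Finset.mem_powerset.1 hA)]
  ring

theorem star_sizeInd_sizeInd (hc : c ≠ 0) (hl : Function.Injective lam)
    (hf : ∀ i j, i ≠ j → ker c lam i j ≠ 0) (k j : ℕ) (S : Finset ι) :
    star (ker c lam) (sizeInd k) (sizeInd j) S = (k + j).choose k * sizeInd (k + j) S := by
  induction j generalizing S with
  | zero =>
    have := star_iterate_right hc hl hf 0 (sizeInd k) S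
    simpa using this.symm
  | succ j ih =>
    have h1 : star (ker c lam) (sizeInd j) (sizeInd 1) =
        fun A => ((j : ℂ) + 1) * sizeInd (j + 1) A := by
      funext A
      rw [star_const_sizeInd hc hl hf]
    have h2 := star_mul_right (f := ker c lam) ((j : ℂ) + 1) (sizeInd k) (sizeInd (j + 1)) S
    rw [← h1, ← star_assoc, funext ih, star_mul_left, star_const_sizeInd hc hl hf] at h2
    have h3 : ((j : ℂ) + 1) ≠ 0 := Nat.cast_add_one_ne_zero j
    have h4 : ((k + j + 1).choose k : ℂ) * (j + 1) = (k + j).choose k * (k + j + 1) := by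
      have := Nat.choose_mul_succ_eq (k + j) k
      rw [show k + j + 1 - k = j + 1 by omega] at this
      exact_mod_cast this.symm
    refine mul_left_cancel₀ h3 ?_
    rw [← h2, ← add_assoc]
    push_cast
    linear_combination -(sizeInd (k + j + 1) S) * h4

theorem star_sizeInd_ones (hc : c ≠ 0) (hl : Function.Injective lam)
    (hf : ∀ i j, i ≠ j → ker c lam i j ≠ 0) (k : ℕ) (S : Finset ι) :
    star (ker c lam) (sizeInd k) (fun _ => 1) S = S.card.choose k := by
  rcases le_or_gt k S.card with hk | hk
  · have := star_sizeInd_sizeInd hc hl hf k (S.card - k) S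
    rw [Nat.add_sub_cancel' hk, sizeInd, if_pos rfl, mul_one] at this
    rw [← this]
    refine Finset.sum_congr rfl fun A hA => ?_
    by_cases h : A.card = k
    · have h2 : (S \ A).card = S.card - k := by
        rw [Finset.card_sdiff_of_subset (Finset.mem_powerset.1 hA), h]
      simp [sizeInd, h, h2]
    · simp [sizeInd, h]
  · rw [Nat.choose_eq_zero_of_lt hk, Nat.cast_zero]
    refine Finset.sum_eq_zero fun A hA => ?_
    have := Finset.card_le_card (Finset.mem_powerset.1 hA)
    rw [sizeInd, if_neg (by omega)]; ring

theorem star_ones_sizeInd (hc : c ≠ 0) (hl : Function.Injective lam)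
    (hf : ∀ i j, i ≠ j → ker c lam i j ≠ 0) (k : ℕ) (S : Finset ι) :
    star (ker c lam) (fun _ => 1) (sizeInd k) S = S.card.choose k := by
  have := star_sizeInd_ones (c := -c) (neg_ne_zero.2 hc) hl
    (by simpa only [ker_neg] using fun i j h => hf j i h.symm) k S
  rwa [ker_neg, star_reverse] at this

/-- Sorting by the size of the first piece leaves the alternating sum of binomial coefficients. Thus
the sign is inverse to the constant 1, the unit being `sizeInd 0`. -/
theorem star_sgn_ones (hc : c ≠ 0) (hl : Function.Injective lam)
    (hf : ∀ i j, i ≠ j → ker c lam i j ≠ 0) :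
    star (ker c lam) sgn (fun _ => 1) = sizeInd 0 := by
  funext S
  have h1 : star (ker c lam) sgn (fun _ => 1) S = star (ker c lam)
      (fun A => ∑ k ∈ Finset.range (S.card + 1), (-1) ^ k * sizeInd k A) (fun _ => 1) S := by
    refine star_congr (fun A hA => ?_) fun _ _ => rfl
    have := Finset.card_le_card hA
    rw [Finset.sum_eq_single A.card]
    · simp [sgn, sizeInd]
    · intro k _ hk; simp [sizeInd, hk.symm]
    · intro h; simp at h; omega
  have h2 : star (ker c lam) (fun A => ∑ k ∈ Finset.range (S.card + 1),
      (-1 : ℂ) ^ k * sizeInd k A) (fun _ => 1) S =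
      ∑ k ∈ Finset.range (S.card + 1), (-1 : ℂ) ^ k * S.card.choose k := by
    simp only [← star_sizeInd_ones hc hl hf, ← star_mul_left]
    simp only [star, Finset.sum_mul, Finset.mul_sum]
    exact Finset.sum_comm
  rw [h1, h2]
  have h3 := Int.alternating_sum_range_choose (n := S.card)
  have h4 := congrArg (Int.cast : ℤ → ℂ) h3
  push_cast at h4
  rw [h4]; simp [sizeInd]

theorem star_sizeInd_zero_left (F : Finset ι → ℂ) (f : ι → ι → ℂ) :
    star f (sizeInd 0) F = F := by
  funext S
  unfold star
  rw [Finset.sum_eq_single ∅]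
  · simp [sizeInd]
  · intro A _ hA; simp [sizeInd, hA]
  · simp

/-- On shell, the triple functional followed by the field reduces to a shuffle product. -/
theorem BetheOn.star_tripleV (hc : c ≠ 0) (hl : Function.Injective lam)
    (hf : ∀ i j, i ≠ j → ker c lam i j ≠ 0) {S : Finset ι} (h : BetheOn c lam l S)
    (Φ : Finset ι → ℂ) (k : ℕ) :
    star (ker c lam) (tripleV c lam l (fun _ => 1) (fun _ => 1) Φ) (sizeInd k) S =
      star (ker c lam) (fun B => sgn B * Φ B) (sizeInd k) S := by
  have h1 : tripleV c lam l (fun _ => 1) (fun _ => 1) Φ = star (ker c lam)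
      (fun A => lprod l A * 1) (star (ker c lam) (fun B => sgn B * Φ B) sgn) := by
    funext C; simp only [tripleV, mul_one]
  have h2 : star (ker c lam) (sizeInd k) (fun _ => 1) =
      star (ker c lam) (fun _ => 1) (sizeInd k) := by
    funext T; rw [star_sizeInd_ones hc hl hf, star_ones_sizeInd hc hl hf]
  -- The first factor moves to the right end as the constant 1, passes `sizeInd k` (both orders give
  -- the same binomial coefficient), and then cancels the sign factor.
  rw [h1, star_assoc, h.star_lprod hf, star_assoc, h2, ← star_assoc]
  have h3 : star (ker c lam) (star (ker c lam) (fun B => sgn B * Φ B) sgn) (fun _ => 1) =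
      fun B => sgn B * Φ B := by
    funext T
    rw [star_assoc, star_sgn_ones hc hl hf]
    have := star_iterate_right hc hl hf 0 (fun B => sgn B * Φ B) T
    simpa using this.symm
  rw [h3]

end OnShell

end BoseGas


namespace BoseGas

/-! ### Partitions into three pieces and the on-shell matrix element -/

section Triples

variable {ι : Type} [DecidableEq ι] {c : ℝ} {lam l : ι → ℂ}

/-- The sum over ordered partitions `(A', H, A)` of `C` with `|H| = r`. -/
noncomputable def tripleSum (f : ι → ι → ℂ) (C : Finset ι) (r : ℕ)
    (X : Finset ι → Finset ι → ℂ) : ℂ :=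
  ∑ D ∈ C.powerset, fp f D (C \ D) * star f (fun A' => X A' (C \ D)) (sizeInd r) D

theorem tripleSum_congr {f : ι → ι → ℂ} {C : Finset ι} {r : ℕ} {X Y : Finset ι → Finset ι → ℂ}
    (h : ∀ A' A, A' ⊆ C → A ⊆ C → Disjoint A' A → A'.card + r + A.card = C.card →
      X A' A = Y A' A) : tripleSum f C r X = tripleSum f C r Y := by
  refine Finset.sum_congr rfl fun D hD => ?_
  congr 1
  refine Finset.sum_congr rfl fun A' hA' => ?_
  have hD' := Finset.mem_powerset.1 hD
  have hA := Finset.mem_powerset.1 hA'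
  by_cases hr : (D \ A').card = r
  · beta_reduce
    rw [h A' (C \ D) (hA.trans hD') Finset.sdiff_subset
      (Finset.disjoint_of_subset_left hA Finset.disjoint_sdiff)]
    rw [← hr, Finset.card_sdiff_of_subset hA, Finset.card_sdiff_of_subset hD']
    have := Finset.card_le_card hA
    have := Finset.card_le_card hD'
    omega
  · simp [sizeInd, hr]

theorem tripleSum_sum {κ : Type*} (s : Finset κ) (f : ι → ι → ℂ) (C : Finset ι) (r : ℕ)
    (X : κ → Finset ι → Finset ι → ℂ) :
    tripleSum f C r (fun A' A => ∑ b ∈ s, X b A' A) = ∑ b ∈ s, tripleSum f C r (X b) := by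
  simp only [tripleSum, star, Finset.sum_mul, Finset.mul_sum]
  symm
  rw [Finset.sum_comm]
  exact Finset.sum_congr rfl fun D _ => Finset.sum_comm

theorem tripleSum_mul (a : ℂ) (f : ι → ι → ℂ) (C : Finset ι) (r : ℕ)
    (X : Finset ι → Finset ι → ℂ) :
    tripleSum f C r (fun A' A => a * X A' A) = a * tripleSum f C r X := by
  simp only [tripleSum, star_mul_left, Finset.mul_sum, mul_left_comm]

theorem tripleSum_prod (f : ι → ι → ℂ) (C : Finset ι) (r : ℕ) (F G : Finset ι → ℂ) :
    tripleSum f C r (fun A' A => F A' * G A) = star f (star f F (sizeInd r)) G C := by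
  refine Finset.sum_congr rfl fun D _ => ?_
  simp only [mul_comm _ (G _), star_mul_left]

theorem tripleSum_eq_sum_indicator (f : ι → ι → ℂ) (C : Finset ι) (r : ℕ)
    (X : Finset ι → Finset ι → ℂ) :
    tripleSum f C r X = ∑ A₀ ∈ C.powerset,
      tripleSum f C r (fun A' A => (if A' = A₀ then 1 else 0) * X A₀ A) := by
  rw [← tripleSum_sum]
  refine tripleSum_congr fun A' A hA' _ _ _ => ?_
  simp [hA']

/-- With A' frozen by an indicator, the inner sum is left multiplication by `sizeInd 1`, adjacent to
`sizeInd r`. Associativity merges these two, so the label taken out of A joins the middle piece. -/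
theorem tripleSum_move_right (hc : c ≠ 0) (hl : Function.Injective lam)
    (hf : ∀ i j, i ≠ j → ker c lam i j ≠ 0) (C : Finset ι) (r : ℕ)
    (Y : Finset ι → Finset ι → ℂ) :
    tripleSum (ker c lam) C r (fun A' A =>
      ∑ a ∈ A, fp (ker c lam) {a} (A.erase a) * Y A' (A.erase a)) =
      (r + 1) * tripleSum (ker c lam) C (r + 1) Y := by
  rw [tripleSum_eq_sum_indicator _ _ (r + 1), tripleSum_eq_sum_indicator _ _ r, Finset.mul_sum]
  refine Finset.sum_congr rfl fun A₀ _ => ?_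
  rw [tripleSum_prod, tripleSum_prod]
  have h1 : (fun A => ∑ a ∈ A, fp (ker c lam) {a} (A.erase a) * Y A₀ (A.erase a)) =
      star (ker c lam) (sizeInd 1) (Y A₀) := by
    funext A
    rw [← single_one, star_single_left]
    simp
  have h2 : star (ker c lam) (sizeInd r) (sizeInd 1) =
      fun A => ((r : ℂ) + 1) * sizeInd (r + 1) A := by
    funext A
    rw [star_const_sizeInd hc hl hf]
  rw [h1, ← star_assoc, ← star_mul_left]
  congr 1
  funext T
  rw [star_assoc, h2, star_mul_right]

theorem tripleSum_move_left (hc : c ≠ 0) (hl : Function.Injective lam)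
    (hf : ∀ i j, i ≠ j → ker c lam i j ≠ 0) (C : Finset ι) (r : ℕ)
    (Y : Finset ι → Finset ι → ℂ) :
    tripleSum (ker c lam) C r (fun A' A =>
      ∑ a ∈ A', fp (ker c lam) (A'.erase a) {a} * Y (A'.erase a) A) =
      (r + 1) * tripleSum (ker c lam) C (r + 1) Y := by
  have h0 : tripleSum (ker c lam) C r (fun A' A =>
      ∑ a ∈ A', fp (ker c lam) (A'.erase a) {a} * Y (A'.erase a) A) =
      ∑ A₀ ∈ C.powerset, tripleSum (ker c lam) C r (fun A' A =>
        (∑ a ∈ A', fp (ker c lam) (A'.erase a) {a} * if A'.erase a = A₀ then 1 else 0) * Y A₀ A) := by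
    rw [← tripleSum_sum]
    refine tripleSum_congr fun A' A hA' _ _ _ => ?_
    simp only [Finset.sum_mul]
    rw [Finset.sum_comm]
    refine Finset.sum_congr rfl fun a _ => ?_
    rw [Finset.sum_eq_single (A'.erase a)]
    · simp
    · intro b _ hb; simp [hb.symm]
    · intro h; exact absurd (Finset.mem_powerset.2 ((Finset.erase_subset _ _).trans hA')) h
  rw [h0, tripleSum_eq_sum_indicator _ _ (r + 1), Finset.mul_sum]
  refine Finset.sum_congr rfl fun A₀ _ => ?_
  rw [tripleSum_prod, tripleSum_prod]
  have h1 : (fun A' => ∑ a ∈ A', fp (ker c lam) (A'.erase a) {a} *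
      if A'.erase a = A₀ then 1 else 0) =
      star (ker c lam) (fun A' => if A' = A₀ then 1 else 0) (sizeInd 1) := by
    funext A
    rw [star_sizeInd_one_right]
  have h2 : star (ker c lam) (sizeInd 1) (sizeInd r) =
      fun A => ((r : ℂ) + 1) * sizeInd (r + 1) A := by
    funext A
    rw [star_sizeInd_const hc hl hf]
  rw [h1, ← star_mul_left]
  congr 1
  funext T
  rw [star_assoc, h2, star_mul_right]

/-- The piece A = γ \ A' stands first and carries its eigenvalues; the Bethe equations remove these
and put it last. -/
theorem BetheOn.tripleSum_eq (hf : ∀ i j, i ≠ j → ker c lam i j ≠ 0) {C : Finset ι}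
    (h : BetheOn c lam l C) (r : ℕ) (X : Finset ι → Finset ι → ℂ) :
    star (ker c lam) (fun γ => ∑ A' ∈ γ.powerset, lprod l (γ \ A') *
      fp (ker c lam) (γ \ A') A' * X A' (γ \ A')) (sizeInd r) C =
      tripleSum (ker c lam) C r X := by
  simp only [tripleSum, star, Finset.sum_mul, Finset.mul_sum]
  rw [Finset.sum_sigma', Finset.sum_sigma']
  have key : ∀ γ A' : Finset ι, A' ⊆ γ → γ ⊆ C →
      C \ (C \ (γ \ A')) = γ \ A' ∧ (C \ (γ \ A')) \ A' = C \ γ := by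
    intro γ A' h1 h2
    refine ⟨Finset.sdiff_sdiff_eq_self (Finset.sdiff_subset.trans h2), ?_⟩
    ext x; simp only [Finset.mem_sdiff]; have := @h1 x; tauto
  refine Finset.sum_bij' (fun p _ => ⟨C \ (p.1 \ p.2), p.2⟩) (fun p _ => ⟨C \ (p.1 \ p.2), p.2⟩)
    ?_ ?_ ?_ ?_ ?_
  · rintro ⟨γ, A'⟩ hp
    simp only [Finset.mem_sigma, Finset.mem_powerset] at hp ⊢
    refine ⟨Finset.sdiff_subset, fun x hx => ?_⟩
    simp only [Finset.mem_sdiff]; have := hp.1 (hp.2 hx); tauto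
  · rintro ⟨γ, A'⟩ hp
    simp only [Finset.mem_sigma, Finset.mem_powerset] at hp ⊢
    refine ⟨Finset.sdiff_subset, fun x hx => ?_⟩
    simp only [Finset.mem_sdiff]; have := hp.1 (hp.2 hx); tauto
  · rintro ⟨γ, A'⟩ hp
    simp only [Finset.mem_sigma, Finset.mem_powerset] at hp ⊢
    rw [(key γ A' hp.2 hp.1).2, Finset.sdiff_sdiff_eq_self hp.1]
  · rintro ⟨γ, A'⟩ hp
    simp only [Finset.mem_sigma, Finset.mem_powerset] at hp ⊢
    rw [(key γ A' hp.2 hp.1).2, Finset.sdiff_sdiff_eq_self hp.1]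
  · rintro ⟨γ, A'⟩ hp
    simp only [Finset.mem_sigma, Finset.mem_powerset] at hp ⊢
    obtain ⟨k1, k2⟩ := key γ A' hp.2 hp.1
    rw [k1, k2]
    have h1 := h.lprod_mul_fp hf (Finset.sdiff_subset.trans hp.1 : γ \ A' ⊆ C)
    have h2 : A' ⊆ C \ (γ \ A') := fun x hx => by
      simp only [Finset.mem_sdiff]; have := hp.1 (hp.2 hx); tauto
    rw [← h1, fp_sdiff_right h2 (γ \ A'), k2, fp_sdiff_left hp.2 (C \ γ)]
    ring

theorem eigE_union {γ W : Finset ι} (hd : Disjoint γ W) :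
    eigE c lam l (γ ∪ W) = ∑ A' ∈ γ.powerset, ∑ B' ∈ W.powerset,
      lprod l (γ \ A') * fp (ker c lam) (γ \ A') A' * (lprod l (W \ B') *
        fp (ker c lam) (W \ B') B' * (sgn A' * sgn B' * fp (ker c lam) (γ \ A') B' *
          fp (ker c lam) (W \ B') A')) := by
  rw [eigE, ← star_reverse, star, ← Finset.sum_product']
  have hdis : ∀ x, x ∈ γ → x ∉ W := fun x h1 h2 => Finset.disjoint_left.1 hd h1 h2
  refine Finset.sum_bij' (fun A _ => (A ∩ γ, A ∩ W)) (fun p _ => p.1 ∪ p.2) ?_ ?_ ?_ ?_ ?_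
  · intro A hA; simp [Finset.inter_subset_right]
  · rintro ⟨A', B'⟩ hp
    simp only [Finset.mem_product, Finset.mem_powerset] at hp ⊢
    exact Finset.union_subset_union hp.1 hp.2
  · intro A hA
    rw [← Finset.inter_union_distrib_left, Finset.inter_eq_left.2 (Finset.mem_powerset.1 hA)]
  · rintro ⟨A', B'⟩ hp
    simp only [Finset.mem_product, Finset.mem_powerset] at hp ⊢
    rw [Prod.mk.injEq]
    constructor
    · ext x; simp only [Finset.mem_inter, Finset.mem_union]
      have := @hp.1 x; have := @hp.2 x; have := hdis x; tauto
    · ext x; simp only [Finset.mem_inter, Finset.mem_union]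
      have := @hp.1 x; have := @hp.2 x; have := hdis x; tauto
  · intro A hA
    have hA' := Finset.mem_powerset.1 hA
    have e1 : (γ ∪ W) \ A = (γ \ (A ∩ γ)) ∪ (W \ (A ∩ W)) := by
      ext x; simp only [Finset.mem_sdiff, Finset.mem_inter, Finset.mem_union]; tauto
    have e2 : A = (A ∩ γ) ∪ (A ∩ W) := by
      rw [← Finset.inter_union_distrib_left, Finset.inter_eq_left.2 hA']
    have d1 : Disjoint (A ∩ γ) (A ∩ W) := Finset.disjoint_of_subset_left Finset.inter_subset_right
      (Finset.disjoint_of_subset_right Finset.inter_subset_right hd)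
    have d2 : Disjoint (γ \ (A ∩ γ)) (W \ (A ∩ W)) :=
      Finset.disjoint_of_subset_left Finset.sdiff_subset
        (Finset.disjoint_of_subset_right Finset.sdiff_subset hd)
    have e3 : sgn A = sgn (A ∩ γ) * sgn (A ∩ W) := by
      rw [sgn_eq_lprod, lprod, lprod, lprod, ← Finset.prod_union d1, ← e2]
    have e4 : lprod l ((γ ∪ W) \ A) = lprod l (γ \ (A ∩ γ)) * lprod l (W \ (A ∩ W)) := by
      rw [lprod, lprod, lprod, ← Finset.prod_union d2, e1]
    have e5 : fp (fun i j => ker c lam j i) A ((γ ∪ W) \ A) =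
        fp (ker c lam) (γ \ (A ∩ γ)) (A ∩ γ) * fp (ker c lam) (γ \ (A ∩ γ)) (A ∩ W) *
        (fp (ker c lam) (W \ (A ∩ W)) (A ∩ γ) * fp (ker c lam) (W \ (A ∩ W)) (A ∩ W)) := by
      rw [fp_swap, ← fp_union_right d1, ← fp_union_right d1, ← e2, ← fp_union_left d2, e1]
    rw [e3, e4, e5]
    ring

/-- The basic double partition sum, with a weight depending on `n = |B'| - |A|`. -/
noncomputable def doubleSum (f : ι → ι → ℂ) (C B : Finset ι) (r s : ℕ) (w : ℂ → ℂ) : ℂ :=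
  tripleSum f C r fun A' A => sgn A * tripleSum f B s fun B' D =>
    sgn D * (fp f A B' * fp f D A' * w ((B'.card : ℂ) - A.card))

theorem pairing_eq_doubleSum (hc : c ≠ 0) (hl : Function.Injective lam)
    (hf : ∀ i j, i ≠ j → ker c lam i j ≠ 0) (k : ℕ) (cs ws : List ι) (hw : (cs ++ ws).Nodup)
    (hlen : cs.length = ws.length) (hC : BetheOn c lam l cs.toFinset)
    (hB : BetheOn c lam l ws.toFinset) :
    pairing c lam l ((opPsiDag c lam)^[k] (Finsupp.single cs 1))
      ((opPsi c lam l)^[k] (Finsupp.single ws 1)) =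
    (c : ℂ) ^ k * (k.factorial : ℂ) ^ 2 * (-1) ^ (cs.length + k) *
      doubleSum (ker c lam) cs.toFinset ws.toFinset k k (fun _ => 1) := by
  have hn := List.nodup_append.1 hw
  have hd : Disjoint cs.toFinset ws.toFinset := by
    rw [Finset.disjoint_left]
    intro a h1 h2
    exact hn.2.2 a (by simpa using h1) a (by simpa using h2) rfl
  have hcard : ws.toFinset.card = cs.length := by
    rw [List.toFinset_card_of_nodup hn.2.1, hlen]
  rw [pairing_fields hl hf k cs ws hw hlen, star_iterate_right hc hl hf]
  set C := cs.toFinset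
  set B := ws.toFinset
  have h1 : (fun X => (star (ker c lam) (single l))^[k] (fun W => tripleV c lam l (fun _ => 1)
      (fun _ => 1) (fun γ => eigE c lam l (γ ∪ W)) X) B) = fun X =>
      k.factorial * tripleV c lam l (fun _ => 1) (fun _ => 1) (fun γ =>
        star (ker c lam) (fun W => eigE c lam l (γ ∪ W)) (sizeInd k) B) X := by
    funext X
    rw [star_iterate_left hc hl hf, hB.star_lprod hf]
    congr 1
    simp only [star]
    rw [tripleV_sum]
    refine Finset.sum_congr rfl fun W _ => ?_
    rw [tripleV_mul]
    congr 1
    simp only [mul_comm _ (sizeInd k _)]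
    rw [tripleV_mul]
  rw [h1, star_mul_left, hC.star_tripleV hc hl hf]
  have h2 : star (ker c lam) (fun γ => sgn γ * star (ker c lam) (fun W => eigE c lam l (γ ∪ W))
      (sizeInd k) B) (sizeInd k) C = star (ker c lam) (fun γ => ∑ A' ∈ γ.powerset,
        lprod l (γ \ A') * fp (ker c lam) (γ \ A') A' * (sgn (γ \ A') *
          tripleSum (ker c lam) B k fun B' D => sgn B' *
            (fp (ker c lam) (γ \ A') B' * fp (ker c lam) D A'))) (sizeInd k) C := by
    refine star_congr (fun γ hγ => ?_) fun _ _ => rfl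
    have h3 : star (ker c lam) (fun W => eigE c lam l (γ ∪ W)) (sizeInd k) B =
        star (ker c lam) (fun W => ∑ A' ∈ γ.powerset, lprod l (γ \ A') *
          fp (ker c lam) (γ \ A') A' * (sgn A' * ∑ B' ∈ W.powerset, lprod l (W \ B') *
            fp (ker c lam) (W \ B') B' * (sgn B' * (fp (ker c lam) (γ \ A') B' *
              fp (ker c lam) (W \ B') A')))) (sizeInd k) B := by
      refine star_congr (fun W hW => ?_) fun _ _ => rfl
      rw [eigE_union (hd.mono hγ hW)]
      refine Finset.sum_congr rfl fun A' _ => ?_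
      rw [Finset.mul_sum, Finset.mul_sum]
      refine Finset.sum_congr rfl fun B' _ => ?_
      ring
    have h4 : ∀ (s : Finset (Finset ι)) (F : Finset ι → Finset ι → ℂ) (G : Finset ι → ℂ),
        star (ker c lam) (fun W => ∑ A' ∈ s, F A' W) G B =
          ∑ A' ∈ s, star (ker c lam) (F A') G B := by
      intro s F G
      simp only [star, Finset.sum_mul, Finset.mul_sum]
      exact Finset.sum_comm
    rw [h3, h4, Finset.mul_sum]
    refine Finset.sum_congr rfl fun A' hA' => ?_
    rw [star_mul_left, star_mul_left, hB.tripleSum_eq hf k (fun B' D => sgn B' *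
            (fp (ker c lam) (γ \ A') B' * fp (ker c lam) D A'))]
    have : sgn γ = sgn A' * sgn (γ \ A') := by
      rw [sgn_eq_lprod, lprod, lprod, lprod, mul_comm,
        Finset.prod_sdiff (Finset.mem_powerset.1 hA')]
    rw [this]
    linear_combination (lprod l (γ \ A') * fp (ker c lam) (γ \ A') A' * sgn (γ \ A') *
      tripleSum (ker c lam) B k fun B' D => sgn B' *
            (fp (ker c lam) (γ \ A') B' * fp (ker c lam) D A')) * sgn_mul_self A'
  rw [h2, hC.tripleSum_eq hf k (fun A' A => sgn A * tripleSum (ker c lam) B k fun B' D => sgn B' *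
            (fp (ker c lam) A B' * fp (ker c lam) D A'))]
  have h5 : doubleSum (ker c lam) C B k k (fun _ => 1) = (-1) ^ (cs.length + k) *
      tripleSum (ker c lam) C k (fun A' A => sgn A * tripleSum (ker c lam) B k fun B' D => sgn B' *
            (fp (ker c lam) A B' * fp (ker c lam) D A')) := by
    rw [doubleSum, ← tripleSum_mul]
    refine tripleSum_congr fun A' A _ _ _ _ => ?_
    rw [mul_left_comm ((-1 : ℂ) ^ _), ← tripleSum_mul ((-1 : ℂ) ^ _)]
    congr 1
    apply tripleSum_congr
    intro B' D _ _ _ hcd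
    -- |B'| + k + |D| = N allows the sign of B' to be traded for that of D, the form used in
    -- `doubleSum`.
    have : sgn D = (-1 : ℂ) ^ (cs.length + k) * sgn B' := by
      unfold sgn
      rw [← hcard, ← hcd, ← pow_add]
      have : B'.card + k + D.card + k + B'.card = 2 * (B'.card + k) + D.card := by ring
      rw [this, pow_add, pow_mul]; simp
    rw [this]; ring
  rw [h5]
  have h6 : ((-1 : ℂ) ^ (cs.length + k)) * (-1) ^ (cs.length + k) = 1 := by
    rw [← mul_pow]; simp
  linear_combination (-(c : ℂ) ^ k * (k.factorial : ℂ) ^ 2 * tripleSum (ker c lam) C k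
    (fun A' A => sgn A * tripleSum (ker c lam) B k fun B' D => sgn B' *
            (fp (ker c lam) A B' * fp (ker c lam) D A'))) * h6

end Triples

end BoseGas


namespace BoseGas

/-! ### Elimination of the middle pieces -/

section Removal

variable {ι : Type} [DecidableEq ι] {c : ℝ} {lam l : ι → ℂ}

theorem tripleSum_add (f : ι → ι → ℂ) (C : Finset ι) (r : ℕ) (X Y : Finset ι → Finset ι → ℂ) :
    tripleSum f C r (fun A' A => X A' A + Y A' A) = tripleSum f C r X + tripleSum f C r Y := by
  have := tripleSum_sum (Finset.univ : Finset Bool) f C r fun b => bif b then X else Y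
  simpa using this

/-- A label passes from B' to the middle piece of B. Applied to B' and A, `sum_fp_erase_left` trades
this for the factor n = |B'| - |A| and for a label of A passing to the middle piece of C. The first
move lowers n by one and the second raises it by one, whence the shifts 1 and 2. -/
theorem doubleSum_succ_left (hc : c ≠ 0) (hl : Function.Injective lam)
    (hf : ∀ i j, i ≠ j → ker c lam i j ≠ 0) {C B : Finset ι} (hCB : Disjoint C B) (r s : ℕ)
    (w : ℂ → ℂ) : ((s : ℂ) + 1) * doubleSum (ker c lam) C B r (s + 1) w =
      doubleSum (ker c lam) C B r s (fun n => n * w (n - 1)) -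
        (r + 1) * doubleSum (ker c lam) C B (r + 1) s fun n => w (n - 2) := by
  have h1 : ∀ A' A, A' ⊆ C → A ⊆ C → ((s : ℂ) + 1) * tripleSum (ker c lam) B (s + 1)
      (fun B' D => sgn D * (fp (ker c lam) A B' * fp (ker c lam) D A' *
        w ((B'.card : ℂ) - A.card))) =
      tripleSum (ker c lam) B s (fun B' D => sgn D * (fp (ker c lam) A B' * fp (ker c lam) D A' *
        (((B'.card : ℂ) - A.card) * w ((B'.card : ℂ) - A.card - 1)))) +
      ∑ a ∈ A, fp (ker c lam) {a} (A.erase a) * tripleSum (ker c lam) B s (fun B' D => sgn D *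
        (fp (ker c lam) (A.erase a) B' * fp (ker c lam) D A' *
          w ((B'.card : ℂ) - (A.erase a).card - 2))) := by
    intro A' A _ hA
    simp only [← tripleSum_mul (fp _ _ _)]
    rw [← tripleSum_move_left hc hl hf, ← tripleSum_sum, ← tripleSum_add]
    refine tripleSum_congr fun B' D hB' hD _ _ => ?_
    have h2 := sum_fp_erase_left hc hl hf
      (Finset.disjoint_of_subset_left hB' (Finset.disjoint_of_subset_right hA hCB.symm))
    have h3 : ∀ j ∈ B', fp (ker c lam) (B'.erase j) {j} * (sgn D * (fp (ker c lam) A (B'.erase j) *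
        fp (ker c lam) D A' * w (((B'.erase j).card : ℂ) - A.card))) =
        (fp (ker c lam) (B'.erase j) {j} * fp (ker c lam) A (B'.erase j)) *
          (sgn D * fp (ker c lam) D A' * w ((B'.card : ℂ) - A.card - 1)) := by
      intro j hj
      rw [Finset.cast_card_erase_of_mem hj]
      rw [show (B'.card : ℂ) - 1 - A.card = (B'.card : ℂ) - A.card - 1 by ring]; ring
    have h4 : ∀ a ∈ A, fp (ker c lam) {a} (A.erase a) * (sgn D * (fp (ker c lam) (A.erase a) B' *
        fp (ker c lam) D A' * w ((B'.card : ℂ) - (A.erase a).card - 2))) =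
        (fp (ker c lam) {a} (A.erase a) * fp (ker c lam) (A.erase a) B') *
          (sgn D * fp (ker c lam) D A' * w ((B'.card : ℂ) - A.card - 1)) := by
      intro j hj
      rw [Finset.cast_card_erase_of_mem hj]
      rw [show (B'.card : ℂ) - (A.card - 1) - 2 = (B'.card : ℂ) - A.card - 1 by ring]; ring
    rw [Finset.sum_congr rfl h3, Finset.sum_congr rfl h4, ← Finset.sum_mul, ← Finset.sum_mul, h2]
    ring
  rw [eq_sub_iff_add_eq, doubleSum, doubleSum, doubleSum, ← tripleSum_move_right hc hl hf,
    ← tripleSum_mul, ← tripleSum_add]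
  refine tripleSum_congr fun A' A hA' hA _ _ => ?_
  rw [mul_left_comm, h1 A' A hA' hA, mul_add, Finset.mul_sum, add_assoc, ← Finset.sum_add_distrib]
  rw [Finset.sum_eq_zero, add_zero]
  intro a ha
  rw [sgn_erase ha]; ring

/-- The same mechanism for D and A'; here |D| - |A'| = r - s - n by the equality of cardinalities,
and the sign of D changes when it loses a label. Comparison with `doubleSum_succ_left` gives
relations among sums with smaller middle pieces. -/
theorem doubleSum_succ_right (hc : c ≠ 0) (hl : Function.Injective lam)
    (hf : ∀ i j, i ≠ j → ker c lam i j ≠ 0) {C B : Finset ι} (hCB : Disjoint C B)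
    (hcard : C.card = B.card) (r s : ℕ)
    (w : ℂ → ℂ) : ((s : ℂ) + 1) * doubleSum (ker c lam) C B r (s + 1) w =
      doubleSum (ker c lam) C B r s (fun n => (n - (r - s)) * w n) -
        (r + 1) * doubleSum (ker c lam) C B (r + 1) s w := by
  have h1 : ∀ A' A, A' ⊆ C → A ⊆ C → A'.card + r + A.card = C.card →
      ((s : ℂ) + 1) * tripleSum (ker c lam) B (s + 1)
      (fun B' D => sgn D * (fp (ker c lam) A B' * fp (ker c lam) D A' *
        w ((B'.card : ℂ) - A.card))) =
      tripleSum (ker c lam) B s (fun B' D => sgn D * (fp (ker c lam) A B' * fp (ker c lam) D A' *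
        (((B'.card : ℂ) - A.card - (r - s)) * w ((B'.card : ℂ) - A.card)))) -
      ∑ a ∈ A', fp (ker c lam) (A'.erase a) {a} * tripleSum (ker c lam) B s (fun B' D => sgn D *
        (fp (ker c lam) A B' * fp (ker c lam) D (A'.erase a) *
          w ((B'.card : ℂ) - A.card))) := by
    intro A' A hA' _ hAA
    rw [eq_sub_iff_add_eq]
    simp only [← tripleSum_mul (fp _ _ _)]
    rw [← tripleSum_move_right hc hl hf, ← tripleSum_sum, ← tripleSum_add]
    refine tripleSum_congr fun B' D hB' hD _ hBD => ?_
    have h2 := sum_fp_erase_right hc hl hf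
      (Finset.disjoint_of_subset_left hD (Finset.disjoint_of_subset_right hA' hCB.symm))
    have h3 : ∀ j ∈ D, fp (ker c lam) {j} (D.erase j) * (sgn (D.erase j) * (fp (ker c lam) A B' *
        fp (ker c lam) (D.erase j) A' * w ((B'.card : ℂ) - A.card))) =
        (fp (ker c lam) {j} (D.erase j) * fp (ker c lam) (D.erase j) A') *
          (-sgn D * fp (ker c lam) A B' * w ((B'.card : ℂ) - A.card)) := by
      intro j hj
      rw [sgn_erase hj]; ring
    have h4 : ∀ a ∈ A', fp (ker c lam) (A'.erase a) {a} * (sgn D * (fp (ker c lam) A B' *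
        fp (ker c lam) D (A'.erase a) * w ((B'.card : ℂ) - A.card))) =
        (fp (ker c lam) (A'.erase a) {a} * fp (ker c lam) D (A'.erase a)) *
          (sgn D * fp (ker c lam) A B' * w ((B'.card : ℂ) - A.card)) := fun j hj => by ring
    rw [Finset.sum_congr rfl h3, Finset.sum_congr rfl h4, ← Finset.sum_mul, ← Finset.sum_mul, h2]
    have h5 : (D.card : ℂ) - A'.card = (r - s) - ((B'.card : ℂ) - A.card) := by
      have : B'.card + s + D.card = A'.card + r + A.card := by omega
      have : (B'.card : ℂ) + s + D.card = A'.card + r + A.card := by exact_mod_cast this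
      linear_combination this
    rw [h5]
    ring
  rw [eq_sub_iff_add_eq, doubleSum, doubleSum, doubleSum, ← tripleSum_move_left hc hl hf,
    ← tripleSum_mul, ← tripleSum_add]
  refine tripleSum_congr fun A' A hA' hA _ hAA => ?_
  rw [mul_left_comm, h1 A' A hA' hA hAA, mul_sub, Finset.mul_sum, sub_add,
    ← Finset.sum_sub_distrib, Finset.sum_eq_zero, sub_zero]
  intro a ha
  ring

theorem doubleSum_add (f : ι → ι → ℂ) (C B : Finset ι) (r s : ℕ) (w w' : ℂ → ℂ) :
    doubleSum f C B r s (fun n => w n + w' n) = doubleSum f C B r s w + doubleSum f C B r s w' := by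
  simp only [doubleSum, mul_add, tripleSum_add]

theorem doubleSum_mul (f : ι → ι → ℂ) (C B : Finset ι) (r s : ℕ) (a : ℂ) (w : ℂ → ℂ) :
    doubleSum f C B r s (fun n => a * w n) = a * doubleSum f C B r s w := by
  simp only [doubleSum, mul_left_comm _ a, tripleSum_mul]

/-- Powers of n up to the fourth are fed into the recursions, which multiply them by one more linear
factor. -/
theorem doubleSum_quintic (f : ι → ι → ℂ) (C B : Finset ι) (r s : ℕ) (a₀ a₁ a₂ a₃ a₄ a₅ : ℂ)
    {w : ℂ → ℂ}
    (hw : ∀ n, w n = a₀ + a₁ * n + a₂ * n ^ 2 + a₃ * n ^ 3 + a₄ * n ^ 4 + a₅ * n ^ 5) :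
    doubleSum f C B r s w =
      a₀ * doubleSum f C B r s (fun n => n ^ 0) + a₁ * doubleSum f C B r s (fun n => n ^ 1) +
      a₂ * doubleSum f C B r s (fun n => n ^ 2) + a₃ * doubleSum f C B r s (fun n => n ^ 3) +
      a₄ * doubleSum f C B r s (fun n => n ^ 4) + a₅ * doubleSum f C B r s (fun n => n ^ 5) := by
  simp only [← doubleSum_mul, ← doubleSum_add]
  congr 1
  funext n
  rw [hw]; ring

theorem doubleSum_one_one (hc : c ≠ 0) (hl : Function.Injective lam)
    (hf : ∀ i j, i ≠ j → ker c lam i j ≠ 0) {C B : Finset ι} (hCB : Disjoint C B)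
    (hcard : C.card = B.card) :
    doubleSum (ker c lam) C B 1 1 (fun n => n ^ 0) =
      1 / 2 * doubleSum (ker c lam) C B 0 0 (fun n => n ^ 2) := by
  have expandL := fun (r s i : ℕ) (a₀ a₁ a₂ a₃ a₄ a₅ b₀ b₁ b₂ b₃ b₄ b₅ : ℂ)
    (h : ∀ n : ℂ, n * (n - 1) ^ i =
      a₀ + a₁ * n + a₂ * n ^ 2 + a₃ * n ^ 3 + a₄ * n ^ 4 + a₅ * n ^ 5)
    (h' : ∀ n : ℂ, (n - 2) ^ i =
      b₀ + b₁ * n + b₂ * n ^ 2 + b₃ * n ^ 3 + b₄ * n ^ 4 + b₅ * n ^ 5) =>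
    (doubleSum_succ_left hc hl hf hCB r s fun n => n ^ i).trans
      (congrArg₂ (fun x y : ℂ => x - ((r : ℂ) + 1) * y) (doubleSum_quintic _ _ _ _ _ _ _ _ _ _ _ h)
        (doubleSum_quintic _ _ _ _ _ _ _ _ _ _ _ h'))
  have expandR := fun (r s i : ℕ) (a₀ a₁ a₂ a₃ a₄ a₅ b₀ b₁ b₂ b₃ b₄ b₅ : ℂ)
    (h : ∀ n : ℂ, (n - (r - s)) * n ^ i =
      a₀ + a₁ * n + a₂ * n ^ 2 + a₃ * n ^ 3 + a₄ * n ^ 4 + a₅ * n ^ 5)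
    (h' : ∀ n : ℂ, n ^ i =
      b₀ + b₁ * n + b₂ * n ^ 2 + b₃ * n ^ 3 + b₄ * n ^ 4 + b₅ * n ^ 5) =>
    (doubleSum_succ_right hc hl hf hCB hcard r s fun n => n ^ i).trans
      (congrArg₂ (fun x y : ℂ => x - ((r : ℂ) + 1) * y) (doubleSum_quintic _ _ _ _ _ _ _ _ _ _ _ h)
        (doubleSum_quintic _ _ _ _ _ _ _ _ _ _ _ h'))
  -- The letter names the recursion; the digits are the sizes r and s + 1 of the middle pieces on
  -- its left side and the exponent of n.
  have l011 := expandL 0 0 1 0 (-1) 1 0 0 0 (-2) 1 0 0 0 0 (by intro; ring) (by intro; ring)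
  have r011 := expandR 0 0 1 0 0 1 0 0 0 0 1 0 0 0 0 (by intro; push_cast; ring) (by intro; ring)
  have l012 := expandL 0 0 2 0 1 (-2) 1 0 0 4 (-4) 1 0 0 0 (by intro; ring) (by intro; ring)
  have r012 := expandR 0 0 2 0 0 0 1 0 0 0 0 1 0 0 0 (by intro; push_cast; ring) (by intro; ring)
  have l110 := expandL 1 0 0 0 1 0 0 0 0 1 0 0 0 0 0 (by intro; ring) (by intro; ring)
  have r110 := expandR 1 0 0 (-1) 1 0 0 0 0 1 0 0 0 0 0 (by intro; push_cast; ring) (by intro; ring)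
  have l111 := expandL 1 0 1 0 (-1) 1 0 0 0 (-2) 1 0 0 0 0 (by intro; ring) (by intro; ring)
  have r111 := expandR 1 0 1 0 (-1) 1 0 0 0 0 1 0 0 0 0 (by intro; push_cast; ring) (by intro; ring)
  push_cast at *
  -- Solution of the linear system that eliminates all sums with piece sizes (0,1), (1,0) and (2,0).
  linear_combination (-1/4) * l011 + (1/4) * r011 + (-1/4) * l012 + (1/4) * r012 + (1/2) * l110 + (1/2) * r110 + (1/2) * l111 + (-1/2) * r111

theorem doubleSum_two_two (hc : c ≠ 0) (hl : Function.Injective lam)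
    (hf : ∀ i j, i ≠ j → ker c lam i j ≠ 0) {C B : Finset ι} (hCB : Disjoint C B)
    (hcard : C.card = B.card) :
    24 * doubleSum (ker c lam) C B 2 2 (fun n => n ^ 0) =
      doubleSum (ker c lam) C B 0 0 (fun n => n ^ 4) - doubleSum (ker c lam) C B 0 0 (fun n => n ^ 2) := by
  have expandL := fun (r s i : ℕ) (a₀ a₁ a₂ a₃ a₄ a₅ b₀ b₁ b₂ b₃ b₄ b₅ : ℂ)
    (h : ∀ n : ℂ, n * (n - 1) ^ i =
      a₀ + a₁ * n + a₂ * n ^ 2 + a₃ * n ^ 3 + a₄ * n ^ 4 + a₅ * n ^ 5)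
    (h' : ∀ n : ℂ, (n - 2) ^ i =
      b₀ + b₁ * n + b₂ * n ^ 2 + b₃ * n ^ 3 + b₄ * n ^ 4 + b₅ * n ^ 5) =>
    (doubleSum_succ_left hc hl hf hCB r s fun n => n ^ i).trans
      (congrArg₂ (fun x y : ℂ => x - ((r : ℂ) + 1) * y) (doubleSum_quintic _ _ _ _ _ _ _ _ _ _ _ h)
        (doubleSum_quintic _ _ _ _ _ _ _ _ _ _ _ h'))
  have expandR := fun (r s i : ℕ) (a₀ a₁ a₂ a₃ a₄ a₅ b₀ b₁ b₂ b₃ b₄ b₅ : ℂ)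
    (h : ∀ n : ℂ, (n - (r - s)) * n ^ i =
      a₀ + a₁ * n + a₂ * n ^ 2 + a₃ * n ^ 3 + a₄ * n ^ 4 + a₅ * n ^ 5)
    (h' : ∀ n : ℂ, n ^ i =
      b₀ + b₁ * n + b₂ * n ^ 2 + b₃ * n ^ 3 + b₄ * n ^ 4 + b₅ * n ^ 5) =>
    (doubleSum_succ_right hc hl hf hCB hcard r s fun n => n ^ i).trans
      (congrArg₂ (fun x y : ℂ => x - ((r : ℂ) + 1) * y) (doubleSum_quintic _ _ _ _ _ _ _ _ _ _ _ h)
        (doubleSum_quintic _ _ _ _ _ _ _ _ _ _ _ h'))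
  have l011 := expandL 0 0 1 0 (-1) 1 0 0 0 (-2) 1 0 0 0 0 (by intro; ring) (by intro; ring)
  have r011 := expandR 0 0 1 0 0 1 0 0 0 0 1 0 0 0 0 (by intro; push_cast; ring) (by intro; ring)
  have l012 := expandL 0 0 2 0 1 (-2) 1 0 0 4 (-4) 1 0 0 0 (by intro; ring) (by intro; ring)
  have r012 := expandR 0 0 2 0 0 0 1 0 0 0 0 1 0 0 0 (by intro; push_cast; ring) (by intro; ring)
  have l013 := expandL 0 0 3 0 (-1) 3 (-3) 1 0 (-8) 12 (-6) 1 0 0 (by intro; ring) (by intro; ring)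
  have r013 := expandR 0 0 3 0 0 0 0 1 0 0 0 0 1 0 0 (by intro; push_cast; ring) (by intro; ring)
  have l014 := expandL 0 0 4 0 1 (-4) 6 (-4) 1 16 (-32) 24 (-8) 1 0 (by intro; ring) (by intro; ring)
  have r014 := expandR 0 0 4 0 0 0 0 0 1 0 0 0 0 1 0 (by intro; push_cast; ring) (by intro; ring)
  have l111 := expandL 1 0 1 0 (-1) 1 0 0 0 (-2) 1 0 0 0 0 (by intro; ring) (by intro; ring)
  have r111 := expandR 1 0 1 0 (-1) 1 0 0 0 0 1 0 0 0 0 (by intro; push_cast; ring) (by intro; ring)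
  have l113 := expandL 1 0 3 0 (-1) 3 (-3) 1 0 (-8) 12 (-6) 1 0 0 (by intro; ring) (by intro; ring)
  have r113 := expandR 1 0 3 0 0 0 (-1) 1 0 0 0 0 1 0 0 (by intro; push_cast; ring) (by intro; ring)
  have l210 := expandL 2 0 0 0 1 0 0 0 0 1 0 0 0 0 0 (by intro; ring) (by intro; ring)
  have l211 := expandL 2 0 1 0 (-1) 1 0 0 0 (-2) 1 0 0 0 0 (by intro; ring) (by intro; ring)
  have r211 := expandR 2 0 1 0 (-2) 1 0 0 0 0 1 0 0 0 0 (by intro; push_cast; ring) (by intro; ring)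
  have l212 := expandL 2 0 2 0 1 (-2) 1 0 0 4 (-4) 1 0 0 0 (by intro; ring) (by intro; ring)
  have r212 := expandR 2 0 2 0 0 (-2) 1 0 0 0 0 1 0 0 0 (by intro; push_cast; ring) (by intro; ring)
  have l220 := expandL 2 1 0 0 1 0 0 0 0 1 0 0 0 0 0 (by intro; ring) (by intro; ring)
  have r220 := expandR 2 1 0 (-1) 1 0 0 0 0 1 0 0 0 0 0 (by intro; push_cast; ring) (by intro; ring)
  have l221 := expandL 2 1 1 0 (-1) 1 0 0 0 (-2) 1 0 0 0 0 (by intro; ring) (by intro; ring)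
  have r221 := expandR 2 1 1 0 (-1) 1 0 0 0 0 1 0 0 0 0 (by intro; push_cast; ring) (by intro; ring)
  push_cast at *
  -- The same elimination, now of all sums with piece sizes other than (0,0) and (2,2).
  linear_combination (1/2) * l011 + (-1/2) * r011 + (1/4) * l012 + (-1/4) * r012 + (-1/2) * l013 + (1/2) * r013 + (-1/4) * l014 + (1/4) * r014 + (4) * l111 + (-4) * r111 + (-1) * l113 + (1) * r113 + (-6) * l210 + (3) * l211 + (9) * r211 + (3) * l212 + (-3) * r212 + (6) * l220 + (6) * r220 + (6) * l221 + (-6) * r221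

end Removal

end BoseGas


namespace BoseGas

/-! ### Cauchy determinants and the generating function -/

section Cauchy

open Matrix

theorem det_add_rows {n R : Type*} [Fintype n] [DecidableEq n] [CommRing R] (A B : n → n → R) :
    det (of fun i j => A i j + B i j) =
      ∑ s : Finset n, det (of fun i j => if i ∈ s then B i j else A i j) := by
  have := (detRowAlternating (R := R) (n := n)).map_add_univ B A
  have e : (of fun i j => A i j + B i j : Matrix n n R) = B + A := by
    ext i j; simp [add_comm]
  rw [e]
  refine this.trans (Finset.sum_congr rfl fun s _ => ?_)
  refine congrArg det ?_
  ext i j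
  by_cases h : i ∈ s <;> simp [h]

theorem det_add_cols {n R : Type*} [Fintype n] [DecidableEq n] [CommRing R] (A B : n → n → R) :
    det (of fun i j => A i j + B i j) =
      ∑ s : Finset n, det (of fun i j => if j ∈ s then B i j else A i j) := by
  rw [← det_transpose]
  refine (det_add_rows (fun i j => A j i) fun i j => B j i).trans
    (Finset.sum_congr rfl fun s _ => ?_)
  rw [← det_transpose]
  rfl

variable {n : ℕ}

/-- Clearing denominators row by row leaves polynomials q j of degree below n evaluated at x i,
hence a Vandermonde determinant in x times the determinant of their coefficients. The latter is
found by setting x = y, where the matrix is diagonal. -/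
theorem det_one_div_sub (x y : Fin n → ℂ) (hy : Function.Injective y)
    (hxy : ∀ i j, x i - y j ≠ 0) :
    det (of fun i j => 1 / (x i - y j)) * ∏ i, ∏ j, (x i - y j) =
      (∏ i, ∏ j ∈ Finset.Ioi i, (x j - x i)) * ∏ i, ∏ j ∈ Finset.Ioi i, (y i - y j) := by
  let q : Fin n → Polynomial ℂ := fun j =>
    ∏ k ∈ Finset.univ.erase j, (Polynomial.X - Polynomial.C (y k))
  have hq : ∀ j, (q j).natDegree < n := fun j => by
    rw [Polynomial.natDegree_prod_of_monic _ _ fun k _ => Polynomial.monic_X_sub_C _]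
    simp only [Polynomial.natDegree_X_sub_C, Finset.sum_const, smul_eq_mul, mul_one]
    rw [Finset.card_erase_of_mem (Finset.mem_univ j), Finset.card_univ, Fintype.card_fin]
    have := j.pos; omega
  let K : Matrix (Fin n) (Fin n) ℂ := of fun k j => (q j).coeff k
  have hK : ∀ u : Fin n → ℂ, det (of fun i j => (q j).eval (u i)) =
      (∏ i, ∏ j ∈ Finset.Ioi i, (u j - u i)) * det K := by
    intro u
    rw [← det_vandermonde, ← det_mul]
    congr 1
    ext i j
    rw [of_apply, Polynomial.eval_eq_sum_range' (hq j), mul_apply, Finset.sum_range]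
    exact Finset.sum_congr rfl fun k _ => by
      rw [vandermonde_apply, mul_comm]; rfl
  have h1 : det (of fun i j => 1 / (x i - y j)) * ∏ i, ∏ j, (x i - y j) =
      det (of fun i j => (q j).eval (x i)) := by
    rw [mul_comm, ← det_mul_column]
    congr 1
    ext i j
    simp only [of_apply, q, Polynomial.eval_prod, Polynomial.eval_sub, Polynomial.eval_X,
      Polynomial.eval_C]
    rw [← Finset.mul_prod_erase _ _ (Finset.mem_univ j)]
    have := hxy i j
    field_simp
  have h2 : det (of fun i j => (q j).eval (y i)) =
      (∏ i, ∏ j ∈ Finset.Ioi i, (y j - y i)) * ∏ i, ∏ j ∈ Finset.Ioi i, (y i - y j) := by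
    have : (of fun i j => (q j).eval (y i) : Matrix (Fin n) (Fin n) ℂ) =
        diagonal fun j => ∏ k ∈ Finset.univ.erase j, (y j - y k) := by
      ext i j
      simp only [of_apply, q, Polynomial.eval_prod, Polynomial.eval_sub, Polynomial.eval_X,
        Polynomial.eval_C]
      by_cases h : i = j
      · subst h; simp
      · rw [diagonal_apply_ne _ h]
        exact Finset.prod_eq_zero (Finset.mem_erase.2 ⟨h, Finset.mem_univ _⟩) (sub_self _)
    have h3 := Finset.prod_prod_Ioi_mul_eq_prod_prod_off_diag fun j i => y i - y j
    rw [this, det_diagonal, ← Finset.prod_mul_distrib]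
    simp only [← Finset.prod_mul_distrib]
    rw [Finset.prod_congr rfl fun i _ => Finset.prod_congr rfl fun j _ =>
      mul_comm (y j - y i) (y i - y j), h3]
    simp only [Finset.compl_singleton]
  have h4 : (∏ i, ∏ j ∈ Finset.Ioi i, (y j - y i)) ≠ 0 :=
    Finset.prod_ne_zero_iff.2 fun i _ => Finset.prod_ne_zero_iff.2 fun j hj =>
      sub_ne_zero.2 (hy.ne (Finset.mem_Ioi.1 hj).ne')
  have h5 : det K = ∏ i, ∏ j ∈ Finset.Ioi i, (y i - y j) :=
    mul_left_cancel₀ h4 ((hK y).symm.trans h2)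
  rw [h1, hK, h5]

/-- Only pairs separated by S acquire a factor F, and once each, whichever of the two indices is
smaller. This turns Vandermonde products of shifted nodes into products of f. -/
theorem prod_Ioi_shift (F : ℂ → ℂ → ℂ) (x : Fin n → ℂ) (S : Finset (Fin n)) (g x' : Fin n → Fin n → ℂ)
    (h : ∀ i j, i ≠ j → x' i j = g i j * ((if i ∈ Sᶜ ∧ j ∈ S then F (x i) (x j) else 1) *
      (if j ∈ Sᶜ ∧ i ∈ S then F (x j) (x i) else 1))) :
    ∏ i, ∏ j ∈ Finset.Ioi i, x' i j =
      (∏ i, ∏ j ∈ Finset.Ioi i, g i j) * ∏ i ∈ Sᶜ, ∏ j ∈ S, F (x i) (x j) := by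
  have h1 : ∏ i, ∏ j ∈ Finset.Ioi i, x' i j = ∏ i, ∏ j ∈ Finset.Ioi i,
      (g i j * ((if i ∈ Sᶜ ∧ j ∈ S then F (x i) (x j) else 1) *
      (if j ∈ Sᶜ ∧ i ∈ S then F (x j) (x i) else 1))) :=
    Finset.prod_congr rfl fun i _ => Finset.prod_congr rfl fun j hj =>
      h i j (Finset.mem_Ioi.1 hj).ne
  have h3 := Finset.prod_prod_Ioi_mul_eq_prod_prod_off_diag fun j i : Fin n =>
    if i ∈ Sᶜ ∧ j ∈ S then F (x i) (x j) else 1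
  simp only [Finset.prod_mul_distrib] at h1 h3
  rw [h1, h3]
  congr 1
  have h4 : ∀ i : Fin n, ∏ j ∈ {i}ᶜ, (if i ∈ Sᶜ ∧ j ∈ S then F (x i) (x j) else 1) =
      ∏ j, (if i ∈ Sᶜ ∧ j ∈ S then F (x i) (x j) else 1) := by
    intro i
    refine Finset.prod_subset (Finset.subset_univ _) fun j _ hj => ?_
    have : j = i := by simpa using hj
    subst this
    rw [if_neg]; simp
  rw [Finset.prod_congr rfl fun i _ => h4 i]
  simp only [ite_and]
  rw [← Finset.prod_subset (Finset.subset_univ Sᶜ) fun i _ hi => by simp only [if_neg hi]; simp]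
  refine Finset.prod_congr rfl fun i hi => ?_
  simp only [if_pos hi]
  rw [← Finset.prod_subset (Finset.subset_univ S) fun j _ hj => if_neg hj]
  exact Finset.prod_congr rfl fun j hj => if_pos hj

/-- The determinant representation of the generating function of the double partition sums. -/
theorem det_eq_sum_partitions (c : ℝ) (b y l : Fin n → ℂ) (z : ℂ) (hb : Function.Injective b)
    (hy : Function.Injective y) (hyy : ∀ i j, y i - y j + Complex.I * c ≠ 0)
    (hby : ∀ i j, b i - y j ≠ 0) (hp : ∀ i j, b i - y j + Complex.I * c ≠ 0)
    (hm : ∀ i j, b i - y j - Complex.I * c ≠ 0)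
    (hl : ∀ α : Finset (Fin n), (∏ j ∈ α, l j) * ∏ i ∈ α, ∏ j ∈ αᶜ, fFun c (y i) (y j) =
      ∏ i ∈ αᶜ, ∏ j ∈ α, fFun c (y i) (y j)) :
    det (of fun i j => (∏ k, (b k - y j + Complex.I * c)) *
        (1 / (b i - y j + Complex.I * c) - z / (b i - y j)) +
        -z * l j * (∏ k, (b k - y j - Complex.I * c)) *
          (1 / (b i - y j) - z / (b i - y j - Complex.I * c))) =
      (∏ i, ∏ j ∈ Finset.Ioi i, ((b j - b i) * (y i - y j))) *
        ∑ α : Finset (Fin n), ∑ β : Finset (Fin n), (-z) ^ (α.card + β.card) *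
          ((∏ i ∈ αᶜ, ∏ j ∈ α, fFun c (y i) (y j)) * (∏ i ∈ βᶜ, ∏ j ∈ β, fFun c (b i) (b j)) *
          ((∏ i ∈ α, ∏ j ∈ βᶜ, fFun c (y i) (b j)) *
            ∏ i ∈ β, ∏ j ∈ αᶜ, fFun c (b i) (y j))) := by
  set ε : ℂ := Complex.I * c with hε
  have hbb : ∀ i j, i ≠ j → b i - b j ≠ 0 := fun i j h => sub_ne_zero.2 (hb.ne h)
  have hyy' : ∀ i j, i ≠ j → y i - y j ≠ 0 := fun i j h => sub_ne_zero.2 (hy.ne h)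
  rw [det_add_cols, Finset.mul_sum]
  refine Finset.sum_congr rfl fun α _ => ?_
  -- The columns outside α and the rows in β have their nodes shifted by -ε; every entry is then
  -- 1/(x i - w j) up to row and column factors, so each term of the two expansions is a Cauchy
  -- determinant.
  let v : Fin n → ℂ := fun j => if j ∈ α then -z * l j * (∏ k, (b k - y j - ε)) else
    ∏ k, (b k - y j + ε)
  let w : Fin n → ℂ := fun j => if j ∈ α then y j else y j - ε
  have e1 : (of fun i j => if j ∈ α then -z * l j * (∏ k, (b k - y j - ε)) *
      (1 / (b i - y j) - z / (b i - y j - ε)) else (∏ k, (b k - y j + ε)) *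
      (1 / (b i - y j + ε) - z / (b i - y j)) : Matrix (Fin n) (Fin n) ℂ) =
      of fun i j => v j * (of fun i j => 1 / (b i - w j) + -z * (1 / (b i - ε - w j)) :
        Matrix (Fin n) (Fin n) ℂ) i j := by
    ext i j
    by_cases h : j ∈ α
    · simp only [of_apply, v, w, if_pos h]
      rw [show b i - ε - y j = b i - y j - ε by ring]; ring
    · simp only [of_apply, v, w, if_neg h]
      rw [show b i - ε - (y j - ε) = b i - y j by ring,
        show b i - (y j - ε) = b i - y j + ε by ring]; ring
  rw [e1, det_mul_row, det_add_rows, Finset.mul_sum, Finset.mul_sum]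
  refine Finset.sum_congr rfl fun β _ => ?_
  let x : Fin n → ℂ := fun i => if i ∈ β then b i - ε else b i
  have e2 : (of fun i j => if i ∈ β then -z * (1 / (b i - ε - w j)) else 1 / (b i - w j) :
      Matrix (Fin n) (Fin n) ℂ) =
      of fun i j => (if i ∈ β then -z else 1) * (of fun i j => 1 / (x i - w j) :
        Matrix (Fin n) (Fin n) ℂ) i j := by
    ext i j
    by_cases h : i ∈ β <;> simp [x, h]
  have hw : Function.Injective w := by
    intro i j h
    by_contra hij
    simp only [w] at h
    split_ifs at h with h1 h2 h2
    · exact hij (hy h)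
    · exact hyy i j (by rw [h]; ring)
    · exact hyy j i (by rw [← h]; ring)
    · exact hij (hy (sub_left_injective h))
  have hxw : ∀ i j, x i - w j ≠ 0 := by
    intro i j
    simp only [x, w]
    split_ifs
    · rw [show b i - ε - y j = b i - y j - ε by ring]; exact hm i j
    · rw [show b i - ε - (y j - ε) = b i - y j by ring]; exact hby i j
    · exact hby i j
    · rw [show b i - (y j - ε) = b i - y j + ε by ring]; exact hp i j
  rw [e2, det_mul_column]
  have e3 : ∏ i, (if i ∈ β then -z else 1) = (-z) ^ β.card := by
    rw [Finset.prod_ite_mem]; simp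
  have e4 : ∏ j, v j = (-z) ^ α.card * (∏ j ∈ α, l j) *
      ∏ i, ∏ j, (if j ∈ α then b i - y j - ε else b i - y j + ε) := by
    rw [Finset.prod_comm]
    have : ∀ j, v j = (if j ∈ α then -z else 1) * (if j ∈ α then l j else 1) *
        ∏ i, (if j ∈ α then b i - y j - ε else b i - y j + ε) := by
      intro j
      by_cases h : j ∈ α <;> simp [v, h]
    simp only [this, Finset.prod_mul_distrib, Finset.prod_ite_mem, Finset.univ_inter,
      Finset.prod_const]
  have e5 := det_one_div_sub x w hw hxw
  have e6 : ∏ i, ∏ j ∈ Finset.Ioi i, (x j - x i) =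
      (∏ i, ∏ j ∈ Finset.Ioi i, (b j - b i)) * ∏ i ∈ βᶜ, ∏ j ∈ β, fFun c (b i) (b j) := by
    refine prod_Ioi_shift (fFun c) b β (fun i j => b j - b i) (fun i j => x j - x i) ?_
    intro i j hij
    have h1 := hbb i j hij
    have h2 := hbb j i hij.symm
    by_cases hi : i ∈ β <;> by_cases hj : j ∈ β <;> simp [x, hi, hj, fFun] <;> field_simp <;> ring
  have e7 : ∏ i, ∏ j ∈ Finset.Ioi i, (w i - w j) =
      (∏ i, ∏ j ∈ Finset.Ioi i, (y i - y j)) * ∏ i ∈ α, ∏ j ∈ αᶜ, fFun c (y i) (y j) := by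
    have := prod_Ioi_shift (fFun c) y αᶜ (fun i j => y i - y j) (fun i j => w i - w j) ?_
    · simpa using this
    intro i j hij
    have h1 := hyy' i j hij
    have h2 := hyy' j i hij.symm
    by_cases hi : i ∈ α <;> by_cases hj : j ∈ α <;> simp [w, hi, hj, fFun] <;> field_simp <;> ring
  have e8 : ∏ i, ∏ j, (if j ∈ α then b i - y j - ε else b i - y j + ε) =
      (∏ i, ∏ j, (x i - w j)) * ((∏ i ∈ α, ∏ j ∈ βᶜ, fFun c (y i) (b j)) *
            ∏ i ∈ β, ∏ j ∈ αᶜ, fFun c (b i) (y j)) := by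
    have h1 : ∏ i ∈ α, ∏ j ∈ βᶜ, fFun c (y i) (b j) =
        ∏ i, ∏ j, if i ∈ βᶜ then if j ∈ α then fFun c (y j) (b i) else 1 else 1 := by
      rw [Finset.prod_comm, ← Finset.prod_subset (Finset.subset_univ βᶜ)
        fun i _ hi => by simp only [if_neg hi]; simp]
      refine Finset.prod_congr rfl fun i hi => ?_
      simp only [if_pos hi, Finset.prod_ite_mem, Finset.univ_inter]
    have h2 : ∏ i ∈ β, ∏ j ∈ αᶜ, fFun c (b i) (y j) =
        ∏ i, ∏ j, if i ∈ β then if j ∈ αᶜ then fFun c (b i) (y j) else 1 else 1 := by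
      rw [← Finset.prod_subset (Finset.subset_univ β)
        fun i _ hi => by simp only [if_neg hi]; simp]
      refine Finset.prod_congr rfl fun i hi => ?_
      simp only [if_pos hi, Finset.prod_ite_mem, Finset.univ_inter]
    rw [h1, h2, ← Finset.prod_mul_distrib, ← Finset.prod_mul_distrib]
    refine Finset.prod_congr rfl fun i _ => ?_
    rw [← Finset.prod_mul_distrib, ← Finset.prod_mul_distrib]
    refine Finset.prod_congr rfl fun j _ => ?_
    have h3 := hby i j
    have h4 : y j - b i ≠ 0 := by rw [← neg_sub]; exact neg_ne_zero.2 h3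
    by_cases hi : i ∈ β <;> by_cases hj : j ∈ α <;> simp [x, w, hi, hj, fFun] <;>
      (try field_simp) <;> ring
  -- Here the Bethe equations remove the eigenvalues l j of the columns in α.
  rw [e3, e4, e8, ← hl α]
  simp only [Finset.prod_mul_distrib] at *
  rw [e6, e7] at e5
  rw [pow_add]
  linear_combination ((-z) ^ α.card * (-z) ^ β.card * (∏ j ∈ α, l j) *
    ((∏ i ∈ α, ∏ j ∈ βᶜ, fFun c (y i) (b j)) * ∏ i ∈ β, ∏ j ∈ αᶜ, fFun c (b i) (y j))) * e5

end Cauchy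

end BoseGas


namespace BoseGas

/-! ### On-shell form factors as moments -/

section Reduction

variable {ι : Type} [DecidableEq ι] {N : ℕ}

theorem tripleSum_zero_map (f : ι → ι → ℂ) (e : Fin N ↪ ι) (X : Finset ι → Finset ι → ℂ) :
    tripleSum f (Finset.univ.map e) 0 X =
      ∑ α : Finset (Fin N), fp f (αᶜ.map e) (α.map e) * X (αᶜ.map e) (α.map e) := by
  have h0 : ∀ (F : Finset ι → ℂ) (S : Finset ι), star f F (sizeInd 0) S = F S := by
    intro F S
    have := congrFun (star_sizeInd_zero_left F fun i j => f j i) S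
    rwa [star_reverse] at this
  have hc : ∀ α : Finset (Fin N), Finset.univ.map e \ αᶜ.map e = α.map e := by
    intro α
    ext x
    simp only [Finset.mem_sdiff, Finset.mem_map, Finset.mem_univ, true_and, Finset.mem_compl]
    constructor
    · rintro ⟨⟨a, rfl⟩, h⟩
      exact ⟨a, by by_contra h'; exact h ⟨a, h', rfl⟩, rfl⟩
    · rintro ⟨a, ha, rfl⟩
      exact ⟨⟨a, rfl⟩, fun ⟨b, hb, h⟩ => hb (e.injective h ▸ ha)⟩
  unfold tripleSum
  simp only [h0]
  symm
  refine Finset.sum_bij (fun α _ => αᶜ.map e) ?_ ?_ ?_ ?_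
  · intro α _; exact Finset.mem_powerset.2 (Finset.map_subset_map.2 (Finset.subset_univ _))
  · intro α _ β _ h; exact compl_injective (Finset.map_injective e h)
  · intro D hD
    obtain ⟨u, -, rfl⟩ := Finset.subset_map_iff.1 (Finset.mem_powerset.1 hD)
    exact ⟨uᶜ, Finset.mem_univ _, by rw [compl_compl]⟩
  · intro α _; rw [hc]

theorem doubleSum_zero_map (f : ι → ι → ℂ) (eC eB : Fin N ↪ ι) (w : ℂ → ℂ) :
    doubleSum f (Finset.univ.map eC) (Finset.univ.map eB) 0 0 w =
      ∑ α : Finset (Fin N), ∑ β : Finset (Fin N), (-1) ^ (α.card + β.card) *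
        ((∏ i ∈ αᶜ, ∏ j ∈ α, f (eC i) (eC j)) * (∏ i ∈ βᶜ, ∏ j ∈ β, f (eB i) (eB j)) *
          ((∏ i ∈ α, ∏ j ∈ βᶜ, f (eC i) (eB j)) * ∏ i ∈ β, ∏ j ∈ αᶜ, f (eB i) (eC j))) *
        w (N - (α.card + β.card : ℕ)) := by
  rw [doubleSum, tripleSum_zero_map]
  refine Finset.sum_congr rfl fun α _ => ?_
  rw [tripleSum_zero_map, Finset.mul_sum, Finset.mul_sum]
  refine Finset.sum_congr rfl fun β _ => ?_
  simp only [fp, Finset.prod_map, sgn, Finset.card_map]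
  have : ((βᶜ.card : ℂ) - α.card) = N - (α.card + β.card : ℕ) := by
    have h := Finset.card_compl_add_card β
    rw [Fintype.card_fin] at h
    have h' : (βᶜ.card : ℂ) + β.card = N := by exact_mod_cast h
    push_cast; linear_combination h'
  rw [this, pow_add]; ring

theorem BetheOn.map {c : ℝ} {lam l : ι → ℂ} (e : Fin N ↪ ι)
    (h : BetheOn c (lam ∘ e) (l ∘ e) Finset.univ) : BetheOn c lam l (Finset.univ.map e) := by
  intro j hj
  obtain ⟨i, -, rfl⟩ := Finset.mem_map.1 hj
  have := h i (Finset.mem_univ _)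
  rw [← Finset.map_erase]
  simpa only [fp, Finset.prod_map, Finset.prod_singleton, ker, Function.comp] using this

theorem betheOn_betheL (c : ℝ) (x : Fin N → ℂ) (hx : Function.Injective x)
    (hf : ∀ i j, i ≠ j → ker c x i j ≠ 0) : BetheOn c x (betheL c x) Finset.univ := by
  intro j _
  rw [fp_singleton_left, fp_singleton_right, betheL, ← Finset.prod_inv_distrib,
    ← Finset.prod_mul_distrib]
  refine Finset.prod_congr rfl fun k hk => ?_
  have hkj := Finset.ne_of_mem_erase hk
  have h1 : x k - x j ≠ 0 := sub_ne_zero.2 (hx.ne hkj)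
  have h2 : x j - x k ≠ 0 := sub_ne_zero.2 (hx.ne hkj.symm)
  have h3 : x j - x k + Complex.I * c ≠ 0 := fun h => hf j k hkj.symm (by simp [ker, fFun, h])
  have h4 : x k - x j - Complex.I * c ≠ 0 := fun h => h3 (by linear_combination -h)
  unfold sLL ker fFun
  rw [inv_div]
  field_simp
  ring

/-- The moments of the generating function of the double partition sums. -/
noncomputable def moment (c : ℝ) (b y : Fin N → ℂ) (k : ℕ) : ℂ :=
  ∑ α : Finset (Fin N), ∑ β : Finset (Fin N), (-1) ^ (α.card + β.card) *
    ((∏ i ∈ αᶜ, ∏ j ∈ α, fFun c (y i) (y j)) * (∏ i ∈ βᶜ, ∏ j ∈ β, fFun c (b i) (b j)) *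
      ((∏ i ∈ α, ∏ j ∈ βᶜ, fFun c (y i) (b j)) * ∏ i ∈ β, ∏ j ∈ αᶜ, fFun c (b i) (y j))) *
    ((N : ℂ) - (α.card + β.card : ℕ)) ^ k

theorem formFactorABA_eq (c : ℝ) (hc : c ≠ 0) (b y : Fin N → ℂ)
    (hinj : Function.Injective (Sum.elim y b))
    (hf : ∀ i j : Fin N ⊕ Fin N, i ≠ j → ker c (Sum.elim y b) i j ≠ 0) :
    formFactorABA c 1 y (fun i => b (Fin.rev i)) =
        c * (-1) ^ (N + 1) * (1 / 2 * moment c b y 2) ∧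
      formFactorABA c 2 y (fun i => b (Fin.rev i)) =
        (c : ℂ) ^ 2 * (-1) ^ N * (1 / 6 * (moment c b y 4 - moment c b y 2)) := by
  let b' : Fin N → ℂ := fun i => b (Fin.rev i)
  let lam : Fin N ⊕ Fin N → ℂ := Sum.elim y b'
  let l : Fin N ⊕ Fin N → ℂ := Sum.elim (betheL c y) (betheL c b')
  let σ : Fin N ⊕ Fin N → Fin N ⊕ Fin N := Sum.map id Fin.rev
  have hσ : Function.Injective σ :=
    Function.Injective.sumMap Function.injective_id Fin.rev_injective
  have hlam : lam = Sum.elim y b ∘ σ := by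
    funext i; cases i <;> rfl
  have hl : Function.Injective lam := by rw [hlam]; exact hinj.comp hσ
  have hf' : ∀ i j, i ≠ j → ker c lam i j ≠ 0 := by
    intro i j hij
    have := hf (σ i) (σ j) (hσ.ne hij)
    simpa only [hlam, ker, Function.comp] using this
  let eC : Fin N ↪ Fin N ⊕ Fin N := ⟨Sum.inl, Sum.inl_injective⟩
  -- `eB` follows the order of b and `eB'` the reversed order of the arguments. They have the same
  -- image, and the sums depend on this set alone.
  let eB : Fin N ↪ Fin N ⊕ Fin N :=
    ⟨fun i => Sum.inr (Fin.rev i), Sum.inr_injective.comp Fin.rev_injective⟩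
  let eB' : Fin N ↪ Fin N ⊕ Fin N := ⟨Sum.inr, Sum.inr_injective⟩
  have hC : (List.ofFn (Sum.inl : Fin N → Fin N ⊕ Fin N)).toFinset = Finset.univ.map eC := by
    ext x; simp [eC]
  have hB' : (List.ofFn (Sum.inr : Fin N → Fin N ⊕ Fin N)).toFinset = Finset.univ.map eB' := by
    ext x; simp [eB']
  have hB : (List.ofFn (Sum.inr : Fin N → Fin N ⊕ Fin N)).toFinset = Finset.univ.map eB := by
    ext x
    simp only [List.mem_toFinset, List.mem_ofFn, Finset.mem_map, Finset.mem_univ, true_and, eB]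
    constructor
    · rintro ⟨i, rfl⟩; exact ⟨Fin.rev i, by simp⟩
    · rintro ⟨i, rfl⟩; exact ⟨Fin.rev i, rfl⟩
  have hbC : BetheOn c lam l (List.ofFn Sum.inl).toFinset := by
    rw [hC]
    exact BetheOn.map eC (betheOn_betheL c y (hl.comp Sum.inl_injective)
      fun i j hij => hf' (Sum.inl i) (Sum.inl j) (Sum.inl_injective.ne hij))
  have hbB : BetheOn c lam l (List.ofFn Sum.inr).toFinset := by
    rw [hB']
    exact BetheOn.map eB' (betheOn_betheL c b' (hl.comp Sum.inr_injective)
      fun i j hij => hf' (Sum.inr i) (Sum.inr j) (Sum.inr_injective.ne hij))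
  have hnd : (List.ofFn Sum.inl ++ List.ofFn Sum.inr : List (Fin N ⊕ Fin N)).Nodup := by
    refine List.nodup_append.2 ⟨List.nodup_ofFn.2 Sum.inl_injective,
      List.nodup_ofFn.2 Sum.inr_injective, ?_⟩
    intro a ha b hb
    obtain ⟨i, rfl⟩ := List.mem_ofFn.1 ha
    obtain ⟨j, rfl⟩ := List.mem_ofFn.1 hb
    exact Sum.inl_ne_inr
  have hdis : Disjoint (Finset.univ.map eC) (Finset.univ.map eB) := by
    rw [Finset.disjoint_left]
    rintro x h1 h2
    obtain ⟨i, -, rfl⟩ := Finset.mem_map.1 h1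
    obtain ⟨j, -, h⟩ := Finset.mem_map.1 h2
    exact Sum.inr_ne_inl h
  have hmain : ∀ k, formFactorABA c k y b' = (c : ℂ) ^ k * (k.factorial : ℂ) ^ 2 *
      (-1) ^ (N + k) * doubleSum (ker c lam) (Finset.univ.map eC) (Finset.univ.map eB) k k
        (fun n => n ^ 0) := by
    intro k
    have := pairing_eq_doubleSum (l := l) hc hl hf' k (List.ofFn Sum.inl) (List.ofFn Sum.inr) hnd
      (by simp) hbC hbB
    rw [hC, hB] at this
    simp only [pow_zero]
    simp only [List.length_ofFn] at this
    exact this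
  have hmom : ∀ k, doubleSum (ker c lam) (Finset.univ.map eC) (Finset.univ.map eB) 0 0
      (fun n => n ^ k) = moment c b y k := by
    intro k
    rw [doubleSum_zero_map]
    simp [moment, ker, lam, eC, eB, b']
  have hcd : (Finset.univ.map eC).card = (Finset.univ.map eB).card := by simp
  constructor
  · rw [hmain 1, doubleSum_one_one hc hl hf' hdis hcd, hmom]
    simp
  · have h2 := doubleSum_two_two hc hl hf' hdis hcd
    rw [hmom, hmom] at h2
    rw [hmain 2, ← h2]
    simp [pow_add, Nat.factorial]; ring

/-- The Vandermonde matrix of the nodes 0, …, M is invertible. A weighted sum of the coefficients of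
a polynomial in z thereby becomes a combination of finitely many values, so limits are needed only
at fixed z. -/
theorem exists_interpolation (M : ℕ) (h : ℕ → ℂ) :
    ∃ κ : Fin (M + 1) → ℂ, ∀ d ≤ M, ∑ i, κ i * ((i : ℕ) : ℂ) ^ d = h d := by
  let V := Matrix.vandermonde fun i : Fin (M + 1) => ((i : ℕ) : ℂ)
  have hV : IsUnit V.det := by
    rw [isUnit_iff_ne_zero, Matrix.det_vandermonde_ne_zero_iff]
    intro i j hij
    exact Fin.ext (Nat.cast_injective hij)
  refine ⟨Matrix.vecMul (fun d : Fin (M + 1) => h d) V⁻¹, fun d hd => ?_⟩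
  have h1 : Matrix.vecMul (Matrix.vecMul (fun d : Fin (M + 1) => h d) V⁻¹) V =
      fun d : Fin (M + 1) => h d := by
    rw [Matrix.vecMul_vecMul, Matrix.nonsing_inv_mul _ hV, Matrix.vecMul_one]
  exact congrFun h1 ⟨d, Nat.lt_succ_of_le hd⟩

end Reduction

end BoseGas


namespace BoseGas

/-! ### The limit of the determinant -/

section Limit

open Matrix

variable {N : ℕ}

/-- The part of a diagonal entry of the limiting determinant that is linear in `z`. -/
noncomputable def diagSum (c : ℝ) (lam : Fin N → ℝ) (e : Fin N → ℂ) (j : Fin N) : ℂ :=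
  ∑ k, (phi c (lam j - lam k) : ℂ) * (e k / e j)

/-- The limit of the generating function of the double partition sums. -/
noncomputable def limDet (c : ℝ) (lam : Fin N → ℝ) (e : Fin N → ℂ) (z : ℂ) : ℂ :=
  det (of fun i j : Fin N => (if i = j then z * (Complex.I * diagSum c lam e j) else 0) +
    1 / ((lam i - lam j : ℂ) + Complex.I * c) - z ^ 2 / ((lam i - lam j : ℂ) - Complex.I * c))

theorem real_add_I_mul_ne_zero {c : ℝ} (hc : c ≠ 0) (x y : ℝ) :
    (x - y : ℂ) + Complex.I * c ≠ 0 := by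
  intro h
  have := congrArg Complex.im h
  simp at this
  exact hc this

theorem real_sub_I_mul_ne_zero {c : ℝ} (hc : c ≠ 0) (x y : ℝ) :
    (x - y : ℂ) - Complex.I * c ≠ 0 := by
  intro h
  have := congrArg Complex.im h
  simp at this
  exact hc this

/-- The ratio of the two summands in a column of the determinant, up to a sign. -/
noncomputable def scatRatio (c : ℝ) (b y : Fin N → ℂ) (j : Fin N) : ℂ :=
  ∏ k, ((y k - y j + Complex.I * c) / (y k - y j - Complex.I * c) *
    ((b k - y j - Complex.I * c) / (b k - y j + Complex.I * c)))

theorem betheL_mul_prod (c : ℝ) (hc : c ≠ 0) (b y : Fin N → ℂ) (j : Fin N)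
    (hp : ∀ i, b i - y j + Complex.I * c ≠ 0) :
    betheL c y j * ∏ k, (b k - y j - Complex.I * c) =
      -(∏ k, (b k - y j + Complex.I * c)) * scatRatio c b y j := by
  have hε : Complex.I * (c : ℂ) ≠ 0 := mul_ne_zero Complex.I_ne_zero (by exact_mod_cast hc)
  unfold scatRatio
  rw [Finset.prod_mul_distrib, Finset.prod_div_distrib (f := fun k => b k - y j - Complex.I * c)]
  have h1 : betheL c y j = -∏ k, (y k - y j + Complex.I * c) / (y k - y j - Complex.I * c) := by
    rw [← Finset.mul_prod_erase _ _ (Finset.mem_univ j), betheL, ← Finset.prod_inv_distrib]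
    -- The factor k = j, absent from the Bethe equations, is the source of the minus sign.
    have : (y j - y j + Complex.I * c) / (y j - y j - Complex.I * c) = -1 := by
      rw [sub_self, zero_add, zero_sub, div_neg, div_self hε]
    rw [this]
    simp only [sLL, inv_div]; ring
  have h2 : ∏ k, (b k - y j + Complex.I * c) ≠ 0 := Finset.prod_ne_zero_iff.2 fun i _ => hp i
  rw [h1]; field_simp

theorem det_eq_prod_mul_det (c : ℝ) (hc : c ≠ 0) (b y : Fin N → ℂ) (z : ℂ)
    (hp : ∀ i j, b i - y j + Complex.I * c ≠ 0) :
    det (of fun i j => (∏ k, (b k - y j + Complex.I * c)) *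
        (1 / (b i - y j + Complex.I * c) - z / (b i - y j)) +
        -z * betheL c y j * (∏ k, (b k - y j - Complex.I * c)) *
          (1 / (b i - y j) - z / (b i - y j - Complex.I * c))) =
      (∏ j, ∏ k, (b k - y j + Complex.I * c)) * det (of fun i j =>
        1 / (b i - y j + Complex.I * c) - z * ((1 - scatRatio c b y j) / (b i - y j)) -
          z ^ 2 * scatRatio c b y j / (b i - y j - Complex.I * c)) := by
  rw [← det_mul_row]
  congr 1
  ext i j
  simp only [of_apply]
  linear_combination (-z * (1 / (b i - y j) - z / (b i - y j - Complex.I * c))) *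
    betheL_mul_prod c hc b y j fun i => hp i j

/-- Every factor is 1 at t = 0, so the derivatives of the factors add up; e j enters both quotients
and drops out. -/
theorem hasDerivAt_scatRatio (c : ℝ) (hc : c ≠ 0) (lam : Fin N → ℝ) (e : Fin N → ℂ) (j : Fin N) :
    HasDerivAt (fun t : ℂ => scatRatio c (fun i => (lam i : ℂ)) (fun i => lam i + t * e i) j)
      (-Complex.I * ∑ k, (phi c (lam j - lam k) : ℂ) * e k) 0 := by
  have hone : ∀ x : ℂ, x + Complex.I * c ≠ 0 → x - Complex.I * c ≠ 0 →
      (x + Complex.I * c) / (x - Complex.I * c) * ((x - Complex.I * c) / (x + Complex.I * c)) = 1 :=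
    fun x h1 h2 => by field_simp
  have hfac : ∀ k : Fin N, HasDerivAt (fun t : ℂ =>
      ((lam k : ℂ) + t * e k - (lam j + t * e j) + Complex.I * c) /
        ((lam k : ℂ) + t * e k - (lam j + t * e j) - Complex.I * c) *
      (((lam k : ℂ) - (lam j + t * e j) - Complex.I * c) /
        ((lam k : ℂ) - (lam j + t * e j) + Complex.I * c)))
      (-Complex.I * ((phi c (lam j - lam k) : ℂ) * e k)) 0 := by
    intro k
    have hp := real_add_I_mul_ne_zero hc (lam k) (lam j)
    have hm := real_sub_I_mul_ne_zero hc (lam k) (lam j)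
    have d1 : HasDerivAt (fun t : ℂ => (lam k : ℂ) + t * e k - (lam j + t * e j) + Complex.I * c)
        (e k - e j) 0 := by
      have h := (((hasDerivAt_id (0 : ℂ)).mul_const (e k)).const_add (lam k : ℂ)).sub
        (((hasDerivAt_id (0 : ℂ)).mul_const (e j)).const_add (lam j : ℂ))
      simpa using h.add_const (Complex.I * c)
    have d2 : HasDerivAt (fun t : ℂ => (lam k : ℂ) + t * e k - (lam j + t * e j) - Complex.I * c)
        (e k - e j) 0 := by
      have h := (((hasDerivAt_id (0 : ℂ)).mul_const (e k)).const_add (lam k : ℂ)).sub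
        (((hasDerivAt_id (0 : ℂ)).mul_const (e j)).const_add (lam j : ℂ))
      simpa using h.sub_const (Complex.I * c)
    have d3 : HasDerivAt (fun t : ℂ => (lam k : ℂ) - (lam j + t * e j) - Complex.I * c)
        (-e j) 0 := by
      have h := (((hasDerivAt_id (0 : ℂ)).mul_const (e j)).const_add (lam j : ℂ)).const_sub
        (lam k : ℂ)
      simpa using h.sub_const (Complex.I * c)
    have d4 : HasDerivAt (fun t : ℂ => (lam k : ℂ) - (lam j + t * e j) + Complex.I * c)
        (-e j) 0 := by
      have h := (((hasDerivAt_id (0 : ℂ)).mul_const (e j)).const_add (lam j : ℂ)).const_sub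
        (lam k : ℂ)
      simpa using h.add_const (Complex.I * c)
    have h := (d1.div d2 (by simpa using hm)).mul (d3.div d4 (by simpa using hp))
    refine h.congr_deriv ?_
    simp only [zero_mul, add_zero, Pi.div_apply]
    have hphi : (phi c (lam j - lam k) : ℂ) =
        2 * c / (((lam k : ℂ) - lam j + Complex.I * c) * ((lam k : ℂ) - lam j - Complex.I * c)) := by
      have : ((lam k : ℂ) - lam j + Complex.I * c) * ((lam k : ℂ) - lam j - Complex.I * c) =
          (c : ℂ) ^ 2 + (lam j - lam k) ^ 2 := by linear_combination (-(c : ℂ) ^ 2) * Complex.I_sq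
      rw [this]
      simp [phi]
    rw [hphi]
    field_simp
    ring
  have h := HasDerivAt.fun_finsetProd (u := Finset.univ) fun k _ => hfac k
  unfold scatRatio
  refine h.congr_deriv ?_
  rw [Finset.mul_sum]
  refine Finset.sum_congr rfl fun k _ => ?_
  rw [Finset.prod_eq_one, one_smul]
  intro i _
  simp only [zero_mul, add_zero]
  exact hone _ (real_add_I_mul_ne_zero hc _ _) (real_sub_I_mul_ne_zero hc _ _)

theorem scatRatio_self (c : ℝ) (hc : c ≠ 0) (lam : Fin N → ℝ) (j : Fin N) :
    scatRatio c (fun i => (lam i : ℂ)) (fun i => (lam i : ℂ)) j = 1 := by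
  refine Finset.prod_eq_one fun k _ => ?_
  have := real_add_I_mul_ne_zero hc (lam k) (lam j)
  have := real_sub_I_mul_ne_zero hc (lam k) (lam j)
  field_simp

/-- The only singular denominators are the diagonal ones, -t e j. There 1 - `scatRatio` vanishes to
first order, and the quotient tends to a derivative divided by e j; off the diagonal the
corresponding term tends to zero. -/
theorem tendsto_det (c : ℝ) (hc : c ≠ 0) (lam : Fin N → ℝ) (hlam : Function.Injective lam)
    (e : Fin N → ℂ) (he : ∀ i, e i ≠ 0) (z : ℂ) :
    Tendsto (fun t : ℂ => det (of fun i j : Fin N =>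
        1 / ((lam i : ℂ) - (lam j + t * e j) + Complex.I * c) -
        z * ((1 - scatRatio c (fun i => (lam i : ℂ)) (fun i => lam i + t * e i) j) /
          ((lam i : ℂ) - (lam j + t * e j))) -
        z ^ 2 * scatRatio c (fun i => (lam i : ℂ)) (fun i => lam i + t * e i) j /
          ((lam i : ℂ) - (lam j + t * e j) - Complex.I * c))) (𝓝[≠] 0)
      (𝓝 (limDet c lam e z)) := by
  have hR : ∀ j, Tendsto (fun t : ℂ =>
      scatRatio c (fun i => (lam i : ℂ)) (fun i => lam i + t * e i) j) (𝓝[≠] 0) (𝓝 1) := by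
    intro j
    have := (hasDerivAt_scatRatio c hc lam e j).continuousAt.tendsto
    simp only [zero_mul, add_zero, scatRatio_self c hc] at this
    exact this.mono_left nhdsWithin_le_nhds
  have hlin : ∀ i j : Fin N, Tendsto (fun t : ℂ => (lam i : ℂ) - (lam j + t * e j)) (𝓝[≠] 0)
      (𝓝 (lam i - lam j)) := by
    intro i j
    have : Continuous fun t : ℂ => (lam i : ℂ) - (lam j + t * e j) := by fun_prop
    have := this.tendsto 0
    simp only [zero_mul, add_zero] at this
    exact this.mono_left nhdsWithin_le_nhds
  unfold limDet
  simp only [det_apply]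
  refine tendsto_finsetSum _ fun σ _ => Tendsto.const_smul (tendsto_finsetProd _ fun j _ => ?_) _
  simp only [of_apply]
  have h1 := (hlin (σ j) j).add_const (Complex.I * (c : ℂ))
  have h2 := (hlin (σ j) j).sub_const (Complex.I * (c : ℂ))
  refine Tendsto.sub ?_ ?_
  · have h3 : Tendsto (fun t : ℂ => z * ((1 - scatRatio c (fun i => (lam i : ℂ))
        (fun i => lam i + t * e i) j) / ((lam (σ j) : ℂ) - (lam j + t * e j)))) (𝓝[≠] 0)
        (𝓝 (-(if σ j = j then z * (Complex.I * diagSum c lam e j) else 0))) := by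
      by_cases hσ : σ j = j
      · rw [if_pos hσ, hσ]
        have hd := (hasDerivAt_scatRatio c hc lam e j).tendsto_slope_zero
        simp only [zero_mul, add_zero, zero_add, scatRatio_self c hc] at hd
        have hval : -(z * (Complex.I * diagSum c lam e j)) =
            (-Complex.I * ∑ k, (phi c (lam j - lam k) : ℂ) * e k) * (z * (e j)⁻¹) := by
          have : diagSum c lam e j = (∑ k, (phi c (lam j - lam k) : ℂ) * e k) * (e j)⁻¹ := by
            rw [diagSum, Finset.sum_mul]
            exact Finset.sum_congr rfl fun k _ => by ring
          rw [this]; ring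
        rw [hval]
        refine Tendsto.congr' ?_ (hd.mul_const (z * (e j)⁻¹))
        filter_upwards [self_mem_nhdsWithin] with t ht
        have ht' : t ≠ 0 := ht
        have := he j
        rw [show (lam j : ℂ) - (lam j + t * e j) = -(t * e j) by ring, smul_eq_mul]
        field_simp
        ring
      · rw [if_neg hσ, neg_zero]
        have hne : (lam (σ j) - lam j : ℂ) ≠ 0 := by
          rw [sub_ne_zero]; exact_mod_cast hlam.ne hσ
        have := (((hR j).const_sub 1).div (hlin (σ j) j) hne).const_mul z
        simpa [Pi.div_def] using this
    have hval : (if σ j = j then z * (Complex.I * diagSum c lam e j) else 0) +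
        1 / ((lam (σ j) - lam j : ℂ) + Complex.I * c) =
        1 / ((lam (σ j) - lam j : ℂ) + Complex.I * c) -
          -(if σ j = j then z * (Complex.I * diagSum c lam e j) else 0) := by ring
    rw [hval]
    exact (tendsto_const_nhds.div h1 (real_add_I_mul_ne_zero hc _ _)).sub h3
  · have := ((hR j).const_mul (z ^ 2)).div h2 (real_sub_I_mul_ne_zero hc _ _)
    simpa [Pi.div_def] using this

end Limit

end BoseGas


namespace BoseGas

/-! ### The limit of the normalised moments -/

section LimitFormFactor

open Matrix

variable {N : ℕ}

theorem prod_Ioi_rev (g : Fin N → Fin N → ℂ) :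
    ∏ i, ∏ j ∈ Finset.Ioi i, g (Fin.rev i) (Fin.rev j) = ∏ i, ∏ j ∈ Finset.Ioi i, g j i := by
  rw [Finset.prod_sigma', Finset.prod_sigma']
  refine Finset.prod_nbij' (fun p => ⟨Fin.rev p.2, Fin.rev p.1⟩)
    (fun p => ⟨Fin.rev p.2, Fin.rev p.1⟩) ?_ ?_ ?_ ?_ ?_ <;> simp

/-- The normalisation of the form factor. -/
noncomputable def ffNorm (c : ℝ) (b y : Fin N → ℂ) : ℂ :=
  (c : ℂ) ^ N * ∏ i : Fin N, ∏ j ∈ Finset.Ioi i,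
    (fFun c (b (Fin.rev i)) (b (Fin.rev j)) * fFun c (y i) (y j))

theorem ffNorm_mul (c : ℝ) (b y : Fin N → ℂ) (hb : Function.Injective b)
    (hy : Function.Injective y) :
    ffNorm c b y * ∏ i, ∏ j ∈ Finset.Ioi i, ((b j - b i) * (y i - y j)) =
      (c : ℂ) ^ N * ∏ i, ∏ j ∈ Finset.Ioi i,
        ((b j - b i + Complex.I * c) * (y i - y j + Complex.I * c)) := by
  unfold ffNorm
  simp only [Finset.prod_mul_distrib]
  rw [prod_Ioi_rev fun i j => fFun c (b i) (b j)]
  rw [mul_assoc]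
  congr 1
  simp only [← Finset.prod_mul_distrib]
  refine Finset.prod_congr rfl fun i _ => Finset.prod_congr rfl fun j hj => ?_
  have hij : i ≠ j := (Finset.mem_Ioi.1 hj).ne
  have h1 : b j - b i ≠ 0 := sub_ne_zero.2 (hb.ne hij.symm)
  have h2 : y i - y j ≠ 0 := sub_ne_zero.2 (hy.ne hij)
  unfold fFun
  field_simp

/-- In the limit the factors with j ≠ k cancel, and the N diagonal factors ic against c^N leave i^N.
-/
theorem tendsto_prefactor (c : ℝ) (hc : c ≠ 0) (lam : Fin N → ℝ) (e : Fin N → ℂ) :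
    Tendsto (fun t : ℂ => (∏ j, ∏ k, ((lam k : ℂ) - (lam j + t * e j) + Complex.I * c)) /
      ((c : ℂ) ^ N * ∏ i, ∏ j ∈ Finset.Ioi i, (((lam j : ℂ) - lam i + Complex.I * c) *
        (((lam i : ℂ) + t * e i) - (lam j + t * e j) + Complex.I * c)))) (𝓝[≠] 0)
      (𝓝 (Complex.I ^ N)) := by
  have hcc : (c : ℂ) ≠ 0 := by exact_mod_cast hc
  have h1 : Continuous fun t : ℂ =>
      ∏ j, ∏ k, ((lam k : ℂ) - (lam j + t * e j) + Complex.I * c) := by fun_prop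
  have h2 : Continuous fun t : ℂ => (c : ℂ) ^ N * ∏ i, ∏ j ∈ Finset.Ioi i,
      (((lam j : ℂ) - lam i + Complex.I * c) *
        (((lam i : ℂ) + t * e i) - (lam j + t * e j) + Complex.I * c)) := by fun_prop
  have h1' := h1.tendsto 0
  have h2' := h2.tendsto 0
  simp only [zero_mul, add_zero] at h1' h2'
  have h3 : (c : ℂ) ^ N * ∏ i, ∏ j ∈ Finset.Ioi i, (((lam j : ℂ) - lam i + Complex.I * c) *
        ((lam i : ℂ) - lam j + Complex.I * c)) ≠ 0 :=
    mul_ne_zero (pow_ne_zero _ hcc) (Finset.prod_ne_zero_iff.2 fun i _ =>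
      Finset.prod_ne_zero_iff.2 fun j _ =>
        mul_ne_zero (real_add_I_mul_ne_zero hc _ _) (real_add_I_mul_ne_zero hc _ _))
  have h4 := (h1'.div h2' h3).mono_left (nhdsWithin_le_nhds (s := {0}ᶜ))
  have h5 : (∏ j, ∏ k, ((lam k : ℂ) - lam j + Complex.I * c)) = Complex.I ^ N *
      ((c : ℂ) ^ N * ∏ i, ∏ j ∈ Finset.Ioi i, (((lam j : ℂ) - lam i + Complex.I * c) *
        ((lam i : ℂ) - lam j + Complex.I * c))) := by
    have h6 := Finset.prod_prod_Ioi_mul_eq_prod_prod_off_diag fun j i : Fin N =>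
      (lam j : ℂ) - lam i + Complex.I * c
    rw [h6, ← mul_assoc]
    have h7 : ∀ j : Fin N, ∏ k, ((lam k : ℂ) - lam j + Complex.I * c) =
        (Complex.I * c) * ∏ k ∈ {j}ᶜ, ((lam k : ℂ) - lam j + Complex.I * c) := by
      intro j
      rw [Finset.compl_singleton, ← Finset.mul_prod_erase _ _ (Finset.mem_univ j), sub_self,
        zero_add]
    simp only [h7, Finset.prod_mul_distrib, Finset.prod_const, Finset.card_univ, Fintype.card_fin]
  rw [h5, mul_div_assoc, div_self h3, mul_one] at h4
  exact h4

theorem moment_eq_sum (c : ℝ) (b y : Fin N → ℂ) (k : ℕ) (κ : Fin (2 * N + 1) → ℂ)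
    (hκ : ∀ d ≤ 2 * N, ∑ i, κ i * ((i : ℕ) : ℂ) ^ d = ((N : ℂ) - d) ^ k) :
    moment c b y k = ∑ m, κ m * ∑ α : Finset (Fin N), ∑ β : Finset (Fin N),
      (-((m : ℕ) : ℂ)) ^ (α.card + β.card) *
      ((∏ i ∈ αᶜ, ∏ j ∈ α, fFun c (y i) (y j)) * (∏ i ∈ βᶜ, ∏ j ∈ β, fFun c (b i) (b j)) *
        ((∏ i ∈ α, ∏ j ∈ βᶜ, fFun c (y i) (b j)) * ∏ i ∈ β, ∏ j ∈ αᶜ, fFun c (b i) (y j))) := by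
  unfold moment
  simp only [Finset.mul_sum (s := (Finset.univ : Finset (Finset (Fin N))))]
  rw [Finset.sum_comm (s := (Finset.univ : Finset (Fin (2 * N + 1))))]
  refine Finset.sum_congr rfl fun α _ => ?_
  rw [Finset.sum_comm (s := (Finset.univ : Finset (Fin (2 * N + 1))))]
  refine Finset.sum_congr rfl fun β _ => ?_
  have hcard : ∀ γ : Finset (Fin N), γ.card ≤ N := fun γ => by
    simpa using Finset.card_le_univ γ
  have h := hκ (α.card + β.card) (by have := hcard α; have := hcard β; omega)
  rw [← h, Finset.mul_sum]
  refine Finset.sum_congr rfl fun m _ => ?_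
  rw [neg_pow]
  ring

/-- For small t ≠ 0 the 2N rapidities are distinct and no f vanishes, which is what the algebraic
part requires. -/
theorem eventually_generic (c : ℝ) (hc : c ≠ 0) (lam : Fin N → ℝ)
    (hlam : Function.Injective lam) (e : Fin N → ℂ) (he : ∀ i, e i ≠ 0) :
    ∀ᶠ t : ℂ in 𝓝[≠] 0,
      Function.Injective (Sum.elim (fun i => (lam i : ℂ) + t * e i) fun i => (lam i : ℂ)) ∧
      ∀ i j, Sum.elim (fun i => (lam i : ℂ) + t * e i) (fun i => (lam i : ℂ)) i -
        Sum.elim (fun i => (lam i : ℂ) + t * e i) (fun i => (lam i : ℂ)) j + Complex.I * c ≠ 0 := by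
  have hlin : ∀ u v : ℂ, u ≠ 0 → ∀ᶠ t : ℂ in 𝓝[≠] 0, u + t * v ≠ 0 := by
    intro u v hu
    have : ContinuousAt (fun t : ℂ => u + t * v) 0 := by fun_prop
    exact (this.eventually_ne (by simpa using hu)).filter_mono nhdsWithin_le_nhds
  have hlam' : ∀ i j, i ≠ j → (lam i : ℂ) - lam j ≠ 0 := fun i j h => by
    rw [sub_ne_zero]; exact_mod_cast hlam.ne h
  have h1 : ∀ᶠ t : ℂ in 𝓝[≠] 0, ∀ i j : Fin N, i ≠ j →
      (lam i : ℂ) + t * e i ≠ lam j + t * e j := by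
    refine eventually_all.2 fun i => eventually_all.2 fun j => ?_
    by_cases h : i = j
    · exact Eventually.of_forall fun t h' => absurd h h'
    · filter_upwards [hlin _ (e i - e j) (hlam' i j h)] with t ht _ h'
      exact ht (by linear_combination h')
  have h2 : ∀ᶠ t : ℂ in 𝓝[≠] 0, ∀ i j : Fin N, (lam i : ℂ) + t * e i ≠ lam j := by
    refine eventually_all.2 fun i => eventually_all.2 fun j => ?_
    by_cases h : i = j
    · filter_upwards [self_mem_nhdsWithin] with t ht h'
      subst h
      exact mul_ne_zero ht (he i) (by linear_combination h')
    · filter_upwards [hlin _ (e i) (hlam' i j h)] with t ht h'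
      exact ht (by linear_combination h')
  have h3 : ∀ᶠ t : ℂ in 𝓝[≠] 0, ∀ i j, Sum.elim (fun i => (lam i : ℂ) + t * e i)
      (fun i => (lam i : ℂ)) i - Sum.elim (fun i => (lam i : ℂ) + t * e i)
      (fun i => (lam i : ℂ)) j + Complex.I * c ≠ 0 := by
    refine eventually_all.2 fun i => eventually_all.2 fun j => ?_
    rcases i with i | i <;> rcases j with j | j
    · filter_upwards [hlin _ (e i - e j) (real_add_I_mul_ne_zero hc (lam i) (lam j))] with t ht h'
      exact ht (by simp only [Sum.elim_inl] at h'; linear_combination h')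
    · filter_upwards [hlin _ (e i) (real_add_I_mul_ne_zero hc (lam i) (lam j))] with t ht h'
      exact ht (by simp only [Sum.elim_inl, Sum.elim_inr] at h'; linear_combination h')
    · filter_upwards [hlin _ (-e j) (real_add_I_mul_ne_zero hc (lam i) (lam j))] with t ht h'
      exact ht (by simp only [Sum.elim_inl, Sum.elim_inr] at h'; linear_combination h')
    · exact Eventually.of_forall fun t => real_add_I_mul_ne_zero hc (lam i) (lam j)
  filter_upwards [h1, h2, h3] with t h1 h2 h3
  refine ⟨?_, h3⟩
  rintro (i | i) (j | j) h
  · by_contra hij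
    exact h1 i j (fun h' => hij (h' ▸ rfl)) h
  · exact absurd h (h2 i j)
  · exact absurd h.symm (h2 j i)
  · have : (lam i : ℂ) = lam j := h
    exact congrArg Sum.inr (hlam (by exact_mod_cast this))

theorem tendsto_moment (c : ℝ) (hc : c ≠ 0) (lam : Fin N → ℝ) (hlam : Function.Injective lam)
    (e : Fin N → ℂ) (he : ∀ i, e i ≠ 0) (k : ℕ) (κ : Fin (2 * N + 1) → ℂ)
    (hκ : ∀ d ≤ 2 * N, ∑ i, κ i * ((i : ℕ) : ℂ) ^ d = ((N : ℂ) - d) ^ k) :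
    Tendsto (fun t : ℂ => (ffNorm c (fun i => (lam i : ℂ)) fun i => lam i + t * e i)⁻¹ *
      moment c (fun i => (lam i : ℂ)) (fun i => lam i + t * e i) k) (𝓝[≠] 0)
      (𝓝 (Complex.I ^ N * ∑ m, κ m * limDet c lam e ((m : ℕ) : ℂ))) := by
  have hlim := (tendsto_prefactor c hc lam e).mul (tendsto_finsetSum Finset.univ fun (m : Fin (2 * N + 1)) _ =>
    (tendsto_det c hc lam hlam e he ((m : ℕ) : ℂ)).const_mul (κ m))
  refine hlim.congr' ?_
  filter_upwards [eventually_generic c hc lam hlam e he] with t ht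
  obtain ⟨hinj, hsh⟩ := ht
  set b : Fin N → ℂ := fun i => (lam i : ℂ)
  set y : Fin N → ℂ := fun i => lam i + t * e i
  have hb : Function.Injective b := hinj.comp Sum.inr_injective
  have hy : Function.Injective y := hinj.comp Sum.inl_injective
  have hby : ∀ i j, b i - y j ≠ 0 := fun i j =>
    sub_ne_zero.2 (hinj.ne (Sum.inr_ne_inl (a := j) (b := i)))
  have hp : ∀ i j, b i - y j + Complex.I * c ≠ 0 := fun i j => hsh (Sum.inr i) (Sum.inl j)
  have hm : ∀ i j, b i - y j - Complex.I * c ≠ 0 := fun i j h =>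
    hsh (Sum.inl j) (Sum.inr i) (by
      have : Sum.elim y b (Sum.inl j) - Sum.elim y b (Sum.inr i) + Complex.I * c =
        -(b i - y j - Complex.I * c) := by simp only [Sum.elim_inl, Sum.elim_inr]; ring
      rw [this, h, neg_zero])
  have hker : ∀ i j, i ≠ j → ker c y i j ≠ 0 := fun i j hij =>
    div_ne_zero (hsh (Sum.inl i) (Sum.inl j)) (sub_ne_zero.2 (hy.ne hij))
  have hl : ∀ α : Finset (Fin N), (∏ j ∈ α, betheL c y j) *
      ∏ i ∈ α, ∏ j ∈ αᶜ, fFun c (y i) (y j) = ∏ i ∈ αᶜ, ∏ j ∈ α, fFun c (y i) (y j) := by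
    intro α
    have := (betheOn_betheL c y hy hker).lprod_mul_fp hker (Finset.subset_univ α)
    simpa only [fp, lprod, ker, Finset.compl_eq_univ_sdiff] using this
  have hV : ∏ i, ∏ j ∈ Finset.Ioi i, ((b j - b i) * (y i - y j)) ≠ 0 :=
    Finset.prod_ne_zero_iff.2 fun i _ => Finset.prod_ne_zero_iff.2 fun j hj =>
      have hij : i ≠ j := (Finset.mem_Ioi.1 hj).ne
      mul_ne_zero (sub_ne_zero.2 (hb.ne hij.symm)) (sub_ne_zero.2 (hy.ne hij))
  rw [moment_eq_sum c b y k κ hκ, Finset.mul_sum, Finset.mul_sum]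
  refine Finset.sum_congr rfl fun m _ => ?_
  have h1 := det_eq_sum_partitions c b y (betheL c y) ((m : ℕ) : ℂ) hb hy
    (fun i j => hsh (Sum.inl i) (Sum.inl j)) hby hp hm hl
  rw [det_eq_prod_mul_det c hc b y _ hp] at h1
  have h2 := ffNorm_mul c b y hb hy
  rw [← h2, div_mul_eq_mul_div, mul_left_comm, h1, div_eq_mul_inv, mul_inv]
  field_simp

end LimitFormFactor

end BoseGas


namespace BoseGas

/-! ### Low-order coefficients of a perturbed determinant -/

section SecondOrder

open Matrix PowerSeries

variable {n : Type*} [Fintype n] [DecidableEq n]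

theorem det_eq_sum_adjugate_of_row {R : Type*} [CommRing R] (A : Matrix n n R) (b : n → R)
    (i : n) : det (A.updateRow i b) = ∑ j, adjugate A j i * b j := by
  rw [← cramer_transpose_apply, cramer_eq_adjugate_mulVec, ← adjugate_transpose]
  simp [mulVec, dotProduct]

/-- A coefficient of the determinant of a perturbation of order two of a constant matrix, when the
terms quadratic in the perturbation do not contribute. -/
theorem coeff_det_C_add_X_sq (A : Matrix n n ℂ) (B : Matrix n n ℂ⟦X⟧) (k : ℕ)
    (hk : ∀ s : Finset n, s.card = 2 → coeff k ((X : ℂ⟦X⟧) ^ 4 *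
      det (of fun i j => if i ∈ s then B i j else C (A i j))) = 0) (hk0 : k ≠ 0) (hk6 : k < 6) :
    coeff k (det (of fun i j => C (A i j) + X ^ 2 * B i j)) =
      ∑ i, ∑ j, adjugate A j i * coeff k (X ^ 2 * B i j) := by
  have h1 := det_add_rows (of fun i j => C (A i j)) (of fun i j => (X : ℂ⟦X⟧) ^ 2 * B i j)
  have h2 : ∀ s : Finset n, det (of fun i j => if i ∈ s then
      (of fun i j => (X : ℂ⟦X⟧) ^ 2 * B i j) i j else (of fun i j => C (A i j)) i j) =
      X ^ (2 * s.card) * det (of fun i j => if i ∈ s then B i j else C (A i j)) := by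
    intro s
    have h3 := det_mul_column (fun i => if i ∈ s then (X : ℂ⟦X⟧) ^ 2 else 1)
      (of fun i j => if i ∈ s then B i j else C (A i j))
    rw [Finset.prod_ite_mem, Finset.univ_inter, Finset.prod_const, ← pow_mul] at h3
    rw [← h3]
    congr 1
    ext1 i j
    simp only [of_apply]
    split_ifs <;> simp
  simp only [h2] at h1
  simp only [of_apply] at h1
  -- A set s of perturbed rows carries X^(2|s|). The empty set contributes at order 0 only, |s| ≥ 3
  -- from order 6 on, and |s| = 2 is excluded by `hk`.
  rw [h1, map_sum, ← Finset.sum_subset (Finset.subset_univ (Finset.powersetCard 1 Finset.univ)),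
    Finset.powersetCard_one, Finset.sum_map]
  · refine Finset.sum_congr rfl fun i _ => ?_
    have h4 : (of fun i' j => if i' ∈ ({i} : Finset n) then B i' j else C (A i' j)) =
        ((C (R := ℂ)).mapMatrix A).updateRow i (B i) := by
      ext1 i' j
      by_cases h : i' = i <;> simp [updateRow_apply, h]
    simp only [Function.Embedding.coeFn_mk, Finset.card_singleton, mul_one]
    rw [h4, det_eq_sum_adjugate_of_row, ← RingHom.map_adjugate, Finset.mul_sum, map_sum]
    refine Finset.sum_congr rfl fun j _ => ?_
    rw [RingHom.mapMatrix_apply, map_apply, mul_left_comm, coeff_C_mul]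
  · intro s _ hs
    have hs1 : s.card ≠ 1 := fun h => hs (by simp [Finset.mem_powersetCard, h])
    have : s.card = 0 ∨ s.card = 2 ∨ 3 ≤ s.card := by omega
    rcases this with h | h | h
    · rw [Finset.card_eq_zero.1 h]
      have : (of fun i j => if i ∈ (∅ : Finset n) then B i j else C (A i j)) =
          (C (R := ℂ)).mapMatrix A := by ext1 i j; simp
      rw [this, ← RingHom.map_det]
      simp [coeff_C, hk0]
    · rw [h]; exact hk s h
    · rw [coeff_X_pow_mul', if_neg (by omega)]

theorem coeff_two_det (A : Matrix n n ℂ) (B : Matrix n n ℂ⟦X⟧) :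
    coeff 2 (det (of fun i j => C (A i j) + X ^ 2 * B i j)) =
      ∑ i, ∑ j, adjugate A j i * coeff 0 (B i j) := by
  rw [coeff_det_C_add_X_sq A B 2 (fun s _ => by rw [coeff_X_pow_mul', if_neg (by omega)])
    (by omega) (by omega)]
  simp only [coeff_X_pow_mul', le_refl, if_true, Nat.sub_self]

/-- Two perturbed rows reach order four only through their leading terms, which by `hB` are equal
rows. -/
theorem coeff_four_det (A : Matrix n n ℂ) (B : Matrix n n ℂ⟦X⟧) (a : n → ℂ)
    (hB : ∀ i j, coeff 0 (B i j) = a j) :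
    coeff 4 (det (of fun i j => C (A i j) + X ^ 2 * B i j)) =
      ∑ i, ∑ j, adjugate A j i * coeff 2 (B i j) := by
  rw [coeff_det_C_add_X_sq A B 4 _ (by omega) (by omega)]
  · simp only [coeff_X_pow_mul', show 2 ≤ 4 by omega, if_true]
  · intro s hs
    rw [coeff_X_pow_mul', if_pos le_rfl, Nat.sub_self, coeff_zero_eq_constantCoeff_apply,
      RingHom.map_det]
    obtain ⟨u, v, huv, rfl⟩ := Finset.card_eq_two.1 hs
    refine det_zero_of_row_eq huv ?_
    ext j
    simp only [RingHom.mapMatrix_apply, map_apply, of_apply, Finset.mem_insert,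
      Finset.mem_singleton, true_or, or_true, if_true, ← coeff_zero_eq_constantCoeff_apply, hB]

end SecondOrder

/-! ### The substitution z = e^X -/

section Expansion

open Matrix

variable {N : ℕ}

/-- The limiting determinant as a polynomial. -/
noncomputable def limDetPoly (c : ℝ) (lam : Fin N → ℝ) (e : Fin N → ℂ) : Polynomial ℂ :=
  det (of fun i j : Fin N =>
    Polynomial.C (if i = j then Complex.I * diagSum c lam e j else 0) * Polynomial.X +
    Polynomial.C (1 / ((lam i - lam j : ℂ) + Complex.I * c)) -
    Polynomial.C (1 / ((lam i - lam j : ℂ) - Complex.I * c)) * Polynomial.X ^ 2)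

theorem eval_limDetPoly (c : ℝ) (lam : Fin N → ℝ) (e : Fin N → ℂ) (z : ℂ) :
    (limDetPoly c lam e).eval z = limDet c lam e z := by
  unfold limDetPoly limDet
  rw [← Polynomial.coe_evalRingHom, RingHom.map_det]
  congr 1
  ext1 i j
  simp only [RingHom.mapMatrix_apply, map_apply, of_apply, Polynomial.coe_evalRingHom]
  simp
  split_ifs <;> ring

theorem natDegree_limDetPoly (c : ℝ) (lam : Fin N → ℝ) (e : Fin N → ℂ) :
    (limDetPoly c lam e).natDegree ≤ 2 * N := by
  unfold limDetPoly
  rw [det_apply]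
  refine Polynomial.natDegree_sum_le_of_forall_le _ _ fun σ _ => ?_
  refine (Polynomial.natDegree_smul_le _ _).trans ?_
  refine (Polynomial.natDegree_prod_le _ _).trans ?_
  refine (Finset.sum_le_card_nsmul _ _ 2 fun i _ => ?_).trans (by simp [mul_comm])
  simp only [of_apply]
  compute_degree

open PowerSeries in
theorem coeff_rescale_exp (a : ℂ) (k : ℕ) :
    coeff k (rescale a (exp ℂ)) = a ^ k / k.factorial := by
  simp [coeff_rescale, coeff_exp, div_eq_mul_inv]

-- z^d becomes e^(dX), and the prefactor centres it to e^((d-M)X), whose coefficient of order k is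
-- (d - M)^k / k!. Moments thus become Taylor coefficients.
open PowerSeries in
theorem coeff_exp_mul_aeval (p : Polynomial ℂ) (M : ℕ) (hp : p.natDegree ≤ 2 * M) (k : ℕ)
    (κ : Fin (2 * M + 1) → ℂ)
    (hκ : ∀ d ≤ 2 * M, ∑ i, κ i * ((i : ℕ) : ℂ) ^ d = ((M : ℂ) - d) ^ k) :
    (-1) ^ k * k.factorial * coeff k (rescale (-(M : ℂ)) (exp ℂ) * Polynomial.aeval (exp ℂ) p) =
      ∑ i, κ i * p.eval ((i : ℕ) : ℂ) := by
  have h1 : ∀ z : ℂ, p.eval z = ∑ d ∈ Finset.range (2 * M + 1), p.coeff d * z ^ d := fun z =>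
    Polynomial.eval_eq_sum_range' (by omega) z
  have h2 : Polynomial.aeval (exp ℂ) p =
      ∑ d ∈ Finset.range (2 * M + 1), C (p.coeff d) * exp ℂ ^ d := by
    rw [Polynomial.aeval_eq_sum_range' (n := 2 * M + 1) (by omega)]
    refine Finset.sum_congr rfl fun d _ => ?_
    rw [PowerSeries.smul_eq_C_mul]
  rw [h2]
  simp only [h1, Finset.mul_sum, map_sum]
  rw [Finset.sum_comm]
  refine Finset.sum_congr rfl fun d hd => ?_
  rw [mul_left_comm, coeff_C_mul, exp_pow_eq_rescale_exp, exp_mul_exp_eq_exp_add,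
    coeff_rescale_exp]
  have hd' : d ≤ 2 * M := by have := Finset.mem_range.1 hd; omega
  have h3 : ∑ i, κ i * (p.coeff d * ((i : ℕ) : ℂ) ^ d) = p.coeff d * ((M : ℂ) - d) ^ k := by
    rw [← hκ d hd', Finset.mul_sum]
    exact Finset.sum_congr rfl fun i _ => by ring
  rw [h3, show -(M : ℂ) + d = -(M - d) by ring, neg_pow ((M : ℂ) - d)]
  have h4 : ((-1 : ℂ) ^ k) * (-1) ^ k = 1 := by rw [← mul_pow]; simp
  have h5 : (k.factorial : ℂ) ≠ 0 := by exact_mod_cast k.factorial_ne_zero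
  field_simp
  linear_combination (p.coeff d * ((M : ℂ) - d) ^ k) * h4

/-- The Laplacian-like matrix governing the limit of the form factors. -/
noncomputable def gaudin (c : ℝ) (lam : Fin N → ℝ) (e : Fin N → ℂ) : Matrix (Fin N) (Fin N) ℂ :=
  of fun i j => (if i = j then diagSum c lam e j else 0) - (phi c (lam i - lam j) : ℂ)

/-- The exponential generating function of the off-diagonal entries of the limiting determinant. -/
noncomputable def entryExp (c x : ℝ) : PowerSeries ℂ :=
  PowerSeries.C (-Complex.I / (x + Complex.I * c)) *
    PowerSeries.rescale (Complex.I / c * (x + Complex.I * c)) (PowerSeries.exp ℂ) -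
  PowerSeries.C (-Complex.I / (x - Complex.I * c)) *
    PowerSeries.rescale (Complex.I / c * (x - Complex.I * c)) (PowerSeries.exp ℂ)

theorem coeff_entryExp (c x : ℝ) (k : ℕ) : PowerSeries.coeff k (entryExp c x) =
    -Complex.I * (Complex.I / c) ^ k / k.factorial * ((x + Complex.I * c) ^ k /
      (x + Complex.I * c) - (x - Complex.I * c) ^ k / (x - Complex.I * c)) := by
  simp only [entryExp, map_sub, PowerSeries.coeff_C_mul, coeff_rescale_exp, mul_pow]
  ring

-- With p = x ± ic and a = i/c, both series e^(apX)/p have the linear coefficient a, so the linear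
-- terms cancel; the constant terms combine to -φ.
open PowerSeries in
theorem entryExp_eq (c : ℝ) (hc : c ≠ 0) (x : ℝ) :
    entryExp c x = C (-(phi c x : ℂ)) + X ^ 2 * PowerSeries.mk fun k => coeff (k + 2) (entryExp c x) := by
  have hp : (x : ℂ) + Complex.I * c ≠ 0 := by simpa using real_add_I_mul_ne_zero hc x 0
  have hm : (x : ℂ) - Complex.I * c ≠ 0 := by simpa using real_sub_I_mul_ne_zero hc x 0
  ext k
  rw [map_add, coeff_X_pow_mul', coeff_C]
  rcases k with _ | _ | k
  · have h : (phi c x : ℂ) = 2 * c / ((x + Complex.I * c) * (x - Complex.I * c)) := by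
      have : ((x : ℂ) + Complex.I * c) * (x - Complex.I * c) = (c : ℂ) ^ 2 + x ^ 2 := by
        linear_combination (-(c : ℂ) ^ 2) * Complex.I_sq
      rw [this]
      simp [phi]
    rw [coeff_entryExp, h]
    simp
    field_simp
    linear_combination (-2 * (c : ℂ)) * Complex.I_sq
  · rw [coeff_entryExp]
    simp [hp, hm]
  · simp

/-- Independence of x is the point: it supplies the equal rows required in `coeff_four_det`. -/
theorem coeff_two_entryExp (c : ℝ) (hc : c ≠ 0) (x : ℝ) :
    PowerSeries.coeff 2 (entryExp c x) = -1 / c := by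
  have hcc : (c : ℂ) ≠ 0 := by exact_mod_cast hc
  have hp : (x : ℂ) + Complex.I * c ≠ 0 := by simpa using real_add_I_mul_ne_zero hc x 0
  have hm : (x : ℂ) - Complex.I * c ≠ 0 := by simpa using real_sub_I_mul_ne_zero hc x 0
  rw [coeff_entryExp]
  simp only [pow_two, mul_self_div_self, Nat.factorial]
  field_simp
  push_cast
  linear_combination (-2 * (c : ℂ) * (Complex.I ^ 2 - 1)) * Complex.I_sq

theorem coeff_four_entryExp (c : ℝ) (hc : c ≠ 0) (x : ℝ) :
    PowerSeries.coeff 4 (entryExp c x) = (3 * x ^ 2 - c ^ 2) / (12 * c ^ 3) := by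
  have hcc : (c : ℂ) ≠ 0 := by exact_mod_cast hc
  have hp : (x : ℂ) + Complex.I * c ≠ 0 := by simpa using real_add_I_mul_ne_zero hc x 0
  have hm : (x : ℂ) - Complex.I * c ≠ 0 := by simpa using real_sub_I_mul_ne_zero hc x 0
  rw [coeff_entryExp, pow_succ (_ + _) 3, pow_succ (_ - _) 3, mul_div_cancel_right₀ _ hp,
    mul_div_cancel_right₀ _ hm, div_pow, Complex.I_pow_four]
  have h3 : Complex.I ^ 3 = -Complex.I := by rw [pow_succ, Complex.I_sq]; ring
  have h : ((x : ℂ) + Complex.I * c) ^ 3 - (x - Complex.I * c) ^ 3 =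
      2 * Complex.I * c * (3 * x ^ 2 - c ^ 2) := by linear_combination (2 * (c : ℂ) ^ 3) * h3
  rw [h]
  simp only [Nat.factorial]
  field_simp
  push_cast
  linear_combination (-24 * (3 * (x : ℂ) ^ 2 - c ^ 2)) * Complex.I_sq

-- Row i is multiplied by -i e^(-X) e^(iλᵢX/c) and column j by e^(-iλⱼX/c), where the products of
-- the exponentials of λ cancel. Since e^(-X) = e^((i/c)(ic)X), the entries become series in
-- (i/c)(λᵢ - λⱼ ± ic), and the diagonal term linear in z becomes constant.
open PowerSeries in
theorem det_exp_mul (c : ℝ) (hc : c ≠ 0) (lam : Fin N → ℝ) (e : Fin N → ℂ) :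
    C ((-Complex.I) ^ N) * (rescale (-(N : ℂ)) (exp ℂ) *
        Polynomial.aeval (exp ℂ) (limDetPoly c lam e)) =
      det (of fun i j => C (gaudin c lam e i j) + X ^ 2 *
        (of fun i j => PowerSeries.mk fun k => coeff (k + 2) (entryExp c (lam i - lam j))) i j) := by
  have hcc : (c : ℂ) ≠ 0 := by exact_mod_cast hc
  set E : ℂ → ℂ⟦X⟧ := fun a => rescale a (exp ℂ) with hE
  have hadd : ∀ a b, E a * E b = E (a + b) := fun a b => exp_mul_exp_eq_exp_add a b
  have hE0 : E 0 = 1 := by ext k; simp [hE]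
  have hE1 : exp ℂ = E 1 := by simp [hE]
  have hpow : E (-(N : ℂ)) = E (-1) ^ N := by
    simp only [hE]
    rw [← map_pow, exp_pow_eq_rescale_exp, rescale_rescale]
    congr 2
    ring
  have huv : (∏ i, E (Complex.I / c * lam i)) * ∏ j, E (-(Complex.I / c * lam j)) = 1 := by
    rw [← Finset.prod_mul_distrib]
    exact Finset.prod_eq_one fun i _ => by rw [hadd, add_neg_cancel, hE0]
  have h1 : C ((-Complex.I) ^ N) * (E (-(N : ℂ)) * Polynomial.aeval (exp ℂ) (limDetPoly c lam e)) =
      (∏ i, C (-Complex.I) * E (-1) * E (Complex.I / c * lam i)) *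
        ((∏ j, E (-(Complex.I / c * lam j))) *
          Polynomial.aeval (exp ℂ) (limDetPoly c lam e)) := by
    rw [Finset.prod_mul_distrib, Finset.prod_const, Finset.card_univ, Fintype.card_fin, hpow,
      mul_pow, map_pow]
    linear_combination (-(C (-Complex.I) ^ N * E (-1) ^ N *
      Polynomial.aeval (exp ℂ) (limDetPoly c lam e))) * huv
  rw [h1, limDetPoly, AlgHom.map_det, ← det_mul_row, ← det_mul_column]
  congr 1
  ext1 i j
  simp only [AlgHom.mapMatrix_apply, map_apply, of_apply]
  have h2 : C (gaudin c lam e i j) + X ^ 2 * PowerSeries.mk (fun k =>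
      coeff (k + 2) (entryExp c (lam i - lam j))) =
      C (if i = j then diagSum c lam e j else 0) + entryExp c (lam i - lam j) := by
    have h := entryExp_eq c hc (lam i - lam j)
    rw [map_neg] at h
    rw [gaudin, of_apply, map_sub]
    linear_combination -h
  rw [h2]
  simp only [map_sub, map_add, map_mul, map_pow, Polynomial.aeval_C, Polynomial.aeval_X]
  have hx : ((lam i - lam j : ℝ) : ℂ) = lam i - lam j := by push_cast; ring
  have hc1 : Complex.I / c * (Complex.I * c) = -1 := by
    field_simp
    exact Complex.I_sq
  have h3 : E (-1) * E (Complex.I / c * lam i) * E (-(Complex.I / c * lam j)) =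
      E (Complex.I / c * ((lam i - lam j : ℝ) + Complex.I * c)) := by
    rw [hadd, hadd, hx, mul_add, hc1]
    congr 1
    ring
  have h4 : E (-1) * E (Complex.I / c * lam i) * E (-(Complex.I / c * lam j)) * E 1 ^ 2 =
      E (Complex.I / c * ((lam i - lam j : ℝ) - Complex.I * c)) := by
    rw [pow_two, hadd, hadd, hadd, hadd, hx, mul_sub, hc1]
    congr 1
    ring
  have h5 : C (-Complex.I) * E (-1) * E (Complex.I / c * lam i) * E (-(Complex.I / c * lam j)) *
      (C (if i = j then Complex.I * diagSum c lam e j else 0) * E 1) =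
      C (if i = j then diagSum c lam e j else 0) := by
    split_ifs with hij
    · subst hij
      have h6 : E (-1) * E (Complex.I / c * lam i) * E (-(Complex.I / c * lam i)) * E 1 = 1 := by
        rw [hadd, hadd, hadd, ← hE0]
        congr 1
        ring
      have h7 : C (-Complex.I) * C (Complex.I * diagSum c lam e i) = C (diagSum c lam e i) := by
        rw [← map_mul]
        congr 1
        linear_combination (-diagSum c lam e i) * Complex.I_sq
      linear_combination (C (-Complex.I) * C (Complex.I * diagSum c lam e i)) * h6 + h7
    · simp
  have h8 : entryExp c (lam i - lam j) =
      C (-Complex.I / ((lam i - lam j : ℝ) + Complex.I * c)) *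
        E (Complex.I / c * ((lam i - lam j : ℝ) + Complex.I * c)) -
      C (-Complex.I / ((lam i - lam j : ℝ) - Complex.I * c)) *
        E (Complex.I / c * ((lam i - lam j : ℝ) - Complex.I * c)) := rfl
  have h9 : ∀ p : ℂ, C (-Complex.I / p) = C (-Complex.I) * C (1 / p) := fun p => by
    rw [← map_mul, mul_one_div]
  rw [h8, ← h4, ← h3, ← h5, hx, h9, h9, hE1]
  simp only [PowerSeries.algebraMap_eq]
  ring

open PowerSeries in
/-- The limits of the second and fourth moments. -/
theorem sum_limDet (c : ℝ) (hc : c ≠ 0) (lam : Fin N → ℝ) (e : Fin N → ℂ)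
    (κ μ : Fin (2 * N + 1) → ℂ)
    (hκ : ∀ d ≤ 2 * N, ∑ i, κ i * ((i : ℕ) : ℂ) ^ d = ((N : ℂ) - d) ^ 2)
    (hμ : ∀ d ≤ 2 * N, ∑ i, μ i * ((i : ℕ) : ℂ) ^ d = ((N : ℂ) - d) ^ 4) :
    c * (-1) ^ (N + 1) * (1 / 2 * (Complex.I ^ N * ∑ m, κ m * limDet c lam e ((m : ℕ) : ℂ))) =
      ∑ i, ∑ j, adjugate (gaudin c lam e) j i ∧
    (c : ℂ) ^ 2 * (-1) ^ N * (1 / 6 * (Complex.I ^ N * ∑ m, μ m * limDet c lam e ((m : ℕ) : ℂ) -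
      Complex.I ^ N * ∑ m, κ m * limDet c lam e ((m : ℕ) : ℂ))) =
      ∑ i, ∑ j, adjugate (gaudin c lam e) j i * (((lam i - lam j) ^ 2 / c : ℝ) : ℂ) := by
  have hcc : (c : ℂ) ≠ 0 := by exact_mod_cast hc
  have h1 := coeff_exp_mul_aeval (limDetPoly c lam e) N (natDegree_limDetPoly c lam e) 2 κ hκ
  have h2 := coeff_exp_mul_aeval (limDetPoly c lam e) N (natDegree_limDetPoly c lam e) 4 μ hμ
  simp only [eval_limDetPoly] at h1 h2
  have h3 := congrArg (coeff 2) (det_exp_mul c hc lam e)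
  have h4 := congrArg (coeff 4) (det_exp_mul c hc lam e)
  rw [coeff_C_mul, coeff_two_det] at h3
  rw [coeff_C_mul, coeff_four_det _ _ (fun _ => -1 / (c : ℂ))] at h4
  · simp only [of_apply, coeff_mk, zero_add, coeff_two_entryExp c hc] at h3
    simp only [of_apply, coeff_mk, Nat.reduceAdd, coeff_four_entryExp c hc] at h4
    rw [← h1, ← h2]
    have h5 : (-1 : ℂ) ^ N * Complex.I ^ N = (-Complex.I) ^ N := by rw [← mul_pow]; simp
    simp only [← Finset.sum_mul] at h3
    -- The part -1/(12c) of the order-four coefficient is what the subtraction of the second moment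
    -- removes; only (λᵢ - λⱼ)²/c remains.
    have h6 : ∑ i, ∑ j, adjugate (gaudin c lam e) j i *
        ((3 * ((lam i - lam j : ℝ) : ℂ) ^ 2 - (c : ℂ) ^ 2) / (12 * (c : ℂ) ^ 3)) =
        1 / (4 * c ^ 2) * (∑ i, ∑ j, adjugate (gaudin c lam e) j i *
          (((lam i - lam j) ^ 2 / c : ℝ) : ℂ)) -
        1 / (12 * c) * ∑ i, ∑ j, adjugate (gaudin c lam e) j i := by
      simp only [Finset.mul_sum, ← Finset.sum_sub_distrib]
      refine Finset.sum_congr rfl fun i _ => Finset.sum_congr rfl fun j _ => ?_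
      push_cast
      field_simp
      ring
    rw [h6] at h4
    set a2 := coeff 2 (rescale (-(N : ℂ)) (exp ℂ) * Polynomial.aeval (exp ℂ) (limDetPoly c lam e))
    set a4 := coeff 4 (rescale (-(N : ℂ)) (exp ℂ) * Polynomial.aeval (exp ℂ) (limDetPoly c lam e))
    set P := ∑ i, ∑ j, adjugate (gaudin c lam e) j i
    set Q := ∑ i, ∑ j, adjugate (gaudin c lam e) j i * (((lam i - lam j) ^ 2 / c : ℝ) : ℂ)
    rw [← h5] at h3 h4
    have h3' : (c : ℂ) * ((-1) ^ N * Complex.I ^ N * a2) = -P := by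
      rw [h3]; field_simp
    have h4' : 12 * (c : ℂ) ^ 2 * ((-1) ^ N * Complex.I ^ N * a4) = 3 * Q - c * P := by
      rw [h4]; field_simp; ring
    simp only [Nat.factorial]
    push_cast
    constructor
    · linear_combination -h3'
    · linear_combination (1 / 3 : ℂ) * h4' - (1 / 3 * c : ℂ) * h3'
  · intro i j
    simp [coeff_two_entryExp c hc]

end Expansion

end BoseGas


namespace BoseGas

/-! ### The matrix tree theorem for parent functions -/

section RootedMaps

open Matrix

variable {V : Type} [Fintype V] [DecidableEq V]

/-- `f` is the parent function of a tree with root `j`. -/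
def IsRootedMap (f : V → V) (j : V) : Prop := f j = j ∧ ∀ v, ∃ k : ℕ, f^[k] v = j

open Classical in
/-- The parent functions of trees with root `j`. -/
noncomputable def rootedMaps (j : V) : Finset (V → V) := Finset.univ.filter fun f => IsRootedMap f j

theorem mem_rootedMaps {f : V → V} {j : V} : f ∈ rootedMaps j ↔ IsRootedMap f j := by
  simp [rootedMaps]

theorem IsRootedMap.exists_depth {f : V → V} {j : V} (hf : IsRootedMap f j) :
    ∃ d : V → ℕ, d j = 0 ∧ ∀ v, v ≠ j → d v = d (f v) + 1 := by
  classical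
  refine ⟨fun v => Nat.find (hf.2 v), by simp, fun v hv => ?_⟩
  rw [Nat.find_eq_iff]
  refine ⟨Nat.find_spec (hf.2 (f v)), fun m hm h => ?_⟩
  rcases m with _ | m
  · exact hv h
  · exact Nat.find_min (hf.2 (f v)) (Nat.lt_of_succ_lt_succ hm) h

theorem isRootedMap_of_depth {f : V → V} {j : V} (hj : f j = j) (d : V → ℕ)
    (hd : ∀ v, v ≠ j → d (f v) < d v) : IsRootedMap f j := by
  refine ⟨hj, fun v => ?_⟩
  induction h : d v using Nat.strong_induction_on generalizing v with
  | _ m ih =>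
    by_cases hv : v = j
    · exact ⟨0, hv⟩
    · obtain ⟨k, hk⟩ := ih _ (h ▸ hd v hv) (f v) rfl
      exact ⟨k + 1, hk⟩

/-- The matrix `1 - M`, where `M` is the adjacency matrix of the graph of `f` outside the root. -/
def rootMatrix (f : V → V) (j : V) : Matrix V V ℂ :=
  of fun v x => (if v = x then 1 else 0) - if v ≠ j ∧ f v = x then 1 else 0

/-- Ordering the vertices by depth makes the matrix triangular with unit diagonal blocks. -/
theorem det_rootMatrix_of_isRootedMap {f : V → V} {j : V} (hf : IsRootedMap f j) :
    det (rootMatrix f j) = 1 := by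
  obtain ⟨d, hd0, hd⟩ := hf.exists_depth
  have ht : (rootMatrix f j)ᵀ.BlockTriangular d := by
    intro i k hik
    simp only [transpose_apply, rootMatrix, of_apply]
    rw [if_neg (by rintro rfl; exact lt_irrefl _ hik), if_neg, sub_zero]
    rintro ⟨hk, rfl⟩
    have := hd k hk
    omega
  rw [← det_transpose, ht.det]
  refine Finset.prod_eq_one fun a _ => ?_
  have : (rootMatrix f j)ᵀ.toSquareBlock d a = 1 := by
    ext ⟨x, hx⟩ ⟨y, hy⟩
    simp only [toSquareBlock_def, of_apply, transpose_apply, rootMatrix, one_apply, Subtype.mk.injEq]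
    rw [if_neg (fun h : y ≠ j ∧ f y = x => by have := hd y h.1; rw [h.2, hx, hy] at this; omega),
      sub_zero]
    simp only [eq_comm]
  rw [this, det_one]

/-- The indicator of the vertices that never reach j lies in the kernel. -/
theorem det_rootMatrix_of_not {f : V → V} {j : V} (hf : ¬ ∀ v, ∃ k : ℕ, f^[k] v = j) :
    det (rootMatrix f j) = 0 := by
  classical
  push Not at hf
  obtain ⟨v₀, hv₀⟩ := hf
  refine exists_mulVec_eq_zero_iff.1 ⟨fun v => if ∀ k : ℕ, f^[k] v ≠ j then 1 else 0, ?_, ?_⟩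
  · intro h
    have := congrFun h v₀
    simp [hv₀] at this
  · ext v
    simp only [mulVec, dotProduct, rootMatrix, of_apply, sub_mul, Finset.sum_sub_distrib, ite_mul,
      one_mul, zero_mul, Pi.zero_apply, ite_and, ne_eq]
    by_cases hv : v = j
    · subst hv
      have : ¬ ∀ k : ℕ, ¬ f^[k] v = v := fun h => h 0 rfl
      simp [this]
    · have : (∀ k : ℕ, ¬ f^[k] v = j) ↔ ∀ k : ℕ, ¬ f^[k] (f v) = j :=
        ⟨fun h k => h (k + 1), fun h k => by
          rcases k with _ | k
          · exact hv
          · exact h k⟩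
      simp [hv, this]

/-- The matrix tree theorem for a Laplacian with a row replaced by a unit vector. -/
theorem det_updateRow_laplacian (a : V → V → ℂ) (j : V) :
    det ((of fun v x => (if v = x then ∑ u, a v u else 0) - a v x).updateRow j (Pi.single j 1)) =
      ∑ f ∈ rootedMaps j, ∏ v ∈ Finset.univ.erase j, a v (f v) := by
  -- Row v is the combination ∑ᵤ a v u (δᵥ - δᵤ), and row j is δⱼ. Multilinearity chooses u = f v in
  -- every row and leaves the determinants of `rootMatrix`.
  let b : V → V → ℂ := fun v u => if v = j then (if u = j then 1 else 0) else a v u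
  let r : V → V → V → ℂ := fun v u x => (if v = x then 1 else 0) - if v ≠ j ∧ u = x then 1 else 0
  have h1 : ((of fun v x => (if v = x then ∑ u, a v u else 0) - a v x).updateRow j
      (Pi.single j 1)) = fun v => ∑ u, b v u • r v u := by
    ext v x
    rw [Finset.sum_apply]
    simp only [updateRow_apply, b, r, Pi.smul_apply, smul_eq_mul, of_apply]
    by_cases hv : v = j
    · subst hv
      simp [Pi.single_apply, eq_comm]
    · simp [hv, mul_sub]
  have h2 : det (fun v => ∑ u, b v u • r v u) = ∑ f : V → V, (∏ v, b v (f v)) *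
      det (rootMatrix f j) := by
    refine ((detRowAlternating (R := ℂ) (n := V)).toMultilinearMap.map_sum
      (fun v u => b v u • r v u)).trans (Finset.sum_congr rfl fun f _ => ?_)
    exact (detRowAlternating (R := ℂ) (n := V)).toMultilinearMap.map_smul_univ (fun v => b v (f v)) (fun v => r v (f v))
  rw [h1]
  refine h2.trans (Finset.sum_subset_zero_on_sdiff (Finset.subset_univ _) ?_ ?_).symm
  · intro f hf
    have hf' : ¬ IsRootedMap f j := by simpa [mem_rootedMaps] using hf
    by_cases hj : f j = j
    · rw [det_rootMatrix_of_not fun h => hf' ⟨hj, h⟩, mul_zero]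
    · rw [Finset.prod_eq_zero (Finset.mem_univ j) (by simp [b, hj]), zero_mul]
  · intro f hf
    have hf' := mem_rootedMaps.1 hf
    rw [det_rootMatrix_of_isRootedMap hf', mul_one, ← Finset.mul_prod_erase _ _ (Finset.mem_univ j)]
    simp only [b, hf'.1, if_true, one_mul]
    exact Finset.prod_congr rfl fun v hv => by rw [if_neg (Finset.ne_of_mem_erase hv)]

/-- Independence of i: with row j replaced by eᵢ - eⱼ, all rows sum to zero and the determinant
vanishes. -/
theorem adjugate_laplacian (a : V → V → ℂ) (i j : V) :
    adjugate (of fun v x => (if v = x then ∑ u, a v u else 0) - a v x) i j =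
      ∑ f ∈ rootedMaps j, ∏ v ∈ Finset.univ.erase j, a v (f v) := by
  rw [← det_updateRow_laplacian, adjugate_apply]
  set M : Matrix V V ℂ := of fun v x => (if v = x then ∑ u, a v u else 0) - a v x
  have h1 : (Pi.single i 1 : V → ℂ) = Pi.single j 1 + (Pi.single i 1 - Pi.single j 1) := by
    rw [add_sub_cancel]
  rw [h1, det_updateRow_add, add_eq_left]
  refine exists_mulVec_eq_zero_iff.1 ⟨fun _ => 1, fun h => one_ne_zero (congrFun h j), ?_⟩
  ext v
  simp only [mulVec, dotProduct, updateRow_apply, mul_one, Pi.zero_apply]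
  split_ifs
  · simp [Finset.sum_sub_distrib]
  · simp [M, Finset.sum_sub_distrib]

end RootedMaps

/-! ### The adjugate of the limiting matrix -/

section Gaudin

open Matrix

variable {N : ℕ}

/-- Scaling column x by e x produces the Laplacian with weights φ(λᵥ - λᵤ) e u; the adjugate of the
diagonal matrix contributes the product of e over the indices other than i. -/
theorem adjugate_gaudin (c : ℝ) (lam : Fin N → ℝ) (e : Fin N → ℂ) (he : ∀ i, e i ≠ 0)
    (i j : Fin N) : adjugate (gaudin c lam e) i j = (e i * ∑ f ∈ rootedMaps j,
      ∏ v ∈ Finset.univ.erase j, ((phi c (lam v - lam (f v)) : ℂ) * e (f v))) / ∏ k, e k := by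
  have h1 : gaudin c lam e * diagonal e = of fun v x =>
      (if v = x then ∑ u, (phi c (lam v - lam u) : ℂ) * e u else 0) -
        (phi c (lam v - lam x) : ℂ) * e x := by
    ext v x
    rw [mul_diagonal]
    simp only [gaudin, of_apply, sub_mul, ite_mul, zero_mul, diagSum, Finset.sum_mul]
    congr 1
    split_ifs with h
    · subst h
      refine Finset.sum_congr rfl fun u _ => ?_
      have := he v
      field_simp
    · rfl
  have h2 := adjugate_laplacian (fun v u => (phi c (lam v - lam u) : ℂ) * e u) i j
  rw [← h1, adjugate_mul_distrib, adjugate_diagonal, diagonal_mul] at h2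
  rw [← h2, ← mul_assoc, Finset.mul_prod_erase _ _ (Finset.mem_univ i), mul_div_cancel_left₀]
  exact Finset.prod_ne_zero_iff.2 fun k _ => he k

/-- The numerator of the limit of the form factors, a polynomial in the shifts. -/
noncomputable def diagPoly (c : ℝ) (lam : Fin N → ℝ) (q : Fin N → Fin N → ℂ) :
    MvPolynomial (Fin N) ℂ :=
  ∑ i, ∑ j, ∑ f ∈ rootedMaps j, MvPolynomial.C (q i j *
    ∏ v ∈ Finset.univ.erase j, (phi c (lam v - lam (f v)) : ℂ)) *
      (MvPolynomial.X i * ∏ v ∈ Finset.univ.erase j, MvPolynomial.X (f v))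

theorem isHomogeneous_diagPoly (c : ℝ) (lam : Fin N → ℝ) (q : Fin N → Fin N → ℂ) :
    (diagPoly c lam q).IsHomogeneous N := by
  refine MvPolynomial.IsHomogeneous.sum _ _ _ fun i _ => MvPolynomial.IsHomogeneous.sum _ _ _
    fun j _ => MvPolynomial.IsHomogeneous.sum _ _ _ fun f _ => ?_
  have h := ((MvPolynomial.isHomogeneous_C (Fin N) (q i j *
    ∏ v ∈ Finset.univ.erase j, (phi c (lam v - lam (f v)) : ℂ))).mul
    ((MvPolynomial.isHomogeneous_X ℂ i).mul (MvPolynomial.IsHomogeneous.prod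
      (Finset.univ.erase j) (fun v => MvPolynomial.X (f v)) (fun _ => 1)
      fun v _ => MvPolynomial.isHomogeneous_X ℂ (f v))))
  convert h using 1
  -- The degree 1 + (N - 1) equals N only for N > 0, which the index i guarantees.
  have := Fin.pos i
  simp
  omega

theorem sum_adjugate_gaudin (c : ℝ) (lam : Fin N → ℝ) (e : Fin N → ℂ) (he : ∀ i, e i ≠ 0)
    (q : Fin N → Fin N → ℂ) (hq : ∀ i j, q i j = q j i) :
    ∑ i, ∑ j, adjugate (gaudin c lam e) j i * q i j =
      MvPolynomial.eval e (diagPoly c lam q) / ∏ k, e k := by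
  rw [Finset.sum_comm]
  simp only [diagPoly, map_sum, map_mul, map_prod, MvPolynomial.eval_C, MvPolynomial.eval_X,
    adjugate_gaudin c lam e he, Finset.sum_div, Finset.sum_mul, Finset.mul_sum]
  refine Finset.sum_congr rfl fun i _ => Finset.sum_congr rfl fun j _ =>
    Finset.sum_congr rfl fun f _ => ?_
  rw [Finset.prod_mul_distrib, hq i j]
  ring

end Gaudin

end BoseGas


namespace BoseGas

/-! ### Spanning trees and parent functions -/

section Trees

variable {V : Type} [Fintype V] [DecidableEq V]

/-- The graph joining every vertex other than `j` to its parent. -/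
def parentGraph (f : V → V) (j : V) : SimpleGraph V :=
  SimpleGraph.fromEdgeSet ((fun v => s(v, f v)) '' {j}ᶜ)

theorem IsRootedMap.ne {f : V → V} {j v : V} (hf : IsRootedMap f j) (hv : v ≠ j) : v ≠ f v := by
  obtain ⟨d, -, hd⟩ := hf.exists_depth
  intro h
  have := hd v hv
  rw [← h] at this
  omega

/-- If two vertices shared an edge, each would be the parent of the other, against the depths. -/
theorem IsRootedMap.injOn_edge {f : V → V} {j : V} (hf : IsRootedMap f j) :
    Set.InjOn (fun v => s(v, f v)) {j}ᶜ := by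
  obtain ⟨d, -, hd⟩ := hf.exists_depth
  intro u hu v hv h
  rcases Sym2.eq_iff.1 h with ⟨h, -⟩ | ⟨h1, h2⟩
  · exact h
  · have h3 := hd u hu
    have h4 := hd v hv
    rw [← h1] at h4
    rw [h2] at h3
    omega

theorem IsRootedMap.edgeSet_parentGraph {f : V → V} {j : V} (hf : IsRootedMap f j) :
    (parentGraph f j).edgeSet = (fun v => s(v, f v)) '' {j}ᶜ := by
  rw [parentGraph, SimpleGraph.edgeSet_fromEdgeSet, sdiff_eq_left, Set.disjoint_left]
  rintro _ ⟨v, hv, rfl⟩ h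
  exact hf.ne hv (by simpa using h)

theorem IsRootedMap.adj_parentGraph {f : V → V} {j v : V} (hf : IsRootedMap f j) (hv : v ≠ j) :
    (parentGraph f j).Adj v (f v) := by
  rw [← SimpleGraph.mem_edgeSet, hf.edgeSet_parentGraph]
  exact ⟨v, hv, rfl⟩

theorem IsRootedMap.eq_of_adj {f : V → V} {j u v : V} (hf : IsRootedMap f j)
    (h : (parentGraph f j).Adj u v) : (u ≠ j ∧ f u = v) ∨ (v ≠ j ∧ f v = u) := by
  rw [← SimpleGraph.mem_edgeSet, hf.edgeSet_parentGraph] at h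
  obtain ⟨w, hw, h⟩ := h
  rcases Sym2.eq_iff.1 h with ⟨h1, h2⟩ | ⟨h1, h2⟩
  · exact Or.inl ⟨h1 ▸ hw, h1 ▸ h2⟩
  · exact Or.inr ⟨h1 ▸ hw, h1 ▸ h2⟩

open Classical in
theorem IsRootedMap.edgeFinset_parentGraph {f : V → V} {j : V} (hf : IsRootedMap f j) :
    (parentGraph f j).edgeFinset = (Finset.univ.erase j).image fun v => s(v, f v) := by
  rw [← Finset.coe_inj, SimpleGraph.coe_edgeFinset, hf.edgeSet_parentGraph]
  ext; simp

open Classical in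
theorem IsRootedMap.isTree_parentGraph {f : V → V} {j : V} (hf : IsRootedMap f j) :
    (parentGraph f j).IsTree := by
  rw [SimpleGraph.isTree_iff_connected_and_card]
  constructor
  · rw [SimpleGraph.connected_iff_exists_forall_reachable]
    refine ⟨j, fun v => SimpleGraph.Reachable.symm ?_⟩
    obtain ⟨k, hk⟩ := hf.2 v
    induction k generalizing v with
    | zero => exact hk ▸ SimpleGraph.Reachable.refl _
    | succ k ih =>
      by_cases hv : v = j
      · exact hv ▸ SimpleGraph.Reachable.refl _
      · exact (hf.adj_parentGraph hv).reachable.trans (ih (f v) hk)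
  · rw [Nat.card_eq_fintype_card, Nat.card_eq_fintype_card, ← SimpleGraph.edgeFinset_card]
    have h1 : (parentGraph f j).edgeFinset.card = Fintype.card V - 1 := by
      rw [hf.edgeFinset_parentGraph, Finset.card_image_of_injOn, Finset.card_erase_of_mem
        (Finset.mem_univ j), Finset.card_univ]
      intro u hu v hv h
      exact hf.injOn_edge (by simpa using hu) (by simpa using hv) h
    have h2 : 0 < Fintype.card V := Fintype.card_pos_iff.2 ⟨j⟩
    omega

/-- Induction on the depth for g. The edge from v to g v forces f v = g v or f (g v) = v; in the
second case f and g agree at g v, so v would lie nearer the root than g v. -/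
theorem parentGraph_injOn {j : V} {f g : V → V} (hf : IsRootedMap f j) (hg : IsRootedMap g j)
    (h : parentGraph f j = parentGraph g j) : f = g := by
  have key : ∀ v, v ≠ j → f v = g v := by
    intro v hv
    obtain ⟨d, -, hd⟩ := hg.exists_depth
    induction hm : d v using Nat.strong_induction_on generalizing v with
    | _ m ih =>
      have h1 := hg.adj_parentGraph hv
      rw [← h] at h1
      rcases hf.eq_of_adj h1 with ⟨-, h2⟩ | ⟨h2, h3⟩
      · exact h2
      · have h4 := hd v hv
        have h5 := hd (g v) h2
        have h6 := ih (d (g v)) (by omega) (g v) h2 rfl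
        rw [h3] at h6
        rw [← h6] at h5
        omega
  ext v
  by_cases hv : v = j
  · rw [hv, hf.1, hg.1]
  · exact key v hv

-- The parent of v is the next vertex on a shortest walk to j. The resulting tree lies in T and has
-- the same number of edges.
open Classical in
theorem exists_parentGraph_eq {T : SimpleGraph V} (hT : T.IsTree) (j : V) :
    ∃ f, IsRootedMap f j ∧ parentGraph f j = T := by
  have h1 : ∀ v, v ≠ j → ∃ u, T.Adj v u ∧ T.dist u j < T.dist v j := by
    intro v hv
    obtain ⟨p, hp⟩ := (hT.connected v j).exists_walk_length_eq_dist
    cases p with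
    | nil => exact absurd rfl hv
    | @cons _ u _ huv p =>
      refine ⟨u, huv, ?_⟩
      have := SimpleGraph.dist_le p
      rw [SimpleGraph.Walk.length_cons] at hp
      omega
  choose g hg1 hg2 using h1
  let f : V → V := fun v => if hv : v = j then j else g v hv
  have hfg : ∀ v (hv : v ≠ j), f v = g v hv := fun v hv => dif_neg hv
  have hf : IsRootedMap f j := isRootedMap_of_depth (dif_pos rfl) (fun v => T.dist v j)
    fun v hv => by rw [hfg v hv]; exact hg2 v hv
  refine ⟨f, hf, ?_⟩
  have hsub : (parentGraph f j).edgeFinset ⊆ T.edgeFinset := by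
    rw [hf.edgeFinset_parentGraph]
    intro x hx
    obtain ⟨v, hv, rfl⟩ := Finset.mem_image.1 hx
    have hv' := Finset.ne_of_mem_erase hv
    rw [SimpleGraph.mem_edgeFinset, SimpleGraph.mem_edgeSet, hfg v hv']
    exact hg1 v hv'
  rw [← SimpleGraph.edgeFinset_inj]
  refine Finset.eq_of_subset_of_card_le hsub ?_
  have := hT.card_edgeFinset
  have := hf.isTree_parentGraph.card_edgeFinset
  omega

open Classical in
/-- The spanning trees correspond to the parent functions with a fixed root. -/
theorem sum_isTree_eq_sum_rootedMaps {R : Type} [CommSemiring R] (W : Sym2 V → R) (j : V) :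
    ∑ T : SimpleGraph V with T.IsTree, ∏ e ∈ T.edgeFinset, W e =
      ∑ f ∈ rootedMaps j, ∏ v ∈ Finset.univ.erase j, W s(v, f v) := by
  symm
  refine Finset.sum_bij (fun f _ => parentGraph f j) ?_ ?_ ?_ ?_
  · intro f hf
    exact Finset.mem_filter.2 ⟨Finset.mem_univ _, (mem_rootedMaps.1 hf).isTree_parentGraph⟩
  · intro f hf g hg h
    exact parentGraph_injOn (mem_rootedMaps.1 hf) (mem_rootedMaps.1 hg) h
  · intro T hT
    obtain ⟨f, hf, h⟩ := exists_parentGraph_eq (Finset.mem_filter.1 hT).2 j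
    exact ⟨f, mem_rootedMaps.2 hf, h⟩
  · intro f hf
    have hf' := mem_rootedMaps.1 hf
    rw [hf'.edgeFinset_parentGraph, Finset.prod_image]
    intro u hu v hv h
    exact hf'.injOn_edge (by simpa using hu) (by simpa using hv) h

end Trees

/-- The edge weights being symmetric, every root j yields the same sum over spanning trees, which
factors out. -/
theorem eval_one_diagPoly (c : ℝ) {N : ℕ} (lam : Fin N → ℝ) (q : Fin N → Fin N → ℂ) :
    MvPolynomial.eval (fun _ => 1) (diagPoly c lam q) = treeSum c lam * ∑ i, ∑ j, q i j := by
  have h : ∀ j : Fin N, ((treeSum c lam : ℝ) : ℂ) = ∑ f ∈ rootedMaps j,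
      ∏ v ∈ Finset.univ.erase j, (phi c (lam v - lam (f v)) : ℂ) := by
    intro j
    have := sum_isTree_eq_sum_rootedMaps (edgeWeight c lam) j
    rw [treeSum, this]
    push_cast
    rfl
  simp only [diagPoly, map_sum, map_mul, map_prod, MvPolynomial.eval_C, MvPolynomial.eval_X,
    Finset.prod_const_one, mul_one, ← Finset.mul_sum, ← h]
  simp only [← Finset.sum_mul]
  ring

end BoseGas


namespace BoseGas

/-! ### Paths and the coefficient of e₁⋯e_N -/

section Chains

variable {n : ℕ}

/-- The monomial of a parent function `f` with root `j` and a vertex `i` is the product of all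
variables exactly if the map obtained from `f` by sending `j` to `i` is bijective. -/
theorem coeff_ones_X_mul_prod {V : Type} [Fintype V] [DecidableEq V] (i j : V) (f : V → V)
    [Decidable (Function.Bijective (Function.update f j i))] :
    MvPolynomial.coeff (Finsupp.equivFunOnFinite.symm fun _ => 1)
      (MvPolynomial.X i * ∏ v ∈ Finset.univ.erase j, MvPolynomial.X (f v) : MvPolynomial V ℂ) =
      if Function.Bijective (Function.update f j i) then 1 else 0 := by
  have h1 : (MvPolynomial.X i * ∏ v ∈ Finset.univ.erase j, MvPolynomial.X (f v) :
      MvPolynomial V ℂ) = ∏ v, MvPolynomial.X (Function.update f j i v) := by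
    rw [← Finset.mul_prod_erase _ _ (Finset.mem_univ j), Function.update_self]
    congr 1
    exact Finset.prod_congr rfl fun v hv => by
      rw [Function.update_of_ne (Finset.ne_of_mem_erase hv)]
  have h2 : (∏ v, MvPolynomial.X (Function.update f j i v) : MvPolynomial V ℂ) =
      MvPolynomial.monomial (∑ v, Finsupp.single (Function.update f j i v) 1) 1 := by
    rw [MvPolynomial.monomial_sum_one]
    rfl
  rw [h1, h2, MvPolynomial.coeff_monomial]
  congr 1
  rw [eq_iff_iff]
  set h := Function.update f j i
  have h3 : ∀ u, (∑ v, Finsupp.single (h v) 1 : V →₀ ℕ) u =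
      (Finset.univ.filter fun v => h v = u).card := by
    intro u
    rw [Finsupp.finsetSum_apply, Finset.card_filter]
    exact Finset.sum_congr rfl fun v _ => by rw [Finsupp.single_apply]
  constructor
  · intro heq
    refine Finite.surjective_iff_bijective.1 fun u => ?_
    have := h3 u
    rw [heq] at this
    have h4 : 0 < (Finset.univ.filter fun v => h v = u).card := by
      rw [← this]; simp
    obtain ⟨v, hv⟩ := Finset.card_pos.1 h4
    exact ⟨v, (Finset.mem_filter.1 hv).2⟩
  · intro hb
    ext u
    rw [h3]
    obtain ⟨v, hv, hu⟩ := hb.existsUnique u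
    simp only [Finsupp.equivFunOnFinite_symm_apply_apply]
    rw [Finset.card_eq_one]
    refine ⟨v, ?_⟩
    ext w
    simp only [Finset.mem_filter, Finset.mem_univ, true_and, Finset.mem_singleton]
    exact ⟨hu w, fun hw => hw ▸ hv⟩

/-- The parent function of the path `σ 0, σ 1, …, σ n` with root `σ n`. -/
def pathMap (σ : Equiv.Perm (Fin (n + 1))) : Fin (n + 1) → Fin (n + 1) :=
  Function.update (σ ∘ finRotate (n + 1) ∘ σ.symm) (σ (Fin.last n)) (σ (Fin.last n))

theorem pathMap_last (σ : Equiv.Perm (Fin (n + 1))) :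
    pathMap σ (σ (Fin.last n)) = σ (Fin.last n) := Function.update_self _ _ _

theorem pathMap_castSucc (σ : Equiv.Perm (Fin (n + 1))) (k : Fin n) :
    pathMap σ (σ k.castSucc) = σ k.succ := by
  rw [pathMap, Function.update_of_ne]
  · simp [finRotate_apply]
  · exact fun h => (Fin.castSucc_lt_last k).ne (σ.injective h)

theorem isRootedMap_pathMap (σ : Equiv.Perm (Fin (n + 1))) :
    IsRootedMap (pathMap σ) (σ (Fin.last n)) := by
  refine isRootedMap_of_depth (pathMap_last σ) (fun v => n - (σ.symm v : ℕ)) fun v hv => ?_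
  obtain ⟨k, rfl⟩ := σ.surjective v
  have hk : k ≠ Fin.last n := fun h => hv (h ▸ rfl)
  obtain ⟨k, rfl⟩ := Fin.exists_castSucc_eq.2 hk
  rw [pathMap_castSucc]
  simp
  omega

/-- Sending the end of the path back to its start closes it to a cycle, in particular a bijection.
-/
theorem update_pathMap (σ : Equiv.Perm (Fin (n + 1))) :
    Function.update (pathMap σ) (σ (Fin.last n)) (σ 0) = σ ∘ finRotate (n + 1) ∘ σ.symm := by
  rw [pathMap, Function.update_idem]
  refine Function.update_eq_self_iff.2 ?_
  simp

/-- Injectivity away from the root forbids branching, so distinct vertices have distinct depths. The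
depths then fill 0, …, n, and σ lists the vertices by decreasing depth. -/
theorem exists_pathMap_eq (i j : Fin (n + 1)) (f : Fin (n + 1) → Fin (n + 1))
    (hf : IsRootedMap f j) (hb : Function.Bijective (Function.update f j i)) :
    ∃ σ : Equiv.Perm (Fin (n + 1)), σ 0 = i ∧ σ (Fin.last n) = j ∧ pathMap σ = f := by
  obtain ⟨d, hd0, hd⟩ := hf.exists_depth
  have hd0' : ∀ v, d v = 0 → v = j := fun v hv => by
    by_contra h; have := hd v h; omega
  have hinj : Function.Injective d := by
    intro u v huv
    induction hm : d u generalizing u v with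
    | zero => rw [hd0' u hm, hd0' v (huv ▸ hm)]
    | succ m ih =>
      have hu : u ≠ j := by rintro rfl; omega
      have hv : v ≠ j := by rintro rfl; omega
      have h1 := hd u hu
      have h2 := hd v hv
      have h3 : f u = f v := ih (by omega) (by omega)
      refine hb.injective ?_
      rw [Function.update_of_ne hu, Function.update_of_ne hv, h3]
  have hlow : ∀ m, ∀ v, d v = m → ∀ k ≤ m, ∃ u, d u = k := by
    intro m
    induction m with
    | zero => intro v hv k hk; exact ⟨v, by omega⟩
    | succ m ih =>
      intro v hv k hk
      rcases Nat.lt_or_ge m k with h | h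
      · exact ⟨v, by omega⟩
      · exact ih (f v) (by have := hd v (by rintro rfl; omega); omega) k h
  have hlt : ∀ v, d v < n + 1 := by
    intro v
    by_contra hv
    choose u hu using fun k : Fin (n + 2) => hlow _ v rfl k (by omega)
    have : Function.Injective u := fun a b hab => by
      have := hu a; rw [hab, hu b] at this; exact Fin.ext this.symm
    have := Fintype.card_le_of_injective u this
    simp at this
  let D : Fin (n + 1) → Fin (n + 1) := fun v => Fin.rev ⟨d v, hlt v⟩
  have hD : Function.Injective D := fun u v h => hinj (by simpa [D] using h)
  let σ : Equiv.Perm (Fin (n + 1)) := (Equiv.ofBijective D (Finite.injective_iff_bijective.1 hD)).symm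
  have hσ : ∀ k, d (σ k) = n - k := by
    intro k
    have h : D (σ k) = k := Equiv.ofBijective_apply_symm_apply D _ k
    have := congrArg Fin.val h
    simp only [D, Fin.val_rev] at this
    have := hlt (σ k)
    omega
  have hlast : σ (Fin.last n) = j := hd0' _ (by rw [hσ]; simp)
  -- The vertex of maximal depth n is nobody's parent, so its preimage under the bijection can only
  -- be j, which is sent to i.
  have hz : σ 0 = i := by
    obtain ⟨v, hv⟩ := hb.surjective (σ 0)
    by_cases hvj : v = j
    · rw [hvj, Function.update_self] at hv
      exact hv.symm
    · rw [Function.update_of_ne hvj] at hv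
      have h1 := hd v hvj
      rw [hv, hσ] at h1
      have := hlt v
      simp at h1
      omega
  refine ⟨σ, hz, hlast, ?_⟩
  ext v : 1
  obtain ⟨k, rfl⟩ := σ.surjective v
  by_cases hk : k = Fin.last n
  · rw [hk, pathMap_last, hlast, hf.1]
  · obtain ⟨k, rfl⟩ := Fin.exists_castSucc_eq.2 hk
    rw [pathMap_castSucc]
    refine hinj ?_
    have h1 := hd (σ k.castSucc) (fun h => hk (σ.injective (h.trans hlast.symm)))
    rw [hσ] at h1 ⊢
    simp at h1 ⊢
    omega

theorem pathMap_injective {σ τ : Equiv.Perm (Fin (n + 1))} (h0 : σ 0 = τ 0)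
    (h : pathMap σ = pathMap τ) : σ = τ := by
  ext k : 1
  induction k using Fin.induction with
  | zero => exact h0
  | succ k ih => rw [← pathMap_castSucc, ← pathMap_castSucc, ih, h]

theorem prod_pathMap {R : Type} [CommMonoid R] (σ : Equiv.Perm (Fin (n + 1)))
    (w : Fin (n + 1) → Fin (n + 1) → R) :
    ∏ v ∈ Finset.univ.erase (σ (Fin.last n)), w v (pathMap σ v) =
      ∏ k : Fin n, w (σ k.castSucc) (σ k.succ) := by
  refine (Finset.prod_bij (fun k _ => σ k.castSucc) ?_ ?_ ?_ ?_).symm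
  · intro k _
    exact Finset.mem_erase.2 ⟨fun h => (Fin.castSucc_lt_last k).ne (σ.injective h),
      Finset.mem_univ _⟩
  · intro k _ l _ h
    exact Fin.castSucc_injective n (σ.injective h)
  · intro v hv
    obtain ⟨k, rfl⟩ := σ.surjective v
    obtain ⟨k, rfl⟩ := Fin.exists_castSucc_eq.2 fun h => Finset.ne_of_mem_erase hv (h ▸ rfl)
    exact ⟨k, Finset.mem_univ _, rfl⟩
  · intro k _
    rw [pathMap_castSucc]

open Classical in
/-- The coefficient of the product of all shifts. -/
theorem coeff_ones_diagPoly (c : ℝ) (lam : Fin (n + 1) → ℝ)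
    (q : Fin (n + 1) → Fin (n + 1) → ℂ) :
    (diagPoly c lam q).coeff (Finsupp.equivFunOnFinite.symm fun _ => 1) =
      ∑ σ : Equiv.Perm (Fin (n + 1)), (chain c lam σ : ℂ) * q (σ 0) (σ (Fin.last n)) := by
  simp only [diagPoly, MvPolynomial.coeff_sum, MvPolynomial.coeff_C_mul, coeff_ones_X_mul_prod,
    mul_ite, mul_one, mul_zero]
  simp only [rootedMaps, Finset.sum_filter]
  rw [← Fintype.sum_prod_type', ← Fintype.sum_prod_type']
  simp only [← ite_and]
  rw [← Finset.sum_filter]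
  symm
  refine Finset.sum_bij (fun σ _ => ((σ 0, σ (Fin.last n)), pathMap σ)) ?_ ?_ ?_ ?_
  · intro σ _
    refine Finset.mem_filter.2 ⟨Finset.mem_univ _, isRootedMap_pathMap σ, ?_⟩
    rw [update_pathMap]
    exact σ.bijective.comp ((finRotate (n + 1)).bijective.comp σ.symm.bijective)
  · intro σ _ τ _ h
    simp only [Prod.mk.injEq] at h
    exact pathMap_injective h.1.1 h.2
  · rintro ⟨⟨i, j⟩, f⟩ h
    obtain ⟨-, h1, h2⟩ := Finset.mem_filter.1 h
    obtain ⟨σ, rfl, rfl, rfl⟩ := exists_pathMap_eq i j f h1 h2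
    exact ⟨σ, Finset.mem_univ _, rfl⟩
  · intro σ _
    rw [prod_pathMap σ fun v u => (phi c (lam v - lam u) : ℂ), chain]
    push_cast
    ring

end Chains

end BoseGas


namespace BoseGas

/-! ### Diagonal limits and the theorem -/

section Diagonal

variable {N : ℕ}

theorem nearDiag_eq (c : ℝ) (k : ℕ) (lam : Fin N → ℝ) (ε : Fin N → ℂ) :
    nearDiag c k lam ε = (ffNorm c (fun i => (lam i : ℂ)) fun i => lam i + ε i)⁻¹ *
      formFactorABA c k (fun i => (lam i : ℂ) + ε i) fun i => (lam (Fin.rev i) : ℂ) := rfl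

/-- The limits of the near-diagonal form factors. -/
theorem tendsto_nearDiag (c : ℝ) (hc : c ≠ 0) (lam : Fin N → ℝ) (hlam : Function.Injective lam)
    (e : Fin N → ℂ) (he : ∀ i, e i ≠ 0) :
    Tendsto (fun t : ℂ => nearDiag c 1 lam fun i => t * e i) (𝓝[≠] 0)
      (𝓝 (MvPolynomial.eval e (diagPoly c lam fun _ _ => 1) / ∏ i, e i)) ∧
    Tendsto (fun t : ℂ => nearDiag c 2 lam fun i => t * e i) (𝓝[≠] 0)
      (𝓝 (MvPolynomial.eval e (diagPoly c lam fun i j => (((lam i - lam j) ^ 2 / c : ℝ) : ℂ)) /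
        ∏ i, e i)) := by
  -- Here d = |α| + |β| and N - d = n, so κ and μ extract the moments n² and n⁴ of the generating
  -- function.
  obtain ⟨κ, hκ⟩ := exists_interpolation (2 * N) fun d => ((N : ℂ) - d) ^ 2
  obtain ⟨μ, hμ⟩ := exists_interpolation (2 * N) fun d => ((N : ℂ) - d) ^ 4
  obtain ⟨h1, h2⟩ := sum_limDet c hc lam e κ μ hκ hμ
  have ht2 := tendsto_moment c hc lam hlam e he 2 κ hκ
  have ht4 := tendsto_moment c hc lam hlam e he 4 μ hμ
  rw [← sum_adjugate_gaudin c lam e he _ fun _ _ => rfl, ← sum_adjugate_gaudin c lam e he _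
    fun i j => by rw [← neg_sub (lam i), neg_sq]]
  simp only [mul_one]
  rw [← h1, ← h2]
  have hev := (eventually_generic c hc lam hlam e he).mono fun t ht =>
    formFactorABA_eq c hc (fun i => (lam i : ℂ)) (fun i => lam i + t * e i) ht.1
      fun i j hij => div_ne_zero (ht.2 i j) (sub_ne_zero.2 (ht.1.ne hij))
  constructor
  · refine ((ht2.const_mul (1 / 2)).const_mul ((c : ℂ) * (-1) ^ (N + 1))).congr' ?_
    filter_upwards [hev] with t ht
    rw [nearDiag_eq, ht.1]
    ring
  · refine (((ht4.sub ht2).const_mul (1 / 6)).const_mul ((c : ℂ) ^ 2 * (-1) ^ N)).congr' ?_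
    filter_upwards [hev] with t ht
    rw [nearDiag_eq, ht.2]
    ring

theorem sum_sum_eq_two_mul_sum_Ioi (g : Fin N → Fin N → ℝ) (h0 : ∀ i, g i i = 0)
    (hg : ∀ i j, g i j = g j i) :
    ∑ i, ∑ j, g i j = 2 * ∑ i, ∑ j ∈ Finset.Ioi i, g i j := by
  have h := Finset.sum_sum_Ioi_add_eq_sum_sum_off_diag fun j i => g i j
  simp only [fun i j => hg j i, ← two_mul, ← Finset.mul_sum] at h
  rw [h]
  refine Finset.sum_congr rfl fun i _ => ?_
  rw [Finset.compl_singleton, ← Finset.add_sum_erase _ _ (Finset.mem_univ i), h0, zero_add]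

end Diagonal

end BoseGas

theorem mainTheorem7 (c : ℝ) (hc : c ≠ 0) (n : ℕ) (lam : Fin (n + 1) → ℝ)
    (hlam : Function.Injective lam) :
    BoseGas.IsSymmetricDiag c 1 lam
      ((((n + 1 : ℕ) : ℝ) ^ 2 * BoseGas.treeSum c lam : ℝ) : ℂ) ∧
    BoseGas.IsSymmetricDiag c 2 lam
      ((2 / c * BoseGas.treeSum c lam *
        ∑ i : Fin (n + 1), ∑ j ∈ Finset.Ioi i, (lam i - lam j) ^ 2 : ℝ) : ℂ) ∧
    BoseGas.IsConnectedDiag c 1 lam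
      ((∑ σ : Equiv.Perm (Fin (n + 1)), BoseGas.chain c lam σ : ℝ) : ℂ) ∧
    BoseGas.IsConnectedDiag c 2 lam
      ((1 / c * ∑ σ : Equiv.Perm (Fin (n + 1)),
        BoseGas.chain c lam σ * (lam (σ 0) - lam (σ (Fin.last n))) ^ 2 : ℝ) : ℂ) := by
  -- Equal shifts are the direction e = 1, so the symmetric value is that of the same limit
  -- polynomial at this point.
  obtain ⟨hs1, hs2⟩ := BoseGas.tendsto_nearDiag c hc lam hlam (fun _ => 1) fun _ => one_ne_zero
  rw [Finset.prod_const_one, div_one, BoseGas.eval_one_diagPoly] at hs1 hs2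
  simp only [mul_one] at hs1 hs2
  refine ⟨?_, ?_, ⟨_, BoseGas.isHomogeneous_diagPoly c lam fun _ _ => 1, fun e he =>
    (BoseGas.tendsto_nearDiag c hc lam hlam e he).1, ?_⟩, ⟨_, BoseGas.isHomogeneous_diagPoly c lam
    fun i j => (((lam i - lam j) ^ 2 / c : ℝ) : ℂ), fun e he =>
    (BoseGas.tendsto_nearDiag c hc lam hlam e he).2, ?_⟩⟩
  · unfold BoseGas.IsSymmetricDiag
    convert hs1 using 2
    simp
    ring
  · unfold BoseGas.IsSymmetricDiag
    convert hs2 using 2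
    have h := BoseGas.sum_sum_eq_two_mul_sum_Ioi (fun i j => (lam i - lam j) ^ 2) (by simp)
      fun i j => by rw [← neg_sub (lam i), neg_sq]
    have h' : ∑ i, ∑ j, (lam i - lam j) ^ 2 / c =
        2 / c * ∑ i, ∑ j ∈ Finset.Ioi i, (lam i - lam j) ^ 2 := by
      simp only [← Finset.sum_div]
      rw [h]
      ring
    simp only [← Complex.ofReal_sum]
    rw [h', ← Complex.ofReal_mul]
    congr 1
    ring
  · rw [BoseGas.coeff_ones_diagPoly]
    simp
  · rw [BoseGas.coeff_ones_diagPoly]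
    push_cast
    rw [Finset.mul_sum]
    exact Finset.sum_congr rfl fun σ _ => by ring
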